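/- **Sticky particles.** Let $\mu_0$ be a Radon measure on $\mathbb R$ with support $\mathbb R$ and let $u_0:\mathbb R\to\mathbb R$ be locally $\mu_0$-integrable with $u_0(x)/x\to0$ as $|x|\to\infty$ and satisfy the negative jump condition $$\limsup_{\varepsilon\downarrow0}\frac{\int_{[x-\varepsilon,x)}u_0\,d\mu_0}{\mu_0[x-\varepsilon,x)}\ \ge\ u_0(x)\ \ge\ \liminf_{\varepsilon\downarrow0}\frac{\int_{(x,x+\varepsilon]}u_0\,d\mu_0}{\mu_0(x,x+\varepsilon]}\qquad\text{for all }x\in\mathbb R.$$ Let $\phi_{0,t}(a)$ be the position at time $t\ge0$ of the particle starting at $a$ in the sticky particle dynamics with initial mass distribution $\mu_0$ and initial velocity $u_0$, given by the generalized variational principle $$\phi_{0,t}(a)=\inf_{d>a}\ \sup_{c<a}\ \frac1{\mu_0([c,d])}\int_{[c,d]}(\eta+t\,u_0(\eta))\,d\mu_0(\eta),$$ i.e. the slope at $a$ of the lower convex hull, in the mass coordinate, of the potential of $\eta+tu_0(\eta)$. Let $\alpha(x,0,t)=\min\phi_{0,t}^{-1}\{x\}$ and $\beta(x,0,t)=\max\phi_{0,t}^{-1}\{x\}$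 be the ends of the cluster located at $x$ at time $t$, and let $u(x,t)$ be the velocity field: the right derivative at time $t$ of $s\mapsto\phi_{0,s}(a)$ for a particle $a$ with $\phi_{0,t}(a)=x$. The first shock time of $a$ is $$\tau(a)=\inf\{t>0:\ u(\phi_{0,t}(a)^-,t)\neq u(\phi_{0,t}(a)^+,t)\}\in[0,\infty].$$ If $\tau(a)<\infty$, the turbulent interval of $a$ is the greatest interval $[A,B]\ni a$ such that $\tau(a')=\tau(a)$ and $\phi_{0,\tau(a)}(a')=\phi_{0,\tau(a)}(a)=:x$ for all $a'\in[A,B]$; put $\alpha=\alpha(x,0,\tau(a))$ and $\beta=\beta(x,0,\tau(a))$. If $\tau(a)=\infty$, put $A=B=\alpha=\beta=a$. Let $X_0$ be a measurable real function on a measure space $(\Omega,\mathcal F,P)$ with $P\circ X_0^{-1}=\mu_0$, let $\gamma=\tau(X_0)$, and for $t\ge0$, with $A,B,\alpha,\beta$ taken at $a=X_0$, put $$Z^1_t=\phi_{0,t}(A),\quad Z^2_t=\phi_{0,t}(B),\quad Z^3_t=\phi_{0,t}(\alpha),\quad Z^4_t=\phi_{0,t}(\beta).$$ **Backward notions.**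 For a process $Z$ let $\mathcal F^Z_t=\sigma(Z_s,\ s\ge t)$, a non-increasing filtration. A backward martingale with respect to $\mathcal F^Z$ is an adapted integrable process $M$ with $\mathbb E[M_s\mid\mathcal F^Z_t]=M_t$ a.s. for $s\le t$. A backward càdlàg semimartingale with respect to $\mathcal F^Z$ is the sum of a backward martingale and of an adapted process with paths of locally bounded variation, both with almost surely càdlàg paths. **Corollary (Turbulence semi-martingales).** Let $Z$ be any of $Z^1,Z^2,Z^3,Z^4$. Then each $Z_t$ is measurable and $Z$ is Markov, and the process $t\mapsto u(Z_t,t)\mathbf 1_{\gamma>t}$ is adapted to $\mathcal F^Z$, with almost every path of bounded variation on $[0,\infty)$. If moreover $u_0$ is $\mu_0$-integrable, then: 1. $t\mapsto u(Z_t,t)\mathbf 1_{\gamma\le t}$ is a backward càdlàg semimartingale with respect to $\mathcal F^Z$, and $t\mapsto u(Z_t,t)\mathbf 1_{\gamma\le t}+\mathbb E[u_0(X_0)\mid Z_0]\mathbf 1_{t<\gamma}$ is a backward martingale with respect to $\mathcal F^Z$; 2. $t\mapsto u(Z_t,t)$ is a backward càdlàg semimartingale with respect to $\mathcal F^Z$,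 and $t\mapsto u(Z_t,t)-\bigl(u_0(Z_0)-\mathbb E[u_0(X_0)\mid Z_0]\bigr)\mathbf 1_{t<\gamma}$ is a backward martingale with respect to $\mathcal F^Z$. -/

import Mathlib

open MeasureTheory Filter Topology Set
open scoped NNReal ENNReal

noncomputable section

namespace Sticky

/-! ### Admissible initial data -/

/-- Generalized left limit `u⁻(x) = limsup_{ε ↓ 0} μ[x-ε,x)⁻¹ ∫_{[x-ε,x)} u dμ`, in `[-∞, ∞]`. -/
def genLeft (μ : Measure ℝ) (u : ℝ → ℝ) (x : ℝ) : EReal :=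
  limsup (fun ε : ℝ => ((⨍ η in Ico (x - ε) x, u η ∂μ : ℝ) : EReal)) (𝓝[>] 0)

/-- Generalized right limit `u⁺(x) = liminf_{ε ↓ 0} μ(x,x+ε]⁻¹ ∫_{(x,x+ε]} u dμ`, in `[-∞, ∞]`. -/
def genRight (μ : Measure ℝ) (u : ℝ → ℝ) (x : ℝ) : EReal :=
  liminf (fun ε : ℝ => ((⨍ η in Ioc x (x + ε), u η ∂μ : ℝ) : EReal)) (𝓝[>] 0)

/-- Admissible initial data: a Radon measure `μ` with support `ℝ` and a locally `μ`-integrable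
velocity `u`, with `u(x)/x → 0` as `|x| → ∞`, satisfying the negative jump condition
`u⁻(x) ≥ u(x) ≥ u⁺(x)` for all `x`. -/
structure Admissible (μ : Measure ℝ) (u : ℝ → ℝ) : Prop where
  locallyFinite : IsLocallyFiniteMeasure μ
  fullSupport : ∀ x ε : ℝ, 0 < ε → 0 < μ (Ioo (x - ε) (x + ε))
  locallyIntegrable : LocallyIntegrable u μ
  sublinear : Tendsto (fun x => u x / x) (cocompact ℝ) (𝓝 0)
  negJump : ∀ x, (u x : EReal) ≤ genLeft μ u x ∧ genRight μ u x ≤ (u x : EReal)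

/-! ### The sticky particle flow and its velocity field -/

/-- The position at time `t` of the centre of mass of the particles starting in `[c,d]`, if these
particles meet no others (momentum is conserved): `μ[c,d]⁻¹ ∫_{[c,d]} (η + t u(η)) dμ(η)`. -/
def barycentre (μ : Measure ℝ) (u : ℝ → ℝ) (t c d : ℝ) : ℝ :=
  ⨍ η in Icc c d, (η + t * u η) ∂μ

/-- The sticky particle flow `φ_{0,t}(a)`, for `t ≥ 0`. In the mass coordinate `m = μ((·, η])`,
`barycentre` is the slope of a chord of the potential whose derivative is `η + t u(η)`; the
inf-sup of these slopes over chords around `a` is the slope at `a` of the lower convex hull of the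
potential (generalized variational principle). For admissible data all the infima and suprema
below are finite. -/
def flow (μ : Measure ℝ) (u : ℝ → ℝ) (t a : ℝ) : ℝ :=
  ⨅ d : Ioi a, ⨆ c : Iio a, barycentre μ u t (c : ℝ) (d : ℝ)

/-- The left end `α(x,0,t)` of the cluster `{a : φ_{0,t}(a) = x}`. -/
def clusterLeft (μ : Measure ℝ) (u : ℝ → ℝ) (x t : ℝ) : ℝ :=
  sInf {a | flow μ u t a = x}

/-- The right end `β(x,0,t)` of the cluster `{a : φ_{0,t}(a) = x}`. -/
def clusterRight (μ : Measure ℝ) (u : ℝ → ℝ) (x t : ℝ) : ℝ :=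
  sSup {a | flow μ u t a = x}

/-- The velocity field `u(x,t)`: the right derivative at time `t` of the path
`s ↦ φ_{0,s}(a)` of a particle `a` with `φ_{0,t}(a) = x`. All such particles stay together after
`t`, so the choice `a = α(x,0,t)` is immaterial. -/
def velocity (μ : Measure ℝ) (u : ℝ → ℝ) (x t : ℝ) : ℝ :=
  derivWithin (fun s => flow μ u s (clusterLeft μ u x t)) (Ici t) t

/-! ### Shock times and turbulent intervals -/

/-- The particle `a` is in a shock at time `t`: the one-sided limits of `u(·,t)` at
`φ_{0,t}(a)` differ. -/
def InShock (μ : Measure ℝ) (u : ℝ → ℝ) (a t : ℝ) : Prop :=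
  Function.leftLim (fun y => velocity μ u y t) (flow μ u t a) ≠
    Function.rightLim (fun y => velocity μ u y t) (flow μ u t a)

/-- The first shock time `τ(a) ∈ [0, ∞]`, equal to `∞` if the particle never enters a shock. The
one-sided limits of `u(·,t)` exist for `t > 0`. -/
def shockTime (μ : Measure ℝ) (u : ℝ → ℝ) (a : ℝ) : ℝ≥0∞ :=
  ⨅ (t : ℝ≥0) (_ : 0 < t ∧ InShock μ u a t), (t : ℝ≥0∞)

/-- The position `φ_{0,τ(a)}(a)` of the first shock of `a` (meaningful if `τ(a) < ∞`). -/
def shockPos (μ : Measure ℝ) (u : ℝ → ℝ) (a : ℝ) : ℝ :=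
  flow μ u (shockTime μ u a).toReal a

open Classical in
/-- The turbulent interval of `a`: the greatest interval containing `a` all of whose particles have
the first shock time and the first shock position of `a`; it is `{a}` if `τ(a) = ∞`. -/
def turbInterval (μ : Measure ℝ) (u : ℝ → ℝ) (a : ℝ) : Set ℝ :=
  if shockTime μ u a = ∞ then {a}
  else {b | ∀ c ∈ uIcc a b,
    shockTime μ u c = shockTime μ u a ∧ shockPos μ u c = shockPos μ u a}

section Processes

variable {Ω : Type*}

/-- `Z¹`: the path of the left end of the turbulent interval of `X₀`. -/
def Z1 (μ : Measure ℝ) (u : ℝ → ℝ) (X₀ : Ω → ℝ) (t : ℝ≥0) (ω : Ω) : ℝ :=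
  flow μ u t (sInf (turbInterval μ u (X₀ ω)))

/-- `Z²`: the path of the right end of the turbulent interval of `X₀`. -/
def Z2 (μ : Measure ℝ) (u : ℝ → ℝ) (X₀ : Ω → ℝ) (t : ℝ≥0) (ω : Ω) : ℝ :=
  flow μ u t (sSup (turbInterval μ u (X₀ ω)))

open Classical in
/-- `Z³`: the path of the left end of the cluster which contains `X₀` at its first shock time. -/
def Z3 (μ : Measure ℝ) (u : ℝ → ℝ) (X₀ : Ω → ℝ) (t : ℝ≥0) (ω : Ω) : ℝ :=
  flow μ u t (if shockTime μ u (X₀ ω) = ∞ then X₀ ω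
    else clusterLeft μ u (shockPos μ u (X₀ ω)) (shockTime μ u (X₀ ω)).toReal)

open Classical in
/-- `Z⁴`: the path of the right end of the cluster which contains `X₀` at its first shock time. -/
def Z4 (μ : Measure ℝ) (u : ℝ → ℝ) (X₀ : Ω → ℝ) (t : ℝ≥0) (ω : Ω) : ℝ :=
  flow μ u t (if shockTime μ u (X₀ ω) = ∞ then X₀ ω
    else clusterRight μ u (shockPos μ u (X₀ ω)) (shockTime μ u (X₀ ω)).toReal)

/-! ### Backward processes -/

/-- The backward natural filtration `𝓕ᶻ_t = σ(Z_s, s ≥ t)`. -/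
@[reducible] def future (Z : ℝ≥0 → Ω → ℝ) (t : ℝ≥0) : MeasurableSpace Ω :=
  ⨆ (s : ℝ≥0) (_ : t ≤ s), MeasurableSpace.comap (Z s) inferInstance

/-- The forward natural filtration `σ(Z_s, s ≤ t)`. -/
@[reducible] def past (Z : ℝ≥0 → Ω → ℝ) (t : ℝ≥0) : MeasurableSpace Ω :=
  ⨆ (s : ℝ≥0) (_ : s ≤ t), MeasurableSpace.comap (Z s) inferInstance

/-- Right-continuous with left limits. -/
def IsCadlag (f : ℝ≥0 → ℝ) : Prop :=
  ∀ t, ContinuousWithinAt f (Ici t) t ∧ ∃ l, Tendsto f (𝓝[<] t) (𝓝 l)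

/-- `V_t` is `𝓖_t`-measurable for all `t`. -/
def IsAdapted (V : ℝ≥0 → Ω → ℝ) (𝓖 : ℝ≥0 → MeasurableSpace Ω) : Prop :=
  ∀ t, Measurable[𝓖 t] (V t)

variable [MeasurableSpace Ω]

/-- The Markov property: given the present, the past and the future are conditionally
independent. It is symmetric in time. -/
def IsMarkov (Z : ℝ≥0 → Ω → ℝ) (P : Measure Ω) : Prop :=
  ∀ t, ∀ A, MeasurableSet[past Z t] A → P A ≠ ∞ →
    ∀ B, MeasurableSet[future Z t] B → P B ≠ ∞ →
      P[(A ∩ B).indicator (fun _ => (1 : ℝ)) | MeasurableSpace.comap (Z t) inferInstance] =ᵐ[P]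
        fun ω =>
          (P[A.indicator (fun _ => (1 : ℝ)) | MeasurableSpace.comap (Z t) inferInstance]) ω *
          (P[B.indicator (fun _ => (1 : ℝ)) | MeasurableSpace.comap (Z t) inferInstance]) ω

/-- Backward martingales with respect to a non-increasing family `𝓖`:
`E[M_s | 𝓖_t] = M_t` for `s ≤ t`. -/
structure IsBackwardMartingale (M : ℝ≥0 → Ω → ℝ) (𝓖 : ℝ≥0 → MeasurableSpace Ω)
    (P : Measure Ω) : Prop where
  adapted : IsAdapted M 𝓖
  integrable : ∀ t, Integrable (M t) P
  condExp_eq : ∀ s t, s ≤ t → P[M s | 𝓖 t] =ᵐ[P] M t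

/-- Backward càdlàg semimartingales: sums of a càdlàg backward martingale and of an adapted
càdlàg process with paths of locally bounded variation. -/
def IsBackwardCadlagSemimartingale (V : ℝ≥0 → Ω → ℝ) (𝓖 : ℝ≥0 → MeasurableSpace Ω)
    (P : Measure Ω) : Prop :=
  ∃ M A : ℝ≥0 → Ω → ℝ,
    IsBackwardMartingale M 𝓖 P ∧ (∀ᵐ ω ∂P, IsCadlag fun t => M t ω) ∧
    IsAdapted A 𝓖 ∧ (∀ᵐ ω ∂P, IsCadlag fun t => A t ω) ∧
    (∀ᵐ ω ∂P, LocallyBoundedVariationOn (fun t => A t ω) univ) ∧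
    ∀ t ω, V t ω = M t ω + A t ω

end Processes

end Sticky

end

/-!
For `t ≥ 0` and `x` the primitive of `η + t u(η) - x` with respect to `μ` is, in the mass
coordinate, the potential minus a line of slope `x`. Where it is minimal, the potential touches its
convex hull (`IsContact`). A minimum exists because `η + t u(η) - x` has the sign of `η` for large
`|η|`. It might be attained on one side only of an atom `c`; the negative jump condition excludes
this, and yields `x = c + t u(c)` at every contact point (`Admissible.exists_isContact`,
`IsContact.eq`). As `φ_{0,t}(c) = x` there (`IsContact.flow_eq`), the flow is monotone, surjective
and continuous; and both ends of every cluster are contact points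
(`Admissible.isContact_clusterLeft`, `Admissible.isContact_clusterRight`). Combining the contact
inequalities of two times so as to eliminate `u` shows that particles which have met stay together
(`Admissible.flow_eq_of_le`), and more: the ends of a cluster have met no other particle before
(`Admissible.eq_of_flow_eq_clusterLeft`). On a cluster `[c,d]` the velocity is `(x - mean of η over
[c,d]) / t`, that is the mean of `u` over `[c,d]` if `c < d` and `u(c)` if `c = d`
(`Admissible.velocity_of_lt`, `Admissible.velocity_of_eq`). Its one-sided limits in `x` are `(x - c)
/ t` and `(x - d) / t`, so that a particle is in a shock exactly when its cluster is non-trivial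
(`Admissible.inShock_iff`).

Each of the four processes is `φ_{0,t}(p(X₀))`, where the map `p` replaces a particle by one which
has met no other before the first shock time `τ` and meets the particle at time `τ`
(`IsRepresentative`, `Admissible.exists_isRepresentative`). As trajectories merge but never split,
`Z_s` is a function of `Z_t` for `s ≥ t`; hence the future σ-algebra is `σ(Z_t)` and `Z` is Markov.
Before `τ` the representative is alone in its cluster, so `{t < τ} ∈ σ(Z_t)`, the variables `Z_t`
and `Z_0` determine each other on this event, and the velocity of `Z_t` is the constant `u(Z_0)`.

The martingales are versions of `t ↦ E[u(X₀) | Z_t]` (`IsRepresentative.condExp_eq`): before `τ`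
this is `E[u(X₀) | Z_0]`; from `τ` on it is the velocity of `Z_t`, by conservation of momentum in a
non-trivial cluster, and because `Z_t` determines `X₀` in a trivial one. The paths are càdlàg since
the clusters of a particle depend on time in a càdlàg manner. At time zero this requires Lebesgue's
differentiation theorem for intervals that are not centred, for an arbitrary Radon measure
(`Admissible.ae_tendsto_average`); it follows from the theorem for Lebesgue measure by the quantile
transform. The finite variation parts are constant before `τ` and vanish from `τ` on.
-/

noncomputable section

namespace Sticky

/-! ### Set integrals over intervals -/

/-- Set integrals converge as soon as the sets converge pointwise and stay inside a fixed set on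
which the function is integrable. -/
theorem tendsto_setIntegral_of_eventually_mem_iff {ι : Type*} {l : Filter ι}
    [l.IsCountablyGenerated] {μ : Measure ℝ} {f : ℝ → ℝ} {S : ι → Set ℝ} {S₀ B : Set ℝ}
    (hB : MeasurableSet B) (hf : IntegrableOn f B μ) (hS : ∀ᶠ i in l, MeasurableSet (S i))
    (hSB : ∀ᶠ i in l, S i ⊆ B) (hS₀ : MeasurableSet S₀)
    (h : ∀ x, ∀ᶠ i in l, (x ∈ S i ↔ x ∈ S₀)) :
    Tendsto (fun i => ∫ x in S i, f x ∂μ) l (𝓝 (∫ x in S₀, f x ∂μ)) := by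
  have key : Tendsto (fun i => ∫ x, (S i).indicator f x ∂μ) l (𝓝 (∫ x, S₀.indicator f x ∂μ)) := by
    refine tendsto_integral_filter_of_dominated_convergence (B.indicator fun x => ‖f x‖) ?_ ?_ ?_ ?_
    · filter_upwards [hS, hSB] with i hi hiB
      exact ((hf.mono_set hiB).integrable_indicator hi).aestronglyMeasurable
    · filter_upwards [hSB] with i hiB
      refine Eventually.of_forall fun x => ?_
      rw [norm_indicator_eq_indicator_norm]
      exact indicator_le_indicator_of_subset hiB (fun _ => norm_nonneg _) x
    · exact (integrable_indicator_iff hB).2 hf.norm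
    · refine Eventually.of_forall fun x => ?_
      refine tendsto_const_nhds.congr' ?_
      filter_upwards [h x] with i hi
      by_cases hx : x ∈ S₀
      · rw [indicator_of_mem hx, indicator_of_mem (hi.2 hx)]
      · rw [indicator_of_notMem hx, indicator_of_notMem (fun hh => hx (hi.1 hh))]
  rw [integral_indicator hS₀] at key
  refine key.congr' ?_
  filter_upwards [hS] with i hi
  rw [integral_indicator hi]

section Intervals

variable {μ : Measure ℝ} {f : ℝ → ℝ}

theorem integrableOn_of_bdd (hf : LocallyIntegrable f μ) {s : Set ℝ} {a b : ℝ} (h : s ⊆ Icc a b) :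
    IntegrableOn f s μ :=
  (hf.integrableOn_isCompact isCompact_Icc).mono_set h

/-- The integral over `[c,d]` is continuous for intervals decreasing to `[c,d]`. -/
theorem tendsto_setIntegral_Icc_of_le {ι : Type*} {l : Filter ι} [l.IsCountablyGenerated]
    (hf : LocallyIntegrable f μ) {c d : ι → ℝ} {c₀ d₀ : ℝ} (hc : Tendsto c l (𝓝 c₀))
    (hd : Tendsto d l (𝓝 d₀)) (hc' : ∀ᶠ i in l, c i ≤ c₀) (hd' : ∀ᶠ i in l, d₀ ≤ d i) :
    Tendsto (fun i => ∫ x in Icc (c i) (d i), f x ∂μ) l (𝓝 (∫ x in Icc c₀ d₀, f x ∂μ)) := by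
  refine tendsto_setIntegral_of_eventually_mem_iff (B := Icc (c₀ - 1) (d₀ + 1)) measurableSet_Icc
    (integrableOn_of_bdd hf subset_rfl) (Eventually.of_forall fun _ => measurableSet_Icc) ?_
    measurableSet_Icc ?_
  · filter_upwards [hc.eventually (lt_mem_nhds (sub_one_lt c₀)),
      hd.eventually (gt_mem_nhds (lt_add_one d₀))] with i h1 h2
    exact Icc_subset_Icc h1.le h2.le
  · intro x
    by_cases hx : x ∈ Icc c₀ d₀
    · filter_upwards [hc', hd'] with i h1 h2
      exact iff_of_true ⟨h1.trans hx.1, hx.2.trans h2⟩ hx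
    · rcases not_and_or.1 hx with h | h
      · filter_upwards [hc.eventually (lt_mem_nhds (not_le.1 h))] with i h1
        exact iff_of_false (fun hh => absurd hh.1 (not_le.2 h1)) hx
      · filter_upwards [hd.eventually (gt_mem_nhds (not_le.1 h))] with i h1
        exact iff_of_false (fun hh => absurd hh.2 (not_le.2 h1)) hx

theorem tendsto_setIntegral_Ico_right {ι : Type*} {l : Filter ι} [l.IsCountablyGenerated]
    (hf : LocallyIntegrable f μ) {c : ι → ℝ} {b c₀ : ℝ} (hc : Tendsto c l (𝓝 c₀))
    (hc' : ∀ᶠ i in l, c i ≤ c₀) :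
    Tendsto (fun i => ∫ x in Ico b (c i), f x ∂μ) l (𝓝 (∫ x in Ico b c₀, f x ∂μ)) := by
  refine tendsto_setIntegral_of_eventually_mem_iff (B := Icc b c₀) measurableSet_Icc
    (integrableOn_of_bdd hf subset_rfl) (Eventually.of_forall fun _ => measurableSet_Ico) ?_
    measurableSet_Ico ?_
  · filter_upwards [hc'] with i h1
    exact Ico_subset_Icc_self.trans (Icc_subset_Icc_right h1)
  · intro x
    by_cases hx : x < c₀
    · filter_upwards [hc.eventually (lt_mem_nhds hx)] with i h1
      simp only [mem_Ico, h1, hx]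
    · filter_upwards [hc'] with i h1
      exact iff_of_false (fun hh => hx (hh.2.trans_le h1)) (fun hh => hx hh.2)

theorem tendsto_setIntegral_Ioc_left {ι : Type*} {l : Filter ι} [l.IsCountablyGenerated]
    (hf : LocallyIntegrable f μ) {c : ι → ℝ} {d c₀ : ℝ} (hc : Tendsto c l (𝓝 c₀))
    (hc' : ∀ᶠ i in l, c₀ ≤ c i) :
    Tendsto (fun i => ∫ x in Ioc (c i) d, f x ∂μ) l (𝓝 (∫ x in Ioc c₀ d, f x ∂μ)) := by
  refine tendsto_setIntegral_of_eventually_mem_iff (B := Icc c₀ d) measurableSet_Icc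
    (integrableOn_of_bdd hf subset_rfl) (Eventually.of_forall fun _ => measurableSet_Ioc) ?_
    measurableSet_Ioc ?_
  · filter_upwards [hc'] with i h1
    exact Ioc_subset_Icc_self.trans (Icc_subset_Icc_left h1)
  · intro x
    by_cases hx : c₀ < x
    · filter_upwards [hc.eventually (gt_mem_nhds hx)] with i h1
      simp only [mem_Ioc, h1, hx]
    · filter_upwards [hc'] with i h1
      exact iff_of_false (fun hh => hx (h1.trans_lt hh.1)) (fun hh => hx hh.1)

/-- The integral over `(b',c]` tends to the integral over `[b,c]` as `b' ↑ b`. -/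
theorem tendsto_setIntegral_Ioc_Iio (hf : LocallyIntegrable f μ) (b c : ℝ) :
    Tendsto (fun b' => ∫ x in Ioc b' c, f x ∂μ) (𝓝[<] b) (𝓝 (∫ x in Icc b c, f x ∂μ)) := by
  refine tendsto_setIntegral_of_eventually_mem_iff (B := Icc (b - 1) c) measurableSet_Icc
    (integrableOn_of_bdd hf subset_rfl) (Eventually.of_forall fun _ => measurableSet_Ioc) ?_
    measurableSet_Icc ?_
  · filter_upwards [mem_nhdsWithin_of_mem_nhds (lt_mem_nhds (sub_one_lt b))] with i h1
    exact Ioc_subset_Icc_self.trans (Icc_subset_Icc_left h1.le)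
  · intro x
    by_cases hx : b ≤ x
    · filter_upwards [self_mem_nhdsWithin] with i h1
      have : i < x := lt_of_lt_of_le h1 hx
      simp only [mem_Ioc, mem_Icc, this, hx]
    · filter_upwards [mem_nhdsWithin_of_mem_nhds (lt_mem_nhds (not_le.1 hx))] with i h1
      exact iff_of_false (fun hh => absurd hh.1 h1.not_gt) (fun hh => hx hh.1)

theorem setIntegral_Icc_eq_singleton_add_Ioc (hf : LocallyIntegrable f μ) {c d : ℝ} (h : c ≤ d) :
    ∫ x in Icc c d, f x ∂μ = ∫ x in {c}, f x ∂μ + ∫ x in Ioc c d, f x ∂μ := by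
  rw [← Icc_union_Ioc_eq_Icc le_rfl h, setIntegral_union _ measurableSet_Ioc
    (integrableOn_of_bdd hf subset_rfl) (integrableOn_of_bdd hf Ioc_subset_Icc_self), Icc_self]
  exact Set.disjoint_left.2 fun x hx hx' => absurd hx'.1 (not_lt.2 hx.2)

theorem setIntegral_Icc_eq_Ico_add_singleton (hf : LocallyIntegrable f μ) {c d : ℝ} (h : c ≤ d) :
    ∫ x in Icc c d, f x ∂μ = ∫ x in Ico c d, f x ∂μ + ∫ x in {d}, f x ∂μ := by
  rw [← Ico_union_Icc_eq_Icc h le_rfl, setIntegral_union _ measurableSet_Icc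
    (integrableOn_of_bdd hf Ico_subset_Icc_self) (integrableOn_of_bdd hf subset_rfl), Icc_self]
  exact Set.disjoint_left.2 fun x hx hx' => absurd hx.2 (not_lt.2 hx'.1)

theorem setIntegral_Icc_eq_Ico_add_Icc (hf : LocallyIntegrable f μ) {b c d : ℝ} (h : b ≤ c)
    (h' : c ≤ d) :
    ∫ x in Icc b d, f x ∂μ = ∫ x in Ico b c, f x ∂μ + ∫ x in Icc c d, f x ∂μ := by
  rw [← Ico_union_Icc_eq_Icc h h', setIntegral_union _ measurableSet_Icc
    (integrableOn_of_bdd hf Ico_subset_Icc_self) (integrableOn_of_bdd hf subset_rfl)]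
  exact Set.disjoint_left.2 fun x hx hx' => absurd hx.2 (not_lt.2 hx'.1)

theorem setIntegral_Icc_eq_Icc_add_Ioc (hf : LocallyIntegrable f μ) {b c d : ℝ} (h : b ≤ c)
    (h' : c ≤ d) :
    ∫ x in Icc b d, f x ∂μ = ∫ x in Icc b c, f x ∂μ + ∫ x in Ioc c d, f x ∂μ := by
  rw [← Icc_union_Ioc_eq_Icc h h', setIntegral_union _ measurableSet_Ioc
    (integrableOn_of_bdd hf subset_rfl) (integrableOn_of_bdd hf Ioc_subset_Icc_self)]
  exact Set.disjoint_left.2 fun x hx hx' => absurd hx'.1 (not_lt.2 hx.2)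

/-- The primitive of a locally integrable function which is non-positive near `-∞` and
non-negative near `+∞` attains its infimum, on one of the two sides of some point `c` (the sides
differ if `c` is an atom). -/
theorem exists_minimizing_cut (hf : LocallyIntegrable f μ) {K : ℝ} (hK : 0 ≤ K)
    (hneg : ∀ x ≤ -K, f x ≤ 0) (hpos : ∀ x, K ≤ x → 0 ≤ f x) :
    ∃ c, ((∀ b < c, ∫ x in Ico b c, f x ∂μ ≤ 0) ∧ ∀ d, c ≤ d → 0 ≤ ∫ x in Icc c d, f x ∂μ) ∨
      ((∀ b ≤ c, ∫ x in Icc b c, f x ∂μ ≤ 0) ∧ ∀ d, c < d → 0 ≤ ∫ x in Ioc c d, f x ∂μ) := by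
  have hint : ∀ a b, IntervalIntegrable f μ a b := fun a b =>
    intervalIntegrable_iff.2 (integrableOn_of_bdd hf (uIoc_subset_uIcc (a := a) (b := b)))
  set R : ℝ → ℝ := fun c => ∫ x in (0 : ℝ)..c, f x ∂μ with hR
  have hRsub : ∀ {c d}, c ≤ d → ∫ x in Ioc c d, f x ∂μ = R d - R c := by
    intro c d hcd
    rw [← intervalIntegral.integral_of_le hcd, hR]
    exact (intervalIntegral.integral_interval_sub_left (hint _ _) (hint _ _)).symm
  have hright : ∀ c, Tendsto R (𝓝[≥] c) (𝓝 (R c)) := by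
    intro c
    have h1 : Tendsto (fun d => ∫ x in Ioc c d, f x ∂μ) (𝓝[≥] c) (𝓝 (∫ x in Ioc c c, f x ∂μ)) := by
      refine tendsto_setIntegral_of_eventually_mem_iff (B := Icc c (c + 1)) measurableSet_Icc
        (integrableOn_of_bdd hf subset_rfl) (Eventually.of_forall fun _ => measurableSet_Ioc) ?_
        measurableSet_Ioc ?_
      · filter_upwards [mem_nhdsWithin_of_mem_nhds (gt_mem_nhds (lt_add_one c))] with i h1
        exact Ioc_subset_Icc_self.trans (Icc_subset_Icc_right h1.le)
      · intro x
        by_cases hx : c < x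
        · filter_upwards [mem_nhdsWithin_of_mem_nhds (gt_mem_nhds hx)] with i h1
          exact iff_of_false (fun hh => absurd hh.2 (not_le.2 h1)) (fun hh => absurd hh.2 (not_le.2 hx))
        · exact Eventually.of_forall fun i => iff_of_false (fun hh => hx hh.1) (fun hh => hx hh.1)
    have h2 : Tendsto (fun d => ∫ x in Ioc c d, f x ∂μ + R c) (𝓝[≥] c) (𝓝 (0 + R c)) := by
      simpa using h1.add_const (R c)
    rw [zero_add] at h2
    refine h2.congr' ?_
    filter_upwards [self_mem_nhdsWithin] with d hd
    rw [hRsub hd]; ring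
  have hleft : ∀ c, Tendsto R (𝓝[<] c) (𝓝 (R c - ∫ x in {c}, f x ∂μ)) := by
    intro c
    have h1 := tendsto_setIntegral_Ioc_Iio hf c c
    rw [Icc_self] at h1
    refine (h1.const_sub (R c)).congr' ?_
    filter_upwards [self_mem_nhdsWithin] with d hd
    rw [hRsub (le_of_lt hd)]; ring
  set m := sInf (R '' Icc (-K) K) with hm
  have hne : (R '' Icc (-K) K).Nonempty := ⟨R 0, 0, ⟨by linarith, hK⟩, rfl⟩
  have hbdd : BddBelow (R '' Icc (-K) K) := by
    refine ⟨R (-K) - ∫ x in Icc (-K) K, ‖f x‖ ∂μ, ?_⟩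
    rintro _ ⟨c, hc, rfl⟩
    have h1 := hRsub hc.1
    have h2 : ‖∫ x in Ioc (-K) c, f x ∂μ‖ ≤ ∫ x in Icc (-K) K, ‖f x‖ ∂μ := by
      refine (norm_integral_le_integral_norm _).trans ?_
      refine setIntegral_mono_set (integrableOn_of_bdd hf subset_rfl).norm
        (Eventually.of_forall fun _ => norm_nonneg _) ?_
      exact (Ioc_subset_Icc_self.trans (Icc_subset_Icc_right hc.2)).eventuallyLE
    have h3 := (abs_le.1 (Real.norm_eq_abs _ ▸ h2)).1
    linarith
  -- the infimum over `[-K, K]` is the infimum over the line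
  have hmin : ∀ c, m ≤ R c := by
    intro c
    rcases lt_or_ge c (-K) with h | h
    · have h1 := hRsub h.le
      have h2 : ∫ x in Ioc c (-K), f x ∂μ ≤ 0 :=
        setIntegral_nonpos measurableSet_Ioc fun x hx => hneg x hx.2
      have h3 : m ≤ R (-K) := csInf_le hbdd ⟨-K, ⟨le_rfl, by linarith⟩, rfl⟩
      linarith
    rcases le_or_gt c K with h' | h'
    · exact csInf_le hbdd ⟨c, ⟨h, h'⟩, rfl⟩
    · have h1 := hRsub h'.le
      have h2 : 0 ≤ ∫ x in Ioc K c, f x ∂μ :=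
        setIntegral_nonneg measurableSet_Ioc fun x hx => hpos x hx.1.le
      have h3 : m ≤ R K := csInf_le hbdd ⟨K, ⟨by linarith, le_rfl⟩, rfl⟩
      linarith
  obtain ⟨v, -, hv, hvm⟩ := exists_seq_tendsto_sInf hne hbdd
  choose w hw hwv using hvm
  obtain ⟨c, hc, φ, hφ, hlim⟩ := isCompact_Icc.tendsto_subseq hw
  have hRw : Tendsto (R ∘ w ∘ φ) atTop (𝓝 m) := by
    have := hv.comp hφ.tendsto_atTop
    refine this.congr fun n => ?_
    simp [hwv]
  have hcases : R c = m ∨ R c - ∫ x in {c}, f x ∂μ = m := by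
    by_cases hfreq : ∃ᶠ n in atTop, (w ∘ φ) n < c
    · right
      have h1 : Tendsto (w ∘ φ) (atTop ⊓ 𝓟 {n | (w ∘ φ) n < c}) (𝓝[<] c) := by
        refine tendsto_nhdsWithin_iff.2 ⟨hlim.mono_left inf_le_left, ?_⟩
        exact mem_inf_of_right (mem_principal_self _)
      have : (atTop ⊓ 𝓟 {n | (w ∘ φ) n < c}).NeBot := frequently_mem_iff_neBot.1 hfreq
      exact tendsto_nhds_unique ((hleft c).comp h1) (hRw.mono_left inf_le_left)
    · left
      have h1 : Tendsto (w ∘ φ) atTop (𝓝[≥] c) := by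
        refine tendsto_nhdsWithin_iff.2 ⟨hlim, ?_⟩
        filter_upwards [not_frequently.1 hfreq] with n hn
        exact not_lt.1 hn
      exact tendsto_nhds_unique ((hright c).comp h1) hRw
  refine ⟨c, ?_⟩
  rcases hcases with h | h
  · right
    refine ⟨fun b hb => ?_, fun d hd => ?_⟩
    · refine le_of_tendsto (tendsto_setIntegral_Ioc_Iio hf b c) ?_
      filter_upwards [self_mem_nhdsWithin] with b' hb'
      rw [hRsub ((le_of_lt hb').trans hb), h]
      linarith [hmin b']
    · rw [hRsub hd.le, h]; linarith [hmin d]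
  · left
    refine ⟨fun b hb => ?_, fun d hd => ?_⟩
    · have h1 : ∫ x in Icc b c, f x ∂μ ≤ ∫ x in {c}, f x ∂μ := by
        refine le_of_tendsto (tendsto_setIntegral_Ioc_Iio hf b c) ?_
        filter_upwards [self_mem_nhdsWithin] with b' hb'
        rw [hRsub ((le_of_lt hb').trans hb.le)]
        linarith [hmin b']
      have := setIntegral_Icc_eq_Ico_add_singleton hf hb.le
      linarith
    · rw [setIntegral_Icc_eq_singleton_add_Ioc hf hd, hRsub hd]
      linarith [hmin d]

end Intervals

/-! ### Contact points of the potential and its convex hull -/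

section Contact

variable {μ : Measure ℝ} {u : ℝ → ℝ}

theorem Admissible.locallyIntegrable_sub (h : Admissible μ u) (t x : ℝ) :
    LocallyIntegrable (fun η => η + t * u η - x) μ := by
  have := h.locallyFinite
  exact ((continuous_id.locallyIntegrable).add (h.locallyIntegrable.smul t)).sub
    (continuous_const.locallyIntegrable)

theorem Admissible.locallyIntegrable_add (h : Admissible μ u) (t : ℝ) :
    LocallyIntegrable (fun η => η + t * u η) μ := by
  simpa using h.locallyIntegrable_sub t 0

theorem Admissible.locallyIntegrable_id (h : Admissible μ u) :
    LocallyIntegrable (fun η : ℝ => η) μ := by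
  have := h.locallyFinite
  exact continuous_id.locallyIntegrable

theorem Admissible.measure_lt_top (h : Admissible μ u) {s : Set ℝ} {c d : ℝ} (hs : s ⊆ Icc c d) :
    μ s < ∞ := by
  have := h.locallyFinite
  exact (measure_mono hs).trans_lt isCompact_Icc.measure_lt_top

theorem Admissible.measureReal_pos (h : Admissible μ u) {s : Set ℝ} {c d a b : ℝ} (hcd : c < d)
    (hs : Ioo c d ⊆ s) (hs' : s ⊆ Icc a b) : 0 < μ.real s := by
  refine ENNReal.toReal_pos ?_ (h.measure_lt_top hs').ne
  have h1 := h.fullSupport ((c + d) / 2) ((d - c) / 2) (by linarith)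
  have e1 : (c + d) / 2 - (d - c) / 2 = c := by ring
  have e2 : (c + d) / 2 + (d - c) / 2 = d := by ring
  rw [e1, e2] at h1
  exact (h1.trans_le (measure_mono hs)).ne'

theorem Admissible.measureReal_Icc_pos (h : Admissible μ u) {c d : ℝ} (hcd : c < d) :
    0 < μ.real (Icc c d) := h.measureReal_pos hcd Ioo_subset_Icc_self subset_rfl

theorem Admissible.measureReal_Ico_pos (h : Admissible μ u) {c d : ℝ} (hcd : c < d) :
    0 < μ.real (Ico c d) := h.measureReal_pos hcd Ioo_subset_Ico_self Ico_subset_Icc_self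

theorem Admissible.measureReal_Ioc_pos (h : Admissible μ u) {c d : ℝ} (hcd : c < d) :
    0 < μ.real (Ioc c d) := h.measureReal_pos hcd Ioo_subset_Ioc_self Ioc_subset_Icc_self

theorem Admissible.setIntegral_sub_const (h : Admissible μ u) (t x : ℝ) {s : Set ℝ} {a b : ℝ}
    (hs : s ⊆ Icc a b) :
    ∫ η in s, (η + t * u η - x) ∂μ = ∫ η in s, (η + t * u η) ∂μ - x * μ.real s := by
  have : IsFiniteMeasure (μ.restrict s) := ⟨by simpa using h.measure_lt_top hs⟩
  rw [integral_sub (integrableOn_of_bdd (h.locallyIntegrable_add t) hs) (integrable_const x)]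
  simp [mul_comm]

theorem Admissible.setIntegral_split (h : Admissible μ u) (t x : ℝ) {s : Set ℝ} {a b : ℝ}
    (hs : s ⊆ Icc a b) :
    ∫ η in s, (η + t * u η - x) ∂μ =
      ∫ η in s, η ∂μ + t * ∫ η in s, u η ∂μ - x * μ.real s := by
  rw [h.setIntegral_sub_const t x hs, integral_add (integrableOn_of_bdd h.locallyIntegrable_id hs)
    ((integrableOn_of_bdd h.locallyIntegrable hs).const_mul t), integral_const_mul]

theorem Admissible.barycentre_le_iff (h : Admissible μ u) (t x : ℝ) {c d : ℝ} (hcd : c < d) :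
    barycentre μ u t c d ≤ x ↔ ∫ η in Icc c d, (η + t * u η - x) ∂μ ≤ 0 := by
  rw [h.setIntegral_sub_const t x subset_rfl, barycentre, setAverage_eq, smul_eq_mul,
    inv_mul_le_iff₀ (h.measureReal_Icc_pos hcd), sub_nonpos, mul_comm]

theorem Admissible.le_barycentre_iff (h : Admissible μ u) (t x : ℝ) {c d : ℝ} (hcd : c < d) :
    x ≤ barycentre μ u t c d ↔ 0 ≤ ∫ η in Icc c d, (η + t * u η - x) ∂μ := by
  rw [h.setIntegral_sub_const t x subset_rfl, barycentre, setAverage_eq, smul_eq_mul,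
    le_inv_mul_iff₀ (h.measureReal_Icc_pos hcd), sub_nonneg, mul_comm]

/-- Far from the origin, `η + t u(η) - x` has the sign of `η`. -/
theorem Admissible.exists_sign (h : Admissible μ u) (t x : ℝ) :
    ∃ K : ℝ, 0 ≤ K ∧ (∀ η ≤ -K, η + t * u η - x ≤ 0) ∧ ∀ η, K ≤ η → 0 ≤ η + t * u η - x := by
  have h1 : ∀ᶠ η in cocompact ℝ, |u η / η| * (|t| + 1) < 1 / 2 := by
    have := (h.sublinear.abs.mul_const (|t| + 1))
    simp only [abs_zero, zero_mul] at this
    exact this.eventually (gt_mem_nhds (by norm_num))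
  rw [← Metric.cobounded_eq_cocompact] at h1
  obtain ⟨K, -, hK⟩ := (Filter.HasBasis.eventually_iff
    (Metric.hasBasis_cobounded_compl_closedBall (0 : ℝ))).1 h1
  have key : ∀ η, |K| < |η| → |t * u η| ≤ |η| / 2 := by
    intro η hη
    have h2 : |u η / η| * (|t| + 1) < 1 / 2 := hK (by simpa using (le_abs_self K).trans_lt hη)
    have h3 : 0 < |η| := (abs_nonneg K).trans_lt hη
    rw [abs_div] at h2
    rw [abs_mul]
    have h4 : |u η| / |η| * (|t| + 1) * |η| < 1 / 2 * |η| := by gcongr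
    have h5 : |u η| / |η| * (|t| + 1) * |η| = |u η| * (|t| + 1) := by field_simp
    nlinarith [abs_nonneg (u η), abs_nonneg t]
  refine ⟨max (|K| + 1) (2 * |x|), by positivity, fun η hη => ?_, fun η hη => ?_⟩
  · have h2 : |K| + 1 ≤ -η := by linarith [le_max_left (|K| + 1) (2 * |x|)]
    have h3 : 2 * |x| ≤ -η := by linarith [le_max_right (|K| + 1) (2 * |x|)]
    have h4 : |η| = -η := abs_of_nonpos (by linarith [abs_nonneg K])
    have h5 := key η (by rw [h4]; linarith)
    rw [h4] at h5
    linarith [le_abs_self (t * u η), neg_abs_le x]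
  · have h2 : |K| + 1 ≤ η := by linarith [le_max_left (|K| + 1) (2 * |x|)]
    have h3 : 2 * |x| ≤ η := by linarith [le_max_right (|K| + 1) (2 * |x|)]
    have h4 : |η| = η := abs_of_nonneg (by linarith [abs_nonneg K])
    have h5 := key η (by rw [h4]; linarith)
    rw [h4] at h5
    linarith [neg_abs_le (t * u η), le_abs_self x]

/-- The left half of the negative jump condition: some mean of `η + t u(η)` over an interval
`[b,c)` is almost as large as `c + t u(c)`. -/
theorem Admissible.exists_left_mean (h : Admissible μ u) {t : ℝ} (ht : 0 ≤ t) (c : ℝ) {ε : ℝ}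
    (hε : 0 < ε) : ∃ b < c, 0 ≤ ∫ η in Ico b c, (η + t * u η - (c + t * u c - ε)) ∂μ := by
  set δ := ε / (1 + t) with hδ
  have hδpos : 0 < δ := div_pos hε (by linarith)
  have hδeq : (1 + t) * δ = ε := by rw [hδ]; field_simp
  have h1 : ((u c - δ : ℝ) : EReal) < genLeft μ u c :=
    lt_of_lt_of_le (by exact_mod_cast sub_lt_self _ hδpos) (h.negJump c).1
  obtain ⟨r, h3, hr0, hrδ⟩ := ((frequently_lt_of_lt_limsup (by isBoundedDefault) h1).and_eventually
    (inter_mem (self_mem_nhdsWithin (a := (0 : ℝ)) (s := Ioi 0))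
      (mem_nhdsWithin_of_mem_nhds (Iio_mem_nhds hδpos)))).exists
  simp only [mem_Ioi] at hr0
  simp only [mem_Iio] at hrδ
  have hlt : c - r < c := by linarith
  have hm := h.measureReal_Ico_pos hlt
  have h3 : u c - δ < ⨍ η in Ico (c - r) c, u η ∂μ := by exact_mod_cast h3
  rw [setAverage_eq, smul_eq_mul, lt_inv_mul_iff₀ hm] at h3
  refine ⟨c - r, hlt, ?_⟩
  rw [h.setIntegral_split t _ Ico_subset_Icc_self]
  have h5 : (c - r) * μ.real (Ico (c - r) c) ≤ ∫ η in Ico (c - r) c, η ∂μ :=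
    setIntegral_ge_of_const_le_real measurableSet_Ico (h.measure_lt_top Ico_subset_Icc_self).ne
      (fun η hη => hη.1) (integrableOn_of_bdd h.locallyIntegrable_id Ico_subset_Icc_self)
  have h6 : t * (μ.real (Ico (c - r) c) * (u c - δ)) ≤ t * ∫ η in Ico (c - r) c, u η ∂μ := by
    gcongr
  have h7 : 0 ≤ μ.real (Ico (c - r) c) * (δ - r) := mul_nonneg hm.le (by linarith)
  have h8 : μ.real (Ico (c - r) c) * ((1 + t) * δ) = μ.real (Ico (c - r) c) * ε := by rw [hδeq]
  linarith

/-- The right half of the negative jump condition: some mean of `η + t u(η)` over an interval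
`(c,d]` is almost as small as `c + t u(c)`. -/
theorem Admissible.exists_right_mean (h : Admissible μ u) {t : ℝ} (ht : 0 ≤ t) (c : ℝ) {ε : ℝ}
    (hε : 0 < ε) : ∃ d, c < d ∧ ∫ η in Ioc c d, (η + t * u η - (c + t * u c + ε)) ∂μ ≤ 0 := by
  set δ := ε / (1 + t) with hδ
  have hδpos : 0 < δ := div_pos hε (by linarith)
  have hδeq : (1 + t) * δ = ε := by rw [hδ]; field_simp
  have h1 : genRight μ u c < ((u c + δ : ℝ) : EReal) :=
    lt_of_le_of_lt (h.negJump c).2 (by exact_mod_cast lt_add_of_pos_right _ hδpos)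
  obtain ⟨r, h3, hr0, hrδ⟩ := ((frequently_lt_of_liminf_lt (by isBoundedDefault) h1).and_eventually
    (inter_mem (self_mem_nhdsWithin (a := (0 : ℝ)) (s := Ioi 0))
      (mem_nhdsWithin_of_mem_nhds (Iio_mem_nhds hδpos)))).exists
  simp only [mem_Ioi] at hr0
  simp only [mem_Iio] at hrδ
  have hlt : c < c + r := by linarith
  have hm := h.measureReal_Ioc_pos hlt
  have h3 : ⨍ η in Ioc c (c + r), u η ∂μ < u c + δ := by exact_mod_cast h3
  rw [setAverage_eq, smul_eq_mul, inv_mul_lt_iff₀ hm] at h3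
  refine ⟨c + r, hlt, ?_⟩
  rw [h.setIntegral_split t _ Ioc_subset_Icc_self]
  have h5 : ∫ η in Ioc c (c + r), η ∂μ ≤ (c + r) * μ.real (Ioc c (c + r)) := by
    have := setIntegral_mono_on (integrableOn_of_bdd h.locallyIntegrable_id Ioc_subset_Icc_self)
      (integrableOn_const (h.measure_lt_top Ioc_subset_Icc_self).ne) measurableSet_Ioc
      (fun η (hη : η ∈ Ioc c (c + r)) => hη.2)
    rwa [setIntegral_const, smul_eq_mul, mul_comm] at this
  have h6 : t * ∫ η in Ioc c (c + r), u η ∂μ ≤ t * (μ.real (Ioc c (c + r)) * (u c + δ)) := by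
    gcongr
  have h7 : 0 ≤ μ.real (Ioc c (c + r)) * (δ - r) := mul_nonneg hm.le (by linarith)
  have h8 : μ.real (Ioc c (c + r)) * ((1 + t) * δ) = μ.real (Ioc c (c + r)) * ε := by rw [hδeq]
  linarith

/-- If all the means of `η + t u(η)` over `[b,c)` are at most `x`, then so is `c + t u(c)`. -/
theorem Admissible.add_mul_le_of_left (h : Admissible μ u) {t : ℝ} (ht : 0 ≤ t) {x c : ℝ}
    (hc : ∀ b < c, ∫ η in Ico b c, (η + t * u η - x) ∂μ ≤ 0) : c + t * u c ≤ x := by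
  by_contra! hcon
  obtain ⟨b, hb, h1⟩ := h.exists_left_mean ht c (ε := (c + t * u c - x) / 2) (by linarith)
  have h2 := hc b hb
  rw [h.setIntegral_sub_const t _ Ico_subset_Icc_self] at h1 h2
  have h3 := mul_pos (h.measureReal_Ico_pos hb) (sub_pos.2 hcon)
  linarith

/-- If all the means of `η + t u(η)` over `(c,d]` are at least `x`, then so is `c + t u(c)`. -/
theorem Admissible.le_add_mul_of_right (h : Admissible μ u) {t : ℝ} (ht : 0 ≤ t) {x c : ℝ}
    (hc : ∀ d, c < d → 0 ≤ ∫ η in Ioc c d, (η + t * u η - x) ∂μ) : x ≤ c + t * u c := by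
  by_contra! hcon
  obtain ⟨d, hd, h1⟩ := h.exists_right_mean ht c (ε := (x - (c + t * u c)) / 2) (by linarith)
  have h2 := hc d hd
  rw [h.setIntegral_sub_const t _ Ioc_subset_Icc_self] at h1 h2
  have h3 := mul_pos (h.measureReal_Ioc_pos hd) (sub_pos.2 hcon)
  linarith

/-- `c` is a contact point at level `x` and time `t`: the primitive of `η + t u(η) - x` with respect
to `μ` is minimal at `c`, on both sides of `c`. In the mass coordinate, the potential of
`η + t u(η)` touches there its convex hull, which has slope `x`. -/
def IsContact (μ : Measure ℝ) (u : ℝ → ℝ) (t x c : ℝ) : Prop :=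
  (∀ b < c, ∫ η in Ico b c, (η + t * u η - x) ∂μ ≤ 0) ∧
    ∀ d, c < d → 0 ≤ ∫ η in Ioc c d, (η + t * u η - x) ∂μ

variable {t x c : ℝ}

theorem IsContact.eq (hc : IsContact μ u t x c) (h : Admissible μ u) (ht : 0 ≤ t) :
    c + t * u c = x :=
  le_antisymm (h.add_mul_le_of_left ht hc.1) (h.le_add_mul_of_right ht hc.2)

theorem setIntegral_singleton_sub (μ : Measure ℝ) (u : ℝ → ℝ) (t x c : ℝ) :
    ∫ η in {c}, (η + t * u η - x) ∂μ = μ.real {c} * (c + t * u c - x) := by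
  rw [integral_singleton, smul_eq_mul]

theorem IsContact.setIntegral_Icc_left_nonpos (hc : IsContact μ u t x c) (h : Admissible μ u)
    (ht : 0 ≤ t) {b : ℝ} (hb : b ≤ c) : ∫ η in Icc b c, (η + t * u η - x) ∂μ ≤ 0 := by
  rw [setIntegral_Icc_eq_Ico_add_singleton (h.locallyIntegrable_sub t x) hb,
    setIntegral_singleton_sub, hc.eq h ht, sub_self, mul_zero, add_zero]
  rcases hb.eq_or_lt with rfl | hb
  · simp
  · exact hc.1 b hb

theorem IsContact.setIntegral_Icc_right_nonneg (hc : IsContact μ u t x c) (h : Admissible μ u)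
    (ht : 0 ≤ t) {d : ℝ} (hd : c ≤ d) : 0 ≤ ∫ η in Icc c d, (η + t * u η - x) ∂μ := by
  rw [setIntegral_Icc_eq_singleton_add_Ioc (h.locallyIntegrable_sub t x) hd,
    setIntegral_singleton_sub, hc.eq h ht, sub_self, mul_zero, zero_add]
  rcases hd.eq_or_lt with rfl | hd
  · simp
  · exact hc.2 d hd

/-- By the negative jump condition, the potential is minimal on both sides of `c` if it is minimal
on the left side. -/
theorem Admissible.isContact_of_left (h : Admissible μ u) (ht : 0 ≤ t)
    (h1 : ∀ b < c, ∫ η in Ico b c, (η + t * u η - x) ∂μ ≤ 0)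
    (h2 : ∀ d, c < d → 0 ≤ ∫ η in Icc c d, (η + t * u η - x) ∂μ) : IsContact μ u t x c := by
  refine ⟨h1, fun d hd => ?_⟩
  have h3 := h2 d hd
  rw [setIntegral_Icc_eq_singleton_add_Ioc (h.locallyIntegrable_sub t x) hd.le,
    setIntegral_singleton_sub] at h3
  have h4 : μ.real {c} * (c + t * u c - x) ≤ 0 :=
    mul_nonpos_of_nonneg_of_nonpos measureReal_nonneg
      (sub_nonpos.2 (h.add_mul_le_of_left ht h1))
  linarith

/-- By the negative jump condition, the potential is minimal on both sides of `c` if it is minimal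
on the right side. -/
theorem Admissible.isContact_of_right (h : Admissible μ u) (ht : 0 ≤ t)
    (h1 : ∀ b < c, ∫ η in Icc b c, (η + t * u η - x) ∂μ ≤ 0)
    (h2 : ∀ d, c < d → 0 ≤ ∫ η in Ioc c d, (η + t * u η - x) ∂μ) : IsContact μ u t x c := by
  refine ⟨fun b hb => ?_, h2⟩
  have h3 := h1 b hb
  rw [setIntegral_Icc_eq_Ico_add_singleton (h.locallyIntegrable_sub t x) hb.le,
    setIntegral_singleton_sub] at h3
  have h4 : 0 ≤ μ.real {c} * (c + t * u c - x) :=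
    mul_nonneg measureReal_nonneg (sub_nonneg.2 (h.le_add_mul_of_right ht h2))
  linarith

/-- Every level has a contact point: the minimum of the primitive, which exists by sublinearity of
`u`, is a contact point by the negative jump condition. -/
theorem Admissible.exists_isContact (h : Admissible μ u) (ht : 0 ≤ t) (x : ℝ) :
    ∃ c, IsContact μ u t x c := by
  obtain ⟨K, hK, h1, h2⟩ := h.exists_sign t x
  obtain ⟨c, ⟨h3, h4⟩ | ⟨h3, h4⟩⟩ := exists_minimizing_cut (h.locallyIntegrable_sub t x) hK h1 h2
  · exact ⟨c, h.isContact_of_left ht h3 fun d hd => h4 d hd.le⟩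
  · exact ⟨c, h.isContact_of_right ht (fun b hb => h3 b hb.le) h4⟩

/-! ### The flow and the contact points -/

theorem Admissible.bddAbove_barycentre (h : Admissible μ u) (t : ℝ) {a d : ℝ} (had : a < d) :
    BddAbove (range fun c : Iio a => barycentre μ u t (c : ℝ) d) := by
  obtain ⟨K, hK, h1, -⟩ := h.exists_sign t 0
  set C := ∫ η in Icc (-K) d, ‖η + t * u η‖ ∂μ with hC
  have hC0 : 0 ≤ C := integral_nonneg fun _ => norm_nonneg _
  refine ⟨C / μ.real (Icc a d), ?_⟩
  rintro _ ⟨⟨c, hc⟩, rfl⟩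
  rw [mem_Iio] at hc
  have hm := h.measureReal_Icc_pos had
  have hmle : μ.real (Icc a d) ≤ μ.real (Icc c d) :=
    measureReal_mono (Icc_subset_Icc_left hc.le) (h.measure_lt_top subset_rfl).ne
  have hint : ∫ η in Icc c d, (η + t * u η) ∂μ ≤ C := by
    have hi := integrableOn_of_bdd (h.locallyIntegrable_add t) (subset_refl (Icc c d))
    have hi' := integrableOn_of_bdd (h.locallyIntegrable_add t) (subset_refl (Icc (-K) d))
    rw [hC, ← integral_indicator measurableSet_Icc, ← integral_indicator measurableSet_Icc]
    refine integral_mono ((integrable_indicator_iff measurableSet_Icc).2 hi)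
      ((integrable_indicator_iff measurableSet_Icc).2 hi'.norm) fun η => ?_
    by_cases hη : η ∈ Icc c d
    · rw [indicator_of_mem hη]
      by_cases hη' : -K ≤ η
      · rw [indicator_of_mem (show η ∈ Icc (-K) d from ⟨hη', hη.2⟩)]
        exact le_abs_self _
      · have h2 := h1 η (not_le.1 hη').le
        exact (by linarith : η + t * u η ≤ 0).trans (indicator_nonneg (fun _ _ => norm_nonneg _) _)
    · rw [indicator_of_notMem hη]
      exact indicator_nonneg (fun _ _ => norm_nonneg _) _
  simp only [barycentre, setAverage_eq, smul_eq_mul]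
  rw [inv_mul_le_iff₀ (hm.trans_le hmle), mul_comm, div_mul_eq_mul_div, le_div_iff₀ hm]
  calc _ ≤ C * μ.real (Icc a d) := by gcongr
    _ ≤ _ := by gcongr

theorem Admissible.bddBelow_iSup_barycentre (h : Admissible μ u) (t a : ℝ) :
    BddBelow (range fun d : Ioi a => ⨆ c : Iio a, barycentre μ u t (c : ℝ) (d : ℝ)) := by
  obtain ⟨K, hK, -, h1⟩ := h.exists_sign t 0
  set C := ∫ η in Icc (a - 1) K, ‖η + t * u η‖ ∂μ with hC
  have hC0 : 0 ≤ C := integral_nonneg fun _ => norm_nonneg _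
  refine ⟨-(C / μ.real (Icc (a - 1) a)), ?_⟩
  rintro _ ⟨⟨d, hd⟩, rfl⟩
  rw [mem_Ioi] at hd
  have hm := h.measureReal_Icc_pos (sub_one_lt a)
  have hmle : μ.real (Icc (a - 1) a) ≤ μ.real (Icc (a - 1) d) :=
    measureReal_mono (Icc_subset_Icc_right hd.le) (h.measure_lt_top subset_rfl).ne
  refine le_ciSup_of_le (h.bddAbove_barycentre t hd) ⟨a - 1, sub_one_lt a⟩ ?_
  have hint : -C ≤ ∫ η in Icc (a - 1) d, (η + t * u η) ∂μ := by
    have hi := integrableOn_of_bdd (h.locallyIntegrable_add t) (subset_refl (Icc (a - 1) d))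
    have hi' := integrableOn_of_bdd (h.locallyIntegrable_add t) (subset_refl (Icc (a - 1) K))
    rw [hC, ← integral_neg, ← integral_indicator measurableSet_Icc,
      ← integral_indicator measurableSet_Icc]
    refine integral_mono ((integrable_indicator_iff measurableSet_Icc).2 hi'.norm.neg)
      ((integrable_indicator_iff measurableSet_Icc).2 hi) fun η => ?_
    have hneg : (Icc (a - 1) K).indicator (fun η => -‖η + t * u η‖) η ≤ 0 :=
      indicator_nonpos (fun _ _ => neg_nonpos.2 (norm_nonneg _)) _
    by_cases hη : η ∈ Icc (a - 1) d
    · rw [indicator_of_mem hη]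
      by_cases hη' : η ≤ K
      · rw [indicator_of_mem (show η ∈ Icc (a - 1) K from ⟨hη.1, hη'⟩)]
        exact neg_abs_le _
      · have h2 := h1 η (not_le.1 hη').le
        exact hneg.trans (by linarith)
    · rw [indicator_of_notMem hη]
      exact hneg
  simp only [barycentre, setAverage_eq, smul_eq_mul]
  rw [le_inv_mul_iff₀ (hm.trans_le hmle), mul_comm, neg_mul, neg_le, div_mul_eq_mul_div,
    le_div_iff₀ hm]
  calc _ ≤ C * μ.real (Icc (a - 1) a) := by gcongr; linarith
    _ ≤ _ := by gcongr

theorem Admissible.flow_le_of_forall (h : Admissible μ u) {t a d x : ℝ} (had : a < d)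
    (hd : ∀ c < a, ∫ η in Icc c d, (η + t * u η - x) ∂μ ≤ 0) : flow μ u t a ≤ x := by
  refine ciInf_le_of_le (h.bddBelow_iSup_barycentre t a) ⟨d, had⟩ ?_
  have : Nonempty (Iio a) := ⟨⟨a - 1, sub_one_lt a⟩⟩
  exact ciSup_le fun c => (h.barycentre_le_iff t x (lt_trans c.2 had)).2 (hd c c.2)

theorem Admissible.le_flow_of_forall (h : Admissible μ u) {t a c x : ℝ} (hca : c < a)
    (hc : ∀ d, a < d → 0 ≤ ∫ η in Icc c d, (η + t * u η - x) ∂μ) : x ≤ flow μ u t a := by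
  have : Nonempty (Ioi a) := ⟨⟨a + 1, lt_add_one a⟩⟩
  refine le_ciInf fun d => ?_
  exact le_ciSup_of_le (h.bddAbove_barycentre t d.2) ⟨c, hca⟩
    ((h.le_barycentre_iff t x (lt_trans hca d.2)).2 (hc d d.2))

/-- The particle at a contact point of level `x` is at the position `x`. -/
theorem IsContact.flow_eq (hc : IsContact μ u t x c) (h : Admissible μ u) (ht : 0 ≤ t) :
    flow μ u t c = x := by
  have heq := hc.eq h ht
  refine le_antisymm (le_of_forall_pos_le_add fun ε hε => ?_)
    (le_of_forall_pos_le_add fun ε hε => ?_)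
  · obtain ⟨d, hd, h1⟩ := h.exists_right_mean ht c hε
    rw [heq] at h1
    refine h.flow_le_of_forall hd fun b hb => ?_
    have h2 := hc.setIntegral_Icc_left_nonpos h ht hb.le
    rw [setIntegral_Icc_eq_Icc_add_Ioc (h.locallyIntegrable_sub t _) hb.le hd.le]
    rw [h.setIntegral_sub_const t _ subset_rfl] at h2 ⊢
    have h3 : 0 ≤ ε * μ.real (Icc b c) := by positivity
    linarith
  · obtain ⟨b, hb, h1⟩ := h.exists_left_mean ht c hε
    rw [heq] at h1
    rw [← sub_le_iff_le_add]
    refine h.le_flow_of_forall hb fun d hd => ?_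
    have h2 := hc.setIntegral_Icc_right_nonneg h ht hd.le
    rw [setIntegral_Icc_eq_Ico_add_Icc (h.locallyIntegrable_sub t _) hb.le hd.le]
    rw [h.setIntegral_sub_const t _ (subset_refl (Icc c d))] at h2 ⊢
    have h3 : 0 ≤ ε * μ.real (Icc c d) := by positivity
    linarith

theorem IsContact.flow_le (hc : IsContact μ u t x c) (h : Admissible μ u) (ht : 0 ≤ t) {a : ℝ}
    (ha : a < c) : flow μ u t a ≤ x :=
  h.flow_le_of_forall ha fun _ hb => hc.setIntegral_Icc_left_nonpos h ht (hb.trans ha).le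

theorem IsContact.le_flow (hc : IsContact μ u t x c) (h : Admissible μ u) (ht : 0 ≤ t) {a : ℝ}
    (ha : c < a) : x ≤ flow μ u t a :=
  h.le_flow_of_forall ha fun _ hd => hc.setIntegral_Icc_right_nonneg h ht (ha.trans hd).le

theorem Admissible.flow_monotone (h : Admissible μ u) (ht : 0 ≤ t) : Monotone (flow μ u t) := by
  intro a b hab
  by_contra! hcon
  obtain ⟨x, hx1, hx2⟩ := exists_between hcon
  obtain ⟨c, hc⟩ := h.exists_isContact ht x
  rcases lt_or_ge a c with h1 | h1
  · exact absurd (hc.flow_le h ht h1) (not_le.2 hx2)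
  · rcases h1.eq_or_lt with rfl | h1
    · exact hx2.ne' (hc.flow_eq h ht)
    · exact absurd (hc.le_flow h ht (h1.trans_le hab)) (not_le.2 hx1)

theorem Admissible.flow_surjective (h : Admissible μ u) (ht : 0 ≤ t) :
    Function.Surjective (flow μ u t) := fun x =>
  let ⟨c, hc⟩ := h.exists_isContact ht x
  ⟨c, hc.flow_eq h ht⟩

theorem Admissible.flow_continuous (h : Admissible μ u) (ht : 0 ≤ t) : Continuous (flow μ u t) :=
  (h.flow_monotone ht).continuous_of_surjective (h.flow_surjective ht)

theorem Admissible.flow_zero (h : Admissible μ u) (a : ℝ) : flow μ u 0 a = a := by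
  obtain ⟨c, hc⟩ := h.exists_isContact le_rfl a
  have h1 := hc.eq h le_rfl
  rw [zero_mul, add_zero] at h1
  rw [← h1] at hc
  rw [← h1]
  exact hc.flow_eq h le_rfl

end Contact

/-! ### Clusters -/

section Clusters

variable {μ : Measure ℝ} {u : ℝ → ℝ} {t s x : ℝ}

theorem Admissible.bddBelow_cluster (h : Admissible μ u) (ht : 0 ≤ t) (x : ℝ) :
    BddBelow {a | flow μ u t a = x} := by
  obtain ⟨c, hc⟩ := h.flow_surjective ht (x - 1)
  refine ⟨c, fun a ha => ?_⟩
  by_contra! hcon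
  have := h.flow_monotone ht hcon.le
  rw [hc, show flow μ u t a = x from ha] at this
  linarith

theorem Admissible.bddAbove_cluster (h : Admissible μ u) (ht : 0 ≤ t) (x : ℝ) :
    BddAbove {a | flow μ u t a = x} := by
  obtain ⟨c, hc⟩ := h.flow_surjective ht (x + 1)
  refine ⟨c, fun a ha => ?_⟩
  by_contra! hcon
  have := h.flow_monotone ht hcon.le
  rw [hc, show flow μ u t a = x from ha] at this
  linarith

theorem Admissible.isClosed_cluster (h : Admissible μ u) (ht : 0 ≤ t) (x : ℝ) :
    IsClosed {a | flow μ u t a = x} :=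
  isClosed_eq (h.flow_continuous ht) continuous_const

theorem Admissible.flow_clusterLeft (h : Admissible μ u) (ht : 0 ≤ t) (x : ℝ) :
    flow μ u t (clusterLeft μ u x t) = x :=
  (h.isClosed_cluster ht x).csInf_mem (h.flow_surjective ht x) (h.bddBelow_cluster ht x)

theorem Admissible.flow_clusterRight (h : Admissible μ u) (ht : 0 ≤ t) (x : ℝ) :
    flow μ u t (clusterRight μ u x t) = x :=
  (h.isClosed_cluster ht x).csSup_mem (h.flow_surjective ht x) (h.bddAbove_cluster ht x)

theorem Admissible.clusterLeft_le (h : Admissible μ u) (ht : 0 ≤ t) {a : ℝ}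
    (ha : flow μ u t a = x) : clusterLeft μ u x t ≤ a := csInf_le (h.bddBelow_cluster ht x) ha

theorem Admissible.le_clusterRight (h : Admissible μ u) (ht : 0 ≤ t) {a : ℝ}
    (ha : flow μ u t a = x) : a ≤ clusterRight μ u x t := le_csSup (h.bddAbove_cluster ht x) ha

theorem Admissible.clusterLeft_le_clusterRight (h : Admissible μ u) (ht : 0 ≤ t) (x : ℝ) :
    clusterLeft μ u x t ≤ clusterRight μ u x t :=
  h.clusterLeft_le ht (h.flow_clusterRight ht x)

theorem Admissible.flow_eq_of_mem (h : Admissible μ u) (ht : 0 ≤ t) {a : ℝ}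
    (h1 : clusterLeft μ u x t ≤ a) (h2 : a ≤ clusterRight μ u x t) : flow μ u t a = x :=
  le_antisymm ((h.flow_monotone ht h2).trans_eq (h.flow_clusterRight ht x))
    ((h.flow_clusterLeft ht x).symm.trans_le (h.flow_monotone ht h1))

theorem Admissible.flow_lt_of_lt_clusterLeft (h : Admissible μ u) (ht : 0 ≤ t) {a : ℝ}
    (ha : a < clusterLeft μ u x t) : flow μ u t a < x := by
  refine lt_of_le_of_ne ((h.flow_monotone ht ha.le).trans_eq (h.flow_clusterLeft ht x)) fun hh => ?_
  exact absurd (h.clusterLeft_le ht hh) (not_le.2 ha)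

theorem Admissible.lt_flow_of_clusterRight_lt (h : Admissible μ u) (ht : 0 ≤ t) {a : ℝ}
    (ha : clusterRight μ u x t < a) : x < flow μ u t a := by
  refine lt_of_le_of_ne ((h.flow_clusterRight ht x).symm.trans_le (h.flow_monotone ht ha.le))
    fun hh => ?_
  exact absurd (h.le_clusterRight ht hh.symm) (not_le.2 ha)

theorem Admissible.clusterRight_lt_clusterLeft (h : Admissible μ u) (ht : 0 ≤ t) {y : ℝ}
    (hxy : x < y) : clusterRight μ u x t < clusterLeft μ u y t := by
  by_contra! hcon
  have := h.flow_monotone ht hcon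
  rw [h.flow_clusterRight ht, h.flow_clusterLeft ht] at this
  linarith

theorem Admissible.clusterLeft_strictMono (h : Admissible μ u) (ht : 0 ≤ t) :
    StrictMono fun x => clusterLeft μ u x t := fun _ _ hxy =>
  (h.clusterLeft_le_clusterRight ht _).trans_lt (h.clusterRight_lt_clusterLeft ht hxy)

theorem Admissible.clusterLeft_zero (h : Admissible μ u) (x : ℝ) : clusterLeft μ u x 0 = x := by
  have := h.flow_clusterLeft le_rfl x
  rwa [h.flow_zero] at this

theorem Admissible.clusterRight_zero (h : Admissible μ u) (x : ℝ) : clusterRight μ u x 0 = x := by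
  have := h.flow_clusterRight le_rfl x
  rwa [h.flow_zero] at this

theorem Admissible.tendsto_left (h : Admissible μ u) (ht : 0 ≤ t) {c : ℝ → ℝ}
    (hc : ∀ y, flow μ u t (c y) = y) (x : ℝ) :
    Tendsto c (𝓝[<] x) (𝓝 (clusterLeft μ u x t)) := by
  refine tendsto_order.2 ⟨fun b hb => ?_, fun b hb => ?_⟩
  · filter_upwards [mem_nhdsWithin_of_mem_nhds
      (lt_mem_nhds (h.flow_lt_of_lt_clusterLeft ht hb))] with y hy
    by_contra! hcon
    have := h.flow_monotone ht hcon
    rw [hc] at this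
    linarith
  · filter_upwards [self_mem_nhdsWithin] with y hy
    exact ((h.le_clusterRight ht (hc y)).trans_lt (h.clusterRight_lt_clusterLeft ht hy)).trans hb

theorem Admissible.tendsto_right (h : Admissible μ u) (ht : 0 ≤ t) {c : ℝ → ℝ}
    (hc : ∀ y, flow μ u t (c y) = y) (x : ℝ) :
    Tendsto c (𝓝[>] x) (𝓝 (clusterRight μ u x t)) := by
  refine tendsto_order.2 ⟨fun b hb => ?_, fun b hb => ?_⟩
  · filter_upwards [self_mem_nhdsWithin] with y hy
    exact hb.trans ((h.clusterRight_lt_clusterLeft ht hy).trans_le (h.clusterLeft_le ht (hc y)))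
  · filter_upwards [mem_nhdsWithin_of_mem_nhds
      (gt_mem_nhds (h.lt_flow_of_clusterRight_lt ht hb))] with y hy
    by_contra! hcon
    have := h.flow_monotone ht hcon
    rw [hc] at this
    linarith

/-- The left end of a cluster is a contact point, as a limit from the left of contact points at
lower levels. -/
theorem Admissible.isContact_clusterLeft (h : Admissible μ u) (ht : 0 ≤ t) (x : ℝ) :
    IsContact μ u t x (clusterLeft μ u x t) := by
  choose c hc using h.exists_isContact (μ := μ) (u := u) ht
  have hcy : ∀ y, flow μ u t (c y) = y := fun y => (hc y).flow_eq h ht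
  have hlim := h.tendsto_left ht hcy x
  have hlt : ∀ y < x, c y < clusterLeft μ u x t := fun y hy =>
    (h.le_clusterRight ht (hcy y)).trans_lt (h.clusterRight_lt_clusterLeft ht hy)
  have hle : ∀ᶠ y in 𝓝[<] x, c y ≤ clusterLeft μ u x t := by
    filter_upwards [self_mem_nhdsWithin] with y hy using (hlt y hy).le
  have hf := h.locallyIntegrable_sub t x
  refine h.isContact_of_left ht (fun b hb => ?_) fun d hd => ?_
  · refine le_of_tendsto (tendsto_setIntegral_Ico_right hf hlim hle) ?_
    filter_upwards [self_mem_nhdsWithin, hlim.eventually (lt_mem_nhds hb)] with y hy hby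
    have h1 := (hc y).1 b hby
    rw [h.setIntegral_sub_const t _ Ico_subset_Icc_self] at h1 ⊢
    have h2 : 0 ≤ (x - y) * μ.real (Ico b (c y)) :=
      mul_nonneg (sub_nonneg.2 (le_of_lt hy)) measureReal_nonneg
    linarith
  · have h1 := tendsto_setIntegral_Icc_of_le hf hlim tendsto_const_nhds hle
      (Eventually.of_forall fun _ => le_refl d)
    have h2 : Tendsto (fun y => -((x - y) * μ.real (Icc (c (x - 1)) d))) (𝓝[<] x) (𝓝 0) := by
      have : Tendsto (fun y => -((x - y) * μ.real (Icc (c (x - 1)) d))) (𝓝 x)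
          (𝓝 (-((x - x) * μ.real (Icc (c (x - 1)) d)))) := by
        exact ((tendsto_const_nhds.sub tendsto_id).mul_const _).neg
      simpa using this.mono_left nhdsWithin_le_nhds
    refine le_of_tendsto_of_tendsto h2 h1 ?_
    filter_upwards [self_mem_nhdsWithin,
      mem_nhdsWithin_of_mem_nhds (lt_mem_nhds (sub_one_lt x))] with y hy hy'
    have hy : y < x := hy
    have h3 := (hc y).setIntegral_Icc_right_nonneg h ht ((hlt y hy).trans hd).le
    have h5 : c (x - 1) ≤ c y := by
      by_contra! hcon
      have := h.flow_monotone ht hcon.le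
      rw [hcy, hcy] at this
      linarith
    have h6 : μ.real (Icc (c y) d) ≤ μ.real (Icc (c (x - 1)) d) :=
      measureReal_mono (Icc_subset_Icc_left h5) (h.measure_lt_top subset_rfl).ne
    have h7 := mul_le_mul_of_nonneg_left h6 (sub_nonneg.2 hy.le)
    rw [h.setIntegral_sub_const t _ subset_rfl] at h3 ⊢
    linarith

/-- The right end of a cluster is a contact point, as a limit from the right of contact points at
higher levels. -/
theorem Admissible.isContact_clusterRight (h : Admissible μ u) (ht : 0 ≤ t) (x : ℝ) :
    IsContact μ u t x (clusterRight μ u x t) := by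
  choose c hc using h.exists_isContact (μ := μ) (u := u) ht
  have hcy : ∀ y, flow μ u t (c y) = y := fun y => (hc y).flow_eq h ht
  have hlim := h.tendsto_right ht hcy x
  have hlt : ∀ y, x < y → clusterRight μ u x t < c y := fun y hy =>
    (h.clusterRight_lt_clusterLeft ht hy).trans_le (h.clusterLeft_le ht (hcy y))
  have hle : ∀ᶠ y in 𝓝[>] x, clusterRight μ u x t ≤ c y := by
    filter_upwards [self_mem_nhdsWithin] with y hy using (hlt y hy).le
  have hf := h.locallyIntegrable_sub t x
  refine h.isContact_of_right ht (fun b hb => ?_) fun d hd => ?_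
  · have h1 := tendsto_setIntegral_Icc_of_le hf tendsto_const_nhds hlim
      (Eventually.of_forall fun _ => le_refl b) hle
    have h2 : Tendsto (fun y => (y - x) * μ.real (Icc b (c (x + 1)))) (𝓝[>] x) (𝓝 0) := by
      have : Tendsto (fun y => (y - x) * μ.real (Icc b (c (x + 1)))) (𝓝 x)
          (𝓝 ((x - x) * μ.real (Icc b (c (x + 1))))) := by
        exact ((tendsto_id.sub tendsto_const_nhds).mul_const _)
      simpa using this.mono_left nhdsWithin_le_nhds
    refine le_of_tendsto_of_tendsto h1 h2 ?_
    filter_upwards [self_mem_nhdsWithin,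
      mem_nhdsWithin_of_mem_nhds (gt_mem_nhds (lt_add_one x))] with y hy hy'
    have hy : x < y := hy
    have h3 := (hc y).setIntegral_Icc_left_nonpos h ht (hb.trans (hlt y hy)).le
    have h5 : c y ≤ c (x + 1) := by
      by_contra! hcon
      have := h.flow_monotone ht hcon.le
      rw [hcy, hcy] at this
      linarith
    have h6 : μ.real (Icc b (c y)) ≤ μ.real (Icc b (c (x + 1))) :=
      measureReal_mono (Icc_subset_Icc_right h5) (h.measure_lt_top subset_rfl).ne
    have h7 := mul_le_mul_of_nonneg_left h6 (sub_nonneg.2 hy.le)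
    rw [h.setIntegral_sub_const t _ subset_rfl] at h3 ⊢
    linarith
  · refine ge_of_tendsto (tendsto_setIntegral_Ioc_left hf hlim hle) ?_
    filter_upwards [self_mem_nhdsWithin, hlim.eventually (gt_mem_nhds hd)] with y hy hby
    have h1 := (hc y).2 d hby
    rw [h.setIntegral_sub_const t _ Ioc_subset_Icc_self] at h1 ⊢
    have h2 : 0 ≤ (y - x) * μ.real (Ioc (c y) d) :=
      mul_nonneg (sub_nonneg.2 (le_of_lt hy)) measureReal_nonneg
    linarith

/-- A cluster is located at its barycentre. -/
theorem Admissible.setIntegral_cluster (h : Admissible μ u) (ht : 0 ≤ t) (x : ℝ) :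
    ∫ η in Icc (clusterLeft μ u x t) (clusterRight μ u x t), (η + t * u η - x) ∂μ = 0 :=
  le_antisymm
    ((h.isContact_clusterRight ht x).setIntegral_Icc_left_nonpos h ht
      (h.clusterLeft_le_clusterRight ht x))
    ((h.isContact_clusterLeft ht x).setIntegral_Icc_right_nonneg h ht
      (h.clusterLeft_le_clusterRight ht x))

end Clusters

/-! ### Evolution of the clusters in time -/

section Evolution

variable {μ : Measure ℝ} {u : ℝ → ℝ} {t s x : ℝ}

theorem Admissible.setIntegral_id_lt (h : Admissible μ u) {S : Set ℝ} {c d a b C : ℝ}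
    (hcd : c < d) (hS : Ioo c d ⊆ S) (hS' : S ⊆ Icc a b) (hSm : MeasurableSet S)
    (hle : ∀ η ∈ S, η ≤ C) (hdC : d ≤ C) : ∫ η in S, η ∂μ < C * μ.real S := by
  have : IsFiniteMeasure (μ.restrict S) := ⟨by simpa using h.measure_lt_top hS'⟩
  have hi := integrableOn_of_bdd h.locallyIntegrable_id hS'
  have h1 : 0 < ∫ η in S, (C - η) ∂μ := by
    rw [setIntegral_pos_iff_support_of_nonneg_ae
      ((ae_restrict_iff' hSm).2 (Eventually.of_forall fun η hη => sub_nonneg.2 (hle η hη)))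
      ((integrable_const C).sub hi)]
    have h2 := h.measureReal_pos hcd subset_rfl Ioo_subset_Icc_self
    refine lt_of_lt_of_le (ENNReal.toReal_pos_iff.1 h2).1 (measure_mono fun η hη => ?_)
    exact ⟨(sub_pos.2 (hη.2.trans_le hdC)).ne', hS hη⟩
  rw [integral_sub (integrable_const C) hi] at h1
  simp only [integral_const, measureReal_restrict_apply_univ, smul_eq_mul] at h1
  linarith

theorem Admissible.lt_setIntegral_id (h : Admissible μ u) {S : Set ℝ} {c d a b C : ℝ}
    (hcd : c < d) (hS : Ioo c d ⊆ S) (hS' : S ⊆ Icc a b) (hSm : MeasurableSet S)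
    (hle : ∀ η ∈ S, C ≤ η) (hdC : C ≤ c) : C * μ.real S < ∫ η in S, η ∂μ := by
  have : IsFiniteMeasure (μ.restrict S) := ⟨by simpa using h.measure_lt_top hS'⟩
  have hi := integrableOn_of_bdd h.locallyIntegrable_id hS'
  have h1 : 0 < ∫ η in S, (η - C) ∂μ := by
    rw [setIntegral_pos_iff_support_of_nonneg_ae
      ((ae_restrict_iff' hSm).2 (Eventually.of_forall fun η hη => sub_nonneg.2 (hle η hη)))
      (hi.sub (integrable_const C))]
    have h2 := h.measureReal_pos hcd subset_rfl Ioo_subset_Icc_self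
    refine lt_of_lt_of_le (ENNReal.toReal_pos_iff.1 h2).1 (measure_mono fun η hη => ?_)
    exact ⟨(sub_pos.2 (hdC.trans_lt hη.1)).ne', hS hη⟩
  rw [integral_sub hi (integrable_const C)] at h1
  simp only [integral_const, measureReal_restrict_apply_univ, smul_eq_mul] at h1
  linarith

/-- Particles which have met stay together. If the two sides of a cluster of time `s` were apart at
time `t`, with a contact point `c` between them, then the mean of `η + t u(η)` would be smaller on
the left side. But that of `η + s u(η)` is larger there, and hence so is that of
`η + t u(η) = (t/s) (η + s u(η)) - (t/s - 1) η`, as the mean of `η` is smaller on the left side. -/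
theorem Admissible.flow_eq_of_le (h : Admissible μ u) (hs : 0 ≤ s) (hst : s ≤ t) {a b : ℝ}
    (hab : flow μ u s a = flow μ u s b) : flow μ u t a = flow μ u t b := by
  rcases hs.eq_or_lt with rfl | hs0
  · rw [h.flow_zero, h.flow_zero] at hab
    rw [hab]
  have ht : 0 ≤ t := hs.trans hst
  set x := flow μ u s a with hx
  set α := clusterLeft μ u x s
  set β := clusterRight μ u x s
  suffices hαβ : flow μ u t β ≤ flow μ u t α by
    have key : ∀ c, flow μ u s c = x → flow μ u t c = flow μ u t α := fun c hc =>
      le_antisymm ((h.flow_monotone ht (h.le_clusterRight hs hc)).trans hαβ)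
        (h.flow_monotone ht (h.clusterLeft_le hs hc))
    rw [key a rfl, key b hab.symm]
  by_contra! hcon
  obtain ⟨y, hy1, hy2⟩ := exists_between hcon
  obtain ⟨c, hc⟩ := h.exists_isContact ht y
  have hcy := hc.flow_eq h ht
  have hαc : α < c := by
    by_contra! hh
    have := h.flow_monotone ht hh
    linarith
  have hcβ : c < β := by
    by_contra! hh
    have := h.flow_monotone ht hh
    linarith
  have h1 := hc.1 α hαc
  have h2 := hc.setIntegral_Icc_right_nonneg h ht hcβ.le
  have hA := h.isContact_clusterLeft hs x
  have hB := h.isContact_clusterRight hs x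
  have h4 := hB.setIntegral_Icc_left_nonpos h hs hcβ.le
  have h3 : 0 ≤ ∫ η in Ico α c, (η + s * u η - x) ∂μ := by
    have := setIntegral_Icc_eq_Ico_add_Icc (h.locallyIntegrable_sub s x) hαc.le hcβ.le
    rw [h.setIntegral_cluster hs x] at this
    linarith
  have h5 := h.setIntegral_id_lt hαc Ioo_subset_Ico_self Ico_subset_Icc_self measurableSet_Ico
    (fun η hη => hη.2.le) le_rfl
  have h6 := h.lt_setIntegral_id hcβ Ioo_subset_Icc_self subset_rfl measurableSet_Icc
    (fun η hη => hη.1) le_rfl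
  rw [h.setIntegral_split _ _ Ico_subset_Icc_self] at h1 h3
  rw [h.setIntegral_split _ _ subset_rfl] at h2 h4
  have m1 := h.measureReal_Ico_pos hαc
  have m2 := h.measureReal_Icc_pos hcβ
  set M1 := μ.real (Ico α c)
  set M2 := μ.real (Icc c β)
  set I1 := ∫ η in Ico α c, η ∂μ
  set I2 := ∫ η in Icc c β, η ∂μ
  set V1 := ∫ η in Ico α c, u η ∂μ
  set V2 := ∫ η in Icc c β, u η ∂μ
  -- eliminating `V1` and `V2` leaves one number `e`, which is negative by the left side and
  -- non-negative by the right side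
  set e := t * x - (t - s) * c - s * y with he
  have k2 : 0 ≤ e * M2 := by
    have a1 : t * (I2 + s * V2 - x * M2) ≤ 0 := mul_nonpos_of_nonneg_of_nonpos ht h4
    have a2 : 0 ≤ s * (I2 + t * V2 - y * M2) := mul_nonneg hs h2
    have a3 : 0 ≤ (t - s) * (I2 - c * M2) := mul_nonneg (by linarith) (by linarith)
    rw [he]; nlinarith
  rcases hst.eq_or_lt with rfl | hst
  · have : flow μ u s α = flow μ u s β := by
      rw [h.flow_clusterLeft hs, h.flow_clusterRight hs]
    exact hcon.ne this
  have k1' : e * M1 < 0 := by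
    have a1 : 0 ≤ t * (I1 + s * V1 - x * M1) := mul_nonneg ht h3
    have a2 : s * (I1 + t * V1 - y * M1) ≤ 0 := mul_nonpos_of_nonneg_of_nonpos hs h1
    have a3 : 0 < (t - s) * (c * M1 - I1) := mul_pos (by linarith) (by linarith)
    rw [he]; nlinarith
  have := neg_of_mul_neg_left k1' m1.le
  have := nonneg_of_mul_nonneg_left k2 m2
  linarith

/-- The left end of a cluster has met no other particle before. -/
theorem Admissible.eq_of_flow_eq_clusterLeft (h : Admissible μ u) (hs : 0 ≤ s) (hst : s < t)
    {a b : ℝ} (ha : clusterLeft μ u (flow μ u t a) t = a) (hab : flow μ u s b = flow μ u s a) :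
    b = a := by
  have ht : 0 ≤ t := hs.trans hst.le
  have hl : ∀ c, flow μ u s c = flow μ u s a → a ≤ c := fun c hc =>
    ha.symm.trans_le (h.clusterLeft_le ht (h.flow_eq_of_le hs hst.le hc))
  have hla : clusterLeft μ u (flow μ u s a) s = a :=
    le_antisymm (h.clusterLeft_le hs rfl) (hl _ (h.flow_clusterLeft hs _))
  by_contra hne
  have hlt : a < clusterRight μ u (flow μ u s a) s :=
    (lt_of_le_of_ne (hl b hab) (Ne.symm hne)).trans_le (h.le_clusterRight hs hab)
  have h1 := h.setIntegral_cluster hs (flow μ u s a)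
  rw [hla] at h1
  set β := clusterRight μ u (flow μ u s a) s with hβ
  clear_value β
  have hA := h.isContact_clusterLeft hs (flow μ u s a)
  have hA' := h.isContact_clusterLeft ht (flow μ u t a)
  rw [hla] at hA
  rw [ha] at hA'
  have e1 := hA.eq h hs
  have e2 := hA'.eq h ht
  have h2 := hA'.setIntegral_Icc_right_nonneg h ht hlt.le
  have h3 := h.lt_setIntegral_id hlt Ioo_subset_Icc_self subset_rfl measurableSet_Icc
    (fun η hη => hη.1) le_rfl
  rw [h.setIntegral_split _ _ subset_rfl] at h1 h2
  rw [← e1] at h1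
  rw [← e2] at h2
  have k1 : 0 < (t - s) * ((∫ η in Icc a β, η ∂μ) - a * μ.real (Icc a β)) :=
    mul_pos (by linarith) (by linarith)
  nlinarith [mul_nonneg hs h2]

/-- The right end of a cluster has met no other particle before. -/
theorem Admissible.eq_of_flow_eq_clusterRight (h : Admissible μ u) (hs : 0 ≤ s) (hst : s < t)
    {a b : ℝ} (ha : clusterRight μ u (flow μ u t a) t = a) (hab : flow μ u s b = flow μ u s a) :
    b = a := by
  have ht : 0 ≤ t := hs.trans hst.le
  have hl : ∀ c, flow μ u s c = flow μ u s a → c ≤ a := fun c hc =>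
    (h.le_clusterRight ht (h.flow_eq_of_le hs hst.le hc)).trans_eq ha
  have hla : clusterRight μ u (flow μ u s a) s = a :=
    le_antisymm (hl _ (h.flow_clusterRight hs _)) (h.le_clusterRight hs rfl)
  by_contra hne
  have hlt : clusterLeft μ u (flow μ u s a) s < a :=
    (h.clusterLeft_le hs hab).trans_lt (lt_of_le_of_ne (hl b hab) hne)
  have h1 := h.setIntegral_cluster hs (flow μ u s a)
  rw [hla] at h1
  set α := clusterLeft μ u (flow μ u s a) s with hα
  clear_value α
  have hA := h.isContact_clusterRight hs (flow μ u s a)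
  have hA' := h.isContact_clusterRight ht (flow μ u t a)
  rw [hla] at hA
  rw [ha] at hA'
  have e1 := hA.eq h hs
  have e2 := hA'.eq h ht
  have h2 := hA'.setIntegral_Icc_left_nonpos h ht hlt.le
  have h3 := h.setIntegral_id_lt hlt Ioo_subset_Icc_self subset_rfl measurableSet_Icc
    (fun η hη => hη.2) le_rfl
  rw [h.setIntegral_split _ _ subset_rfl] at h1 h2
  rw [← e1] at h1
  rw [← e2] at h2
  have k1 : 0 < (t - s) * (a * μ.real (Icc α a) - ∫ η in Icc α a, η ∂μ) :=
    mul_pos (by linarith) (by linarith)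
  nlinarith [mul_nonpos_of_nonneg_of_nonpos hs h2]

end Evolution

/-! ### Trajectories -/

/-- The mean initial position `μ[c,d]⁻¹ ∫_{[c,d]} η dμ(η)` of the particles starting in `[c,d]`. It
is `c` if `c = d`, even if `{c}` has no mass. -/
def massCentre (μ : Measure ℝ) (c d : ℝ) : ℝ :=
  if c < d then ⨍ η in Icc c d, η ∂μ else c

section Trajectories

variable {μ : Measure ℝ} {u : ℝ → ℝ} {t s : ℝ}

theorem massCentre_self (μ : Measure ℝ) (c : ℝ) : massCentre μ c c = c := by
  simp [massCentre]

theorem Admissible.massCentre_mul (h : Admissible μ u) {c d : ℝ} (hcd : c < d) :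
    massCentre μ c d * μ.real (Icc c d) = ∫ η in Icc c d, η ∂μ := by
  have hm := h.measureReal_Icc_pos hcd
  rw [massCentre, if_pos hcd, setAverage_eq, smul_eq_mul]
  field_simp

theorem Admissible.le_massCentre (h : Admissible μ u) {c d : ℝ} (hcd : c ≤ d) :
    c ≤ massCentre μ c d := by
  rcases hcd.eq_or_lt with rfl | hcd
  · rw [massCentre_self]
  have h1 := h.lt_setIntegral_id hcd Ioo_subset_Icc_self subset_rfl measurableSet_Icc
    (fun η hη => hη.1) le_rfl
  rw [← h.massCentre_mul hcd] at h1
  exact (lt_of_mul_lt_mul_right h1 measureReal_nonneg).le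

theorem Admissible.massCentre_le (h : Admissible μ u) {c d : ℝ} (hcd : c ≤ d) :
    massCentre μ c d ≤ d := by
  rcases hcd.eq_or_lt with rfl | hcd
  · rw [massCentre_self]
  have h1 := h.setIntegral_id_lt hcd Ioo_subset_Icc_self subset_rfl measurableSet_Icc
    (fun η hη => hη.2) le_rfl
  rw [← h.massCentre_mul hcd] at h1
  exact (lt_of_mul_lt_mul_right h1 measureReal_nonneg).le

theorem Admissible.tendsto_massCentre (h : Admissible μ u) {ι : Type*} {l : Filter ι}
    [l.IsCountablyGenerated] {c d : ι → ℝ} {c₀ d₀ : ℝ} (hc : Tendsto c l (𝓝 c₀))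
    (hd : Tendsto d l (𝓝 d₀)) (hc' : ∀ᶠ i in l, c i ≤ c₀) (hd' : ∀ᶠ i in l, d₀ ≤ d i)
    (hcd : c₀ ≤ d₀) :
    Tendsto (fun i => massCentre μ (c i) (d i)) l (𝓝 (massCentre μ c₀ d₀)) := by
  have := h.locallyFinite
  rcases hcd.eq_or_lt with rfl | hcd
  · rw [massCentre_self]
    refine tendsto_of_tendsto_of_tendsto_of_le_of_le' hc hd ?_ ?_
    · filter_upwards [hc', hd'] with i h1 h2 using h.le_massCentre (h1.trans h2)
    · filter_upwards [hc', hd'] with i h1 h2 using h.massCentre_le (h1.trans h2)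
  · have h1 := tendsto_setIntegral_Icc_of_le h.locallyIntegrable_id hc hd hc' hd'
    have h2 := tendsto_setIntegral_Icc_of_le
      ((continuous_const (y := (1 : ℝ))).locallyIntegrable (μ := μ)) hc hd hc' hd'
    simp only [setIntegral_const, smul_eq_mul, mul_one] at h2
    rw [massCentre, if_pos hcd, setAverage_eq, smul_eq_mul]
    refine ((h2.inv₀ (h.measureReal_Icc_pos hcd).ne').mul h1).congr' ?_
    filter_upwards [hc', hd'] with i h3 h4
    rw [massCentre, if_pos (h3.trans_lt (hcd.trans_le h4)), setAverage_eq, smul_eq_mul]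

/-- The left end at time `t` of the cluster of the particle `a`. -/
def lo (μ : Measure ℝ) (u : ℝ → ℝ) (t a : ℝ) : ℝ := clusterLeft μ u (flow μ u t a) t

/-- The right end at time `t` of the cluster of the particle `a`. -/
def hi (μ : Measure ℝ) (u : ℝ → ℝ) (t a : ℝ) : ℝ := clusterRight μ u (flow μ u t a) t

theorem Admissible.lo_le (h : Admissible μ u) (ht : 0 ≤ t) (a : ℝ) : lo μ u t a ≤ a :=
  h.clusterLeft_le ht rfl

theorem Admissible.le_hi (h : Admissible μ u) (ht : 0 ≤ t) (a : ℝ) : a ≤ hi μ u t a :=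
  h.le_clusterRight ht rfl

theorem Admissible.lo_le_hi (h : Admissible μ u) (ht : 0 ≤ t) (a : ℝ) :
    lo μ u t a ≤ hi μ u t a := (h.lo_le ht a).trans (h.le_hi ht a)

theorem Admissible.flow_lo (h : Admissible μ u) (ht : 0 ≤ t) (a : ℝ) :
    flow μ u t (lo μ u t a) = flow μ u t a := h.flow_clusterLeft ht _

theorem Admissible.flow_hi (h : Admissible μ u) (ht : 0 ≤ t) (a : ℝ) :
    flow μ u t (hi μ u t a) = flow μ u t a := h.flow_clusterRight ht _

theorem Admissible.flow_eq_iff (h : Admissible μ u) (ht : 0 ≤ t) {a b : ℝ} :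
    flow μ u t b = flow μ u t a ↔ b ∈ Icc (lo μ u t a) (hi μ u t a) :=
  ⟨fun hb => ⟨h.clusterLeft_le ht hb, h.le_clusterRight ht hb⟩, fun hb =>
    h.flow_eq_of_mem ht hb.1 hb.2⟩

theorem lo_congr {a b : ℝ} (hab : flow μ u t a = flow μ u t b) : lo μ u t a = lo μ u t b := by
  rw [lo, lo, hab]

theorem hi_congr {a b : ℝ} (hab : flow μ u t a = flow μ u t b) : hi μ u t a = hi μ u t b := by
  rw [hi, hi, hab]

theorem Admissible.lo_anti (h : Admissible μ u) (hs : 0 ≤ s) (hst : s ≤ t) (a : ℝ) :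
    lo μ u t a ≤ lo μ u s a :=
  h.clusterLeft_le (hs.trans hst) (h.flow_eq_of_le hs hst (h.flow_lo hs a))

theorem Admissible.hi_mono (h : Admissible μ u) (hs : 0 ≤ s) (hst : s ≤ t) (a : ℝ) :
    hi μ u s a ≤ hi μ u t a :=
  h.le_clusterRight (hs.trans hst) (h.flow_eq_of_le hs hst (h.flow_hi hs a))

theorem Admissible.lo_monotone (h : Admissible μ u) (ht : 0 ≤ t) : Monotone (lo μ u t) :=
  fun _ _ hab => (h.clusterLeft_strictMono ht).monotone (h.flow_monotone ht hab)

theorem Admissible.clusterRight_strictMono (h : Admissible μ u) (ht : 0 ≤ t) :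
    StrictMono fun x => clusterRight μ u x t := fun _ _ hxy =>
  (h.clusterRight_lt_clusterLeft ht hxy).trans_le (h.clusterLeft_le_clusterRight ht _)

theorem Admissible.hi_monotone (h : Admissible μ u) (ht : 0 ≤ t) : Monotone (hi μ u t) :=
  fun _ _ hab => (h.clusterRight_strictMono ht).monotone (h.flow_monotone ht hab)

theorem Admissible.isContact_lo (h : Admissible μ u) (ht : 0 ≤ t) (a : ℝ) :
    IsContact μ u t (flow μ u t a) (lo μ u t a) := h.isContact_clusterLeft ht _

theorem Admissible.isContact_hi (h : Admissible μ u) (ht : 0 ≤ t) (a : ℝ) :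
    IsContact μ u t (flow μ u t a) (hi μ u t a) := h.isContact_clusterRight ht _

theorem Admissible.flow_eq_lo (h : Admissible μ u) (ht : 0 ≤ t) (a : ℝ) :
    flow μ u t a = lo μ u t a + t * u (lo μ u t a) := ((h.isContact_lo ht a).eq h ht).symm

theorem Admissible.flow_eq_hi (h : Admissible μ u) (ht : 0 ≤ t) (a : ℝ) :
    flow μ u t a = hi μ u t a + t * u (hi μ u t a) := ((h.isContact_hi ht a).eq h ht).symm

/-- A bound on the displacement of `a` between `t` and `s` in which the velocity does not occur: it is
eliminated from two contact inequalities over the interval between the left end of the cluster of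
time `s` and the right end of the cluster of time `t`. -/
theorem Admissible.mul_flow_le (h : Admissible μ u) (ht : 0 ≤ t) (hts : t ≤ s) (a : ℝ) :
    t * flow μ u s a ≤ s * flow μ u t a - (s - t) * massCentre μ (lo μ u s a) (hi μ u t a) := by
  have hs := ht.trans hts
  have h1 := h.lo_le hs a
  have h2 := h.le_hi ht a
  rcases (h1.trans h2).eq_or_lt with heq | hlt
  · have e1 : lo μ u s a = a := le_antisymm h1 (heq ▸ h2)
    have e2 : hi μ u t a = a := by rw [← heq, e1]
    have e3 := h.flow_eq_lo hs a
    have e4 := h.flow_eq_hi ht a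
    rw [e1] at e3
    rw [e2] at e4
    rw [e1, e2, massCentre_self, e3, e4]
    apply le_of_eq; ring
  · have h3 := (h.isContact_lo hs a).setIntegral_Icc_right_nonneg h hs hlt.le
    have h4 := (h.isContact_hi ht a).setIntegral_Icc_left_nonpos h ht hlt.le
    rw [h.setIntegral_split _ _ subset_rfl] at h3 h4
    have h5 := h.massCentre_mul hlt
    have hm := h.measureReal_Icc_pos hlt
    refine le_of_mul_le_mul_right ?_ hm
    linear_combination t * h3 + s * h4 + (s - t) * h5

/-- The counterpart of `Admissible.mul_flow_le` with left and right exchanged. -/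
theorem Admissible.le_mul_flow (h : Admissible μ u) (ht : 0 ≤ t) (hts : t ≤ s) (a : ℝ) :
    s * flow μ u t a - (s - t) * massCentre μ (lo μ u t a) (hi μ u s a) ≤ t * flow μ u s a := by
  have hs := ht.trans hts
  have h1 := h.lo_le ht a
  have h2 := h.le_hi hs a
  rcases (h1.trans h2).eq_or_lt with heq | hlt
  · have e1 : lo μ u t a = a := le_antisymm h1 (heq ▸ h2)
    have e2 : hi μ u s a = a := by rw [← heq, e1]
    have e3 := h.flow_eq_hi hs a
    have e4 := h.flow_eq_lo ht a
    rw [e2] at e3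
    rw [e1] at e4
    rw [e1, e2, massCentre_self, e3, e4]
    apply le_of_eq; ring
  · have h3 := (h.isContact_hi hs a).setIntegral_Icc_left_nonpos h hs hlt.le
    have h4 := (h.isContact_lo ht a).setIntegral_Icc_right_nonneg h ht hlt.le
    rw [h.setIntegral_split _ _ subset_rfl] at h3 h4
    have h5 := h.massCentre_mul hlt
    have hm := h.measureReal_Icc_pos hlt
    refine le_of_mul_le_mul_right ?_ hm
    linear_combination t * h3 + s * h4 + (t - s) * h5

/-- On `(0, T]`, the quotient `φ_{0,s}(a) / s` is a Lipschitz function of `1 / s`. -/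
theorem Admissible.abs_flow_div_sub_le (h : Admissible μ u) {T : ℝ} (ht : 0 < t) (hts : t ≤ s)
    (hsT : s ≤ T) (a : ℝ) :
    |flow μ u s a / s - flow μ u t a / t| ≤
      max |lo μ u T a| |hi μ u T a| * (1 / t - 1 / s) := by
  have hs := ht.trans_le hts
  set C := max |lo μ u T a| |hi μ u T a|
  have hC : ∀ m, lo μ u T a ≤ m → m ≤ hi μ u T a → |m| ≤ C := fun m h1 h2 => by
    refine abs_le.2 ⟨?_, ?_⟩
    · linarith [neg_abs_le (lo μ u T a), le_max_left |lo μ u T a| |hi μ u T a|]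
    · linarith [le_abs_self (hi μ u T a), le_max_right |lo μ u T a| |hi μ u T a|]
  have h1 := h.mul_flow_le ht.le hts a
  have h2 := h.le_mul_flow ht.le hts a
  have h3 : |massCentre μ (lo μ u s a) (hi μ u t a)| ≤ C := by
    have hle := (h.lo_le hs.le a).trans (h.le_hi ht.le a)
    exact hC _ ((h.lo_anti hs.le hsT a).trans (h.le_massCentre hle))
      ((h.massCentre_le hle).trans (h.hi_mono ht.le (hts.trans hsT) a))
  have h4 : |massCentre μ (lo μ u t a) (hi μ u s a)| ≤ C := by
    have hle := (h.lo_le ht.le a).trans (h.le_hi hs.le a)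
    exact hC _ ((h.lo_anti ht.le (hts.trans hsT) a).trans (h.le_massCentre hle))
      ((h.massCentre_le hle).trans (h.hi_mono hs.le hsT a))
  have e1 : flow μ u s a / s - flow μ u t a / t = (t * flow μ u s a - s * flow μ u t a) / (s * t) := by
    field_simp
  have e2 : C * (1 / t - 1 / s) = C * (s - t) / (s * t) := by field_simp
  rw [e1, e2, abs_div, abs_of_pos (mul_pos hs ht)]
  refine div_le_div_of_nonneg_right ?_ (mul_pos hs ht).le
  have hst : 0 ≤ s - t := sub_nonneg.2 hts
  refine abs_le.2 ⟨?_, ?_⟩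
  · have := mul_le_mul_of_nonneg_left (abs_le.1 h4).2 hst
    linarith
  · have := mul_le_mul_of_nonneg_left (abs_le.1 h3).1 hst
    linarith

theorem Admissible.flow_continuousAt (h : Admissible μ u) (ht : 0 < t) (a : ℝ) :
    ContinuousAt (fun s => flow μ u s a) t := by
  set C := max |lo μ u (t + 1) a| |hi μ u (t + 1) a|
  have key : Tendsto (fun s => flow μ u s a / s) (𝓝 t) (𝓝 (flow μ u t a / t)) := by
    rw [tendsto_iff_norm_sub_tendsto_zero]
    have h1 : Tendsto (fun s => C * |1 / t - 1 / s|) (𝓝 t) (𝓝 0) := by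
      have : ContinuousAt (fun s => C * |1 / t - 1 / s|) t := by
        have := ht.ne'
        fun_prop (disch := assumption)
      simpa [ContinuousAt] using this
    refine squeeze_zero' (Eventually.of_forall fun _ => norm_nonneg _) ?_ h1
    filter_upwards [lt_mem_nhds ht, gt_mem_nhds (lt_add_one t)] with s hs0 hs1
    rcases le_total t s with hts | hts
    · refine (h.abs_flow_div_sub_le ht hts hs1.le a).trans ?_
      gcongr
      exact le_abs_self _
    · rw [Real.norm_eq_abs, abs_sub_comm]
      refine (h.abs_flow_div_sub_le hs0 hts (lt_add_one t).le a).trans ?_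
      gcongr
      rw [abs_sub_comm]
      exact le_abs_self _
  have h2 := key.mul (tendsto_id (α := ℝ) (x := 𝓝 t))
  simp only [id, div_mul_cancel₀ _ ht.ne'] at h2
  refine h2.congr' ?_
  filter_upwards [lt_mem_nhds ht] with s hs
  rw [div_mul_cancel₀ _ hs.ne']

/-- For `d < a` the position of `a` is bounded from below by the barycentre of `[d, β]`, with `β` the
right end of its cluster; as this interval has at least the mass of `[d, a]`, the velocity displaces
its barycentre by at most a multiple of the time. The upper bound is similar. -/
theorem Admissible.flow_tendsto_zero (h : Admissible μ u) (a : ℝ) :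
    Tendsto (fun s => flow μ u s a) (𝓝[>] 0) (𝓝 a) := by
  have hpos : ∀ᶠ s : ℝ in 𝓝[>] 0, 0 < s := self_mem_nhdsWithin
  have hle1 : ∀ᶠ s : ℝ in 𝓝[>] 0, s < 1 := mem_nhdsWithin_of_mem_nhds (gt_mem_nhds one_pos)
  have habs : ∀ c d c' d', c' ≤ c → d ≤ d' →
      |∫ η in Icc c d, u η ∂μ| ≤ ∫ η in Icc c' d', ‖u η‖ ∂μ := by
    intro c d c' d' hc hd
    rw [← Real.norm_eq_abs]
    refine (norm_integral_le_integral_norm _).trans (setIntegral_mono_set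
      (integrableOn_of_bdd h.locallyIntegrable subset_rfl).norm
      (Eventually.of_forall fun _ => norm_nonneg _) (Icc_subset_Icc hc hd).eventuallyLE)
  refine tendsto_order.2 ⟨fun z hz => ?_, fun z hz => ?_⟩
  · obtain ⟨d, hd1, hd2⟩ := exists_between hz
    set C := ∫ η in Icc d (hi μ u 1 a), ‖u η‖ ∂μ
    set M₀ := μ.real (Icc d a)
    have hM₀ : 0 < M₀ := h.measureReal_Icc_pos hd2
    have hlim : Tendsto (fun s : ℝ => d - s * C / M₀) (𝓝[>] 0) (𝓝 d) := by
      have : Tendsto (fun s : ℝ => d - s * C / M₀) (𝓝 0) (𝓝 (d - 0 * C / M₀)) :=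
        tendsto_const_nhds.sub ((tendsto_id.mul_const C).div_const M₀)
      rw [zero_mul, zero_div, sub_zero] at this
      exact this.mono_left nhdsWithin_le_nhds
    filter_upwards [hpos, hle1, hlim.eventually (lt_mem_nhds hd1)] with s hs0 hs1 hs2
    refine hs2.trans_le ?_
    have hlt : d < hi μ u s a := hd2.trans_le (h.le_hi hs0.le a)
    have h1 := (h.isContact_hi hs0.le a).setIntegral_Icc_left_nonpos h hs0.le hlt.le
    have h2 := h.lt_setIntegral_id hlt Ioo_subset_Icc_self subset_rfl measurableSet_Icc
      (fun η hη => hη.1) le_rfl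
    rw [h.setIntegral_split _ _ subset_rfl] at h1
    have h3 := (abs_le.1 (habs d (hi μ u s a) d (hi μ u 1 a) le_rfl (h.hi_mono hs0.le hs1.le a))).1
    have hMM : M₀ ≤ μ.real (Icc d (hi μ u s a)) :=
      measureReal_mono (Icc_subset_Icc_right (h.le_hi hs0.le a)) (h.measure_lt_top subset_rfl).ne
    set M := μ.real (Icc d (hi μ u s a))
    have hM : 0 < M := hM₀.trans_le hMM
    have hC : 0 ≤ C := integral_nonneg fun _ => norm_nonneg _
    have h4 : s * C ≤ s * C / M₀ * M := by
      rw [div_mul_eq_mul_div, le_div_iff₀ hM₀]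
      gcongr
    have h5 := mul_le_mul_of_nonneg_left h3 hs0.le
    refine le_of_mul_le_mul_right ?_ hM
    linarith
  · obtain ⟨d, hd1, hd2⟩ := exists_between hz
    set C := ∫ η in Icc (lo μ u 1 a) d, ‖u η‖ ∂μ
    set M₀ := μ.real (Icc a d)
    have hM₀ : 0 < M₀ := h.measureReal_Icc_pos hd1
    have hlim : Tendsto (fun s : ℝ => d + s * C / M₀) (𝓝[>] 0) (𝓝 d) := by
      have : Tendsto (fun s : ℝ => d + s * C / M₀) (𝓝 0) (𝓝 (d + 0 * C / M₀)) :=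
        tendsto_const_nhds.add ((tendsto_id.mul_const C).div_const M₀)
      rw [zero_mul, zero_div, add_zero] at this
      exact this.mono_left nhdsWithin_le_nhds
    filter_upwards [hpos, hle1, hlim.eventually (gt_mem_nhds hd2)] with s hs0 hs1 hs2
    refine lt_of_le_of_lt ?_ hs2
    have hlt : lo μ u s a < d := (h.lo_le hs0.le a).trans_lt hd1
    have h1 := (h.isContact_lo hs0.le a).setIntegral_Icc_right_nonneg h hs0.le hlt.le
    have h2 := h.setIntegral_id_lt hlt Ioo_subset_Icc_self subset_rfl measurableSet_Icc
      (fun η hη => hη.2) le_rfl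
    rw [h.setIntegral_split _ _ subset_rfl] at h1
    have h3 := (abs_le.1 (habs (lo μ u s a) d (lo μ u 1 a) d (h.lo_anti hs0.le hs1.le a) le_rfl)).2
    have hMM : M₀ ≤ μ.real (Icc (lo μ u s a) d) :=
      measureReal_mono (Icc_subset_Icc_left (h.lo_le hs0.le a)) (h.measure_lt_top subset_rfl).ne
    set M := μ.real (Icc (lo μ u s a) d)
    have hM : 0 < M := hM₀.trans_le hMM
    have hC : 0 ≤ C := integral_nonneg fun _ => norm_nonneg _
    have h4 : s * C ≤ s * C / M₀ * M := by
      rw [div_mul_eq_mul_div, le_div_iff₀ hM₀]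
      gcongr
    have h5 := mul_le_mul_of_nonneg_left h3 hs0.le
    refine le_of_mul_le_mul_right ?_ hM
    linarith

theorem Admissible.flow_tendsto_right (h : Admissible μ u) (ht : 0 ≤ t) (a : ℝ) :
    Tendsto (fun s => flow μ u s a) (𝓝[>] t) (𝓝 (flow μ u t a)) := by
  rcases ht.eq_or_lt with rfl | ht
  · rw [h.flow_zero]
    exact h.flow_tendsto_zero a
  · exact (h.flow_continuousAt ht a).tendsto.mono_left nhdsWithin_le_nhds

theorem Admissible.lo_tendsto_right (h : Admissible μ u) (ht : 0 ≤ t) (a : ℝ) :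
    Tendsto (fun s => lo μ u s a) (𝓝[>] t) (𝓝 (lo μ u t a)) := by
  have hpos : ∀ᶠ s : ℝ in 𝓝[>] t, t < s := self_mem_nhdsWithin
  refine tendsto_order.2 ⟨fun b hb => ?_, fun b hb => ?_⟩
  · filter_upwards [hpos, (h.flow_tendsto_right ht b).eventually_lt (h.flow_tendsto_right ht a)
      (h.flow_lt_of_lt_clusterLeft ht hb)] with s hs hsb
    by_contra! hcon
    have := h.flow_monotone (ht.trans hs.le) hcon
    rw [h.flow_lo (ht.trans hs.le)] at this
    linarith
  · filter_upwards [hpos] with s hs using (h.lo_anti ht hs.le a).trans_lt hb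

theorem Admissible.hi_tendsto_right (h : Admissible μ u) (ht : 0 ≤ t) (a : ℝ) :
    Tendsto (fun s => hi μ u s a) (𝓝[>] t) (𝓝 (hi μ u t a)) := by
  have hpos : ∀ᶠ s : ℝ in 𝓝[>] t, t < s := self_mem_nhdsWithin
  refine tendsto_order.2 ⟨fun b hb => ?_, fun b hb => ?_⟩
  · filter_upwards [hpos] with s hs using hb.trans_le (h.hi_mono ht hs.le a)
  · filter_upwards [hpos, (h.flow_tendsto_right ht a).eventually_lt (h.flow_tendsto_right ht b)
      (h.lt_flow_of_clusterRight_lt ht hb)] with s hs hsb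
    by_contra! hcon
    have := h.flow_monotone (ht.trans hs.le) hcon
    rw [h.flow_hi (ht.trans hs.le)] at this
    linarith

theorem Admissible.massCentre_tendsto_right (h : Admissible μ u) (ht : 0 ≤ t) (a : ℝ) :
    Tendsto (fun s => massCentre μ (lo μ u s a) (hi μ u s a)) (𝓝[>] t)
      (𝓝 (massCentre μ (lo μ u t a) (hi μ u t a))) := by
  have hpos : ∀ᶠ s : ℝ in 𝓝[>] t, t < s := self_mem_nhdsWithin
  refine h.tendsto_massCentre (h.lo_tendsto_right ht a) (h.hi_tendsto_right ht a) ?_ ?_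
    (h.lo_le_hi ht a)
  · filter_upwards [hpos] with s hs using h.lo_anti ht hs.le a
  · filter_upwards [hpos] with s hs using h.hi_mono ht hs.le a

/-- The difference quotients at `t` lie between the bounds given by `Admissible.le_mul_flow` and
`Admissible.mul_flow_le`, which have the same limit as the clusters are right-continuous in time. -/
theorem Admissible.hasDerivWithinAt_flow (h : Admissible μ u) (ht : 0 < t) (a : ℝ) :
    HasDerivWithinAt (fun s => flow μ u s a)
      ((flow μ u t a - massCentre μ (lo μ u t a) (hi μ u t a)) / t) (Ici t) t := by
  have hpos : ∀ᶠ s : ℝ in 𝓝[>] t, t < s := self_mem_nhdsWithin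
  rw [← hasDerivWithinAt_Ioi_iff_Ici, hasDerivWithinAt_iff_tendsto_slope' self_notMem_Ioi]
  have h1 : Tendsto (fun s => massCentre μ (lo μ u s a) (hi μ u t a)) (𝓝[>] t)
      (𝓝 (massCentre μ (lo μ u t a) (hi μ u t a))) := by
    refine h.tendsto_massCentre (h.lo_tendsto_right ht.le a) tendsto_const_nhds ?_
      (Eventually.of_forall fun _ => le_rfl) (h.lo_le_hi ht.le a)
    filter_upwards [hpos] with s hs using h.lo_anti ht.le hs.le a
  have h2 : Tendsto (fun s => massCentre μ (lo μ u t a) (hi μ u s a)) (𝓝[>] t)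
      (𝓝 (massCentre μ (lo μ u t a) (hi μ u t a))) := by
    refine h.tendsto_massCentre tendsto_const_nhds (h.hi_tendsto_right ht.le a)
      (Eventually.of_forall fun _ => le_rfl) ?_ (h.lo_le_hi ht.le a)
    filter_upwards [hpos] with s hs using h.hi_mono ht.le hs.le a
  refine tendsto_of_tendsto_of_tendsto_of_le_of_le'
    ((tendsto_const_nhds.sub h2).div_const t) ((tendsto_const_nhds.sub h1).div_const t) ?_ ?_
  · filter_upwards [hpos] with s hs
    have := h.le_mul_flow ht.le hs.le a
    rw [slope_def_field, div_le_div_iff₀ ht (sub_pos.2 hs)]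
    linarith
  · filter_upwards [hpos] with s hs
    have := h.mul_flow_le ht.le hs.le a
    rw [slope_def_field, div_le_div_iff₀ (sub_pos.2 hs) ht]
    linarith

/-! ### The velocity field -/

/-- The velocity of a cluster is its displacement from its mean initial position, divided by `t`. -/
theorem Admissible.velocity_eq (h : Admissible μ u) (ht : 0 < t) (x : ℝ) :
    velocity μ u x t =
      (x - massCentre μ (clusterLeft μ u x t) (clusterRight μ u x t)) / t := by
  have h1 := h.hasDerivWithinAt_flow ht (clusterLeft μ u x t)
  rw [lo, hi, h.flow_clusterLeft ht.le] at h1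
  exact h1.derivWithin (uniqueDiffOn_Ici t t self_mem_Ici)

theorem Admissible.velocity_flow (h : Admissible μ u) (ht : 0 < t) (a : ℝ) :
    velocity μ u (flow μ u t a) t =
      (flow μ u t a - massCentre μ (lo μ u t a) (hi μ u t a)) / t := h.velocity_eq ht _

/-- The velocity of a non-trivial cluster is the mean of the initial velocities (conservation of
momentum). -/
theorem Admissible.velocity_of_lt (h : Admissible μ u) (ht : 0 < t) {x : ℝ}
    (hlt : clusterLeft μ u x t < clusterRight μ u x t) :
    velocity μ u x t = ⨍ η in Icc (clusterLeft μ u x t) (clusterRight μ u x t), u η ∂μ := by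
  have h1 := h.setIntegral_cluster ht.le x
  rw [h.setIntegral_split _ _ subset_rfl, ← h.massCentre_mul hlt] at h1
  have hm := h.measureReal_Icc_pos hlt
  rw [h.velocity_eq ht, setAverage_eq, smul_eq_mul, div_eq_iff ht.ne',
    eq_comm, mul_assoc, inv_mul_eq_iff_eq_mul₀ hm.ne']
  linarith

theorem Admissible.velocity_of_eq (h : Admissible μ u) (ht : 0 < t) {a : ℝ}
    (hlo : lo μ u t a = a) (hhi : hi μ u t a = a) : velocity μ u (flow μ u t a) t = u a := by
  have h1 := h.flow_eq_lo ht.le a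
  rw [hlo] at h1
  rw [h.velocity_flow ht, hlo, hhi, massCentre_self, h1]
  field_simp
  ring

theorem Admissible.velocity_tendsto_left (h : Admissible μ u) (ht : 0 < t) (x : ℝ) :
    Tendsto (fun y => velocity μ u y t) (𝓝[<] x) (𝓝 ((x - clusterLeft μ u x t) / t)) := by
  simp only [h.velocity_eq ht]
  have h1 := h.tendsto_left ht.le (fun y => h.flow_clusterLeft ht.le y) x
  have h2 := h.tendsto_left ht.le (fun y => h.flow_clusterRight ht.le y) x
  have h3 := tendsto_of_tendsto_of_tendsto_of_le_of_le h1 h2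
    (fun y => h.le_massCentre (h.clusterLeft_le_clusterRight ht.le y))
    (fun y => h.massCentre_le (h.clusterLeft_le_clusterRight ht.le y))
  exact ((tendsto_id.mono_left nhdsWithin_le_nhds).sub h3).div_const t

theorem Admissible.velocity_tendsto_right (h : Admissible μ u) (ht : 0 < t) (x : ℝ) :
    Tendsto (fun y => velocity μ u y t) (𝓝[>] x) (𝓝 ((x - clusterRight μ u x t) / t)) := by
  simp only [h.velocity_eq ht]
  have h1 := h.tendsto_right ht.le (fun y => h.flow_clusterLeft ht.le y) x
  have h2 := h.tendsto_right ht.le (fun y => h.flow_clusterRight ht.le y) x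
  have h3 := tendsto_of_tendsto_of_tendsto_of_le_of_le h1 h2
    (fun y => h.le_massCentre (h.clusterLeft_le_clusterRight ht.le y))
    (fun y => h.massCentre_le (h.clusterLeft_le_clusterRight ht.le y))
  exact ((tendsto_id.mono_left nhdsWithin_le_nhds).sub h3).div_const t

/-- A particle is in a shock exactly if it has met another particle. -/
theorem Admissible.inShock_iff (h : Admissible μ u) (ht : 0 < t) (a : ℝ) :
    InShock μ u a t ↔ lo μ u t a < hi μ u t a := by
  rw [InShock, leftLim_eq_of_tendsto (h.velocity_tendsto_left ht _),
    rightLim_eq_of_tendsto (h.velocity_tendsto_right ht _), Ne,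
    div_left_inj' ht.ne', sub_right_inj]
  exact (h.lo_le_hi ht.le a).lt_iff_ne.symm

/-- The velocity of a particle has limits from the left in time. -/
theorem Admissible.exists_tendsto_velocity_left (h : Admissible μ u) (ht : 0 < t) (a : ℝ) :
    ∃ l, Tendsto (fun s => velocity μ u (flow μ u s a) s) (𝓝[<] t) (𝓝 l) := by
  have hpos : ∀ᶠ s : ℝ in 𝓝[<] t, 0 < s := mem_nhdsWithin_of_mem_nhds (lt_mem_nhds ht)
  have hlt : ∀ᶠ s : ℝ in 𝓝[<] t, s < t := self_mem_nhdsWithin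
  suffices hm : ∃ m, Tendsto (fun s => massCentre μ (lo μ u s a) (hi μ u s a)) (𝓝[<] t) (𝓝 m) by
    obtain ⟨m, hm⟩ := hm
    refine ⟨(flow μ u t a - m) / t, ?_⟩
    refine ((((h.flow_continuousAt ht a).tendsto.mono_left nhdsWithin_le_nhds).sub hm).div
      (tendsto_id.mono_left nhdsWithin_le_nhds) ht.ne').congr' ?_
    filter_upwards [hpos] with s hs
    rw [h.velocity_flow hs]
    rfl
  have := h.locallyFinite
  by_cases hcase : ∃ s₀, 0 ≤ s₀ ∧ s₀ < t ∧ lo μ u s₀ a < hi μ u s₀ a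
  · obtain ⟨s₀, hs₀, hs₀t, hs₀lt⟩ := hcase
    -- the clusters increase to the set of the particles met before `t`
    set S : Set ℝ := {b | ∃ s, 0 ≤ s ∧ s < t ∧ flow μ u s b = flow μ u s a} with hS
    have hgt : ∀ᶠ s : ℝ in 𝓝[<] t, s₀ ≤ s :=
      mem_nhdsWithin_of_mem_nhds (le_mem_nhds hs₀t)
    have hmem : ∀ b, ∀ᶠ s in 𝓝[<] t, (b ∈ Icc (lo μ u s a) (hi μ u s a) ↔ b ∈ S) := by
      intro b
      by_cases hb : b ∈ S
      · obtain ⟨r, hr0, hrt, hr⟩ := id hb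
        filter_upwards [mem_nhdsWithin_of_mem_nhds (lt_mem_nhds hrt), hpos] with s hs hs0
        exact iff_of_true ((h.flow_eq_iff hs0.le).1 (h.flow_eq_of_le hr0 hs.le hr)) hb
      · filter_upwards [hlt, hpos] with s hs hs0
        exact iff_of_false (fun hh => hb ⟨s, hs0.le, hs, (h.flow_eq_iff hs0.le).2 hh⟩) hb
    have hSord : S.OrdConnected := by
      refine ⟨fun b hb c hc d hd => ?_⟩
      obtain ⟨r, hr0, hrt, hr⟩ := hb
      obtain ⟨r', hr0', hrt', hr'⟩ := hc
      refine ⟨max r r', hr0.trans (le_max_left _ _), max_lt hrt hrt', ?_⟩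
      have h0 := hr0.trans (le_max_left r r')
      have e1 := h.flow_eq_of_le hr0 (le_max_left r r') hr
      have e2 := h.flow_eq_of_le hr0' (le_max_right r r') hr'
      exact le_antisymm ((h.flow_monotone h0 hd.2).trans_eq e2)
        (e1.symm.trans_le (h.flow_monotone h0 hd.1))
    have hSsub : S ⊆ Icc (lo μ u t a) (hi μ u t a) := by
      rintro b ⟨r, hr0, hrt, hr⟩
      exact (h.flow_eq_iff ht.le).1 (h.flow_eq_of_le hr0 hrt.le hr)
    have hsub : ∀ᶠ s in 𝓝[<] t, Icc (lo μ u s a) (hi μ u s a) ⊆ Icc (lo μ u t a) (hi μ u t a) := by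
      filter_upwards [hlt, hpos] with s hs hs0
      exact Icc_subset_Icc (h.lo_anti hs0.le hs.le a) (h.hi_mono hs0.le hs.le a)
    have hlim : ∀ f : ℝ → ℝ, LocallyIntegrable f μ →
        Tendsto (fun s => ∫ η in Icc (lo μ u s a) (hi μ u s a), f η ∂μ) (𝓝[<] t)
          (𝓝 (∫ η in S, f η ∂μ)) := fun f hf =>
      tendsto_setIntegral_of_eventually_mem_iff measurableSet_Icc
        (integrableOn_of_bdd hf subset_rfl) (Eventually.of_forall fun _ => measurableSet_Icc)
        hsub hSord.measurableSet hmem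
    have h1 := hlim _ h.locallyIntegrable_id
    have h2 := hlim _ (continuous_const (y := (1 : ℝ))).locallyIntegrable
    simp only [setIntegral_const, smul_eq_mul, mul_one] at h2
    have hSpos : 0 < μ.real S := by
      refine h.measureReal_pos hs₀lt (fun b hb => ?_) hSsub
      exact ⟨s₀, hs₀, hs₀t, (h.flow_eq_iff hs₀).2 (Ioo_subset_Icc_self hb)⟩
    refine ⟨_, (h1.div h2 hSpos.ne').congr' ?_⟩
    filter_upwards [hgt] with s hs
    have hlt' := (h.lo_anti hs₀ hs a).trans_lt (hs₀lt.trans_le (h.hi_mono hs₀ hs a))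
    rw [Pi.div_apply, ← h.massCentre_mul hlt', mul_div_cancel_right₀ _ (h.measureReal_Icc_pos hlt').ne']
  · push Not at hcase
    refine ⟨a, tendsto_const_nhds.congr' ?_⟩
    filter_upwards [hlt, hpos] with s hs hs0
    have h1 := hcase s hs0.le hs
    have h2 : lo μ u s a = a := le_antisymm (h.lo_le hs0.le a) ((h.le_hi hs0.le a).trans h1)
    have h3 : hi μ u s a = a := le_antisymm (h1.trans (h.lo_le hs0.le a)) (h.le_hi hs0.le a)
    rw [h2, h3, massCentre_self]

theorem Admissible.velocity_tendsto_time_right (h : Admissible μ u) (ht : 0 < t) (a : ℝ) :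
    Tendsto (fun s => velocity μ u (flow μ u s a) s) (𝓝[>] t)
      (𝓝 (velocity μ u (flow μ u t a) t)) := by
  rw [h.velocity_flow ht]
  refine (((h.flow_tendsto_right ht.le a).sub (h.massCentre_tendsto_right ht.le a)).div
    (tendsto_id.mono_left nhdsWithin_le_nhds) ht.ne').congr' ?_
  filter_upwards [self_mem_nhdsWithin] with s hs
  rw [h.velocity_flow (ht.trans hs)]
  rfl

end Trajectories

/-! ### Shock times -/

section ShockTimes

variable {μ : Measure ℝ} {u : ℝ → ℝ}

theorem Admissible.lo_zero (h : Admissible μ u) (a : ℝ) : lo μ u 0 a = a := by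
  rw [lo, h.flow_zero, h.clusterLeft_zero]

theorem Admissible.hi_zero (h : Admissible μ u) (a : ℝ) : hi μ u 0 a = a := by
  rw [hi, h.flow_zero, h.clusterRight_zero]

theorem Admissible.lo_eq_of_eq (h : Admissible μ u) {t : ℝ} (ht : 0 ≤ t) {a : ℝ}
    (ha : lo μ u t a = hi μ u t a) : lo μ u t a = a :=
  le_antisymm (h.lo_le ht a) (ha ▸ h.le_hi ht a)

theorem Admissible.hi_eq_of_eq (h : Admissible μ u) {t : ℝ} (ht : 0 ≤ t) {a : ℝ}
    (ha : lo μ u t a = hi μ u t a) : hi μ u t a = a := ha ▸ h.lo_eq_of_eq ht ha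

theorem Admissible.eq_of_flow_eq (h : Admissible μ u) {t : ℝ} (ht : 0 ≤ t) {a b : ℝ}
    (ha : lo μ u t a = hi μ u t a) (hab : flow μ u t b = flow μ u t a) : b = a := by
  have := (h.flow_eq_iff ht).1 hab
  rw [h.lo_eq_of_eq ht ha, h.hi_eq_of_eq ht ha] at this
  exact le_antisymm this.2 this.1

theorem Admissible.shockTime_le (h : Admissible μ u) {a : ℝ} {t : ℝ≥0}
    (hlt : lo μ u t a < hi μ u t a) : shockTime μ u a ≤ t := by
  have ht : 0 < t := by
    rcases eq_zero_or_pos t with rfl | ht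
    · rw [NNReal.coe_zero, h.lo_zero, h.hi_zero] at hlt
      exact absurd hlt (lt_irrefl _)
    · exact ht
  exact iInf₂_le t ⟨ht, (h.inShock_iff (NNReal.coe_pos.2 ht) a).2 hlt⟩

theorem Admissible.lo_eq_hi_of_lt (h : Admissible μ u) {a : ℝ} {t : ℝ≥0}
    (ht : (t : ℝ≥0∞) < shockTime μ u a) : lo μ u t a = hi μ u t a := by
  by_contra hne
  exact absurd (h.shockTime_le (lt_of_le_of_ne (h.lo_le_hi t.coe_nonneg a) hne)) (not_le.2 ht)

theorem Admissible.lo_lt_hi_of_lt (h : Admissible μ u) {a : ℝ} {t : ℝ≥0}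
    (ht : shockTime μ u a < t) : lo μ u t a < hi μ u t a := by
  obtain ⟨r, ⟨hr0, hr⟩, hrt⟩ : ∃ r : ℝ≥0, (0 < r ∧ InShock μ u a r) ∧ (r : ℝ≥0∞) < t := by
    simpa [shockTime, iInf_lt_iff] using ht
  have hrt : r < t := by exact_mod_cast hrt
  rw [h.inShock_iff (NNReal.coe_pos.2 hr0)] at hr
  have hrt' : (r : ℝ) ≤ t := by exact_mod_cast hrt.le
  exact (h.lo_anti r.coe_nonneg hrt' a).trans_lt (hr.trans_le (h.hi_mono r.coe_nonneg hrt' a))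

theorem Admissible.le_shockTime (h : Admissible μ u) {a : ℝ} {T : ℝ≥0∞}
    (hT : ∀ t : ℝ≥0, (t : ℝ≥0∞) < T → lo μ u t a = hi μ u t a) : T ≤ shockTime μ u a := by
  by_contra! hcon
  obtain ⟨r, hr1, hr2⟩ := ENNReal.lt_iff_exists_nnreal_btwn.1 hcon
  exact (h.lo_lt_hi_of_lt hr1).ne (hT r hr2)

theorem Admissible.measurable_flow (h : Admissible μ u) {t : ℝ} (ht : 0 ≤ t) :
    Measurable (flow μ u t) := (h.flow_monotone ht).measurable

theorem Admissible.measurable_shockTime (h : Admissible μ u) : Measurable (shockTime μ u) := by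
  refine measurable_of_Iio fun c => ?_
  have : shockTime μ u ⁻¹' Iio c = ⋃ (q : ℚ) (_ : (Real.toNNReal q : ℝ≥0∞) < c),
      {a | lo μ u (Real.toNNReal q) a < hi μ u (Real.toNNReal q) a} := by
    ext a
    simp only [mem_preimage, mem_Iio, mem_iUnion, exists_prop]
    constructor
    · intro ha
      obtain ⟨q, -, hq1, hq2⟩ := ENNReal.lt_iff_exists_rat_btwn.1 ha
      exact ⟨q, hq2, h.lo_lt_hi_of_lt hq1⟩
    · rintro ⟨q, hq, ha⟩
      exact (h.shockTime_le ha).trans_lt hq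
  rw [this]
  refine MeasurableSet.iUnion fun q => MeasurableSet.iUnion fun _ => ?_
  exact measurableSet_lt (h.lo_monotone (NNReal.coe_nonneg _)).measurable
    (h.hi_monotone (NNReal.coe_nonneg _)).measurable

/-- Before its first shock a particle moves with its initial velocity. -/
theorem Admissible.flow_eq_of_lt_shockTime (h : Admissible μ u) {a : ℝ} {t : ℝ≥0}
    (ht : (t : ℝ≥0∞) < shockTime μ u a) : flow μ u t a = a + t * u a := by
  have h1 := h.flow_eq_lo t.coe_nonneg a
  rwa [show lo μ u (t : ℝ) a = a from h.lo_eq_of_eq t.coe_nonneg (h.lo_eq_hi_of_lt ht)] at h1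

theorem Admissible.velocity_eq_of_lt_shockTime (h : Admissible μ u) {a : ℝ} {t : ℝ≥0}
    (ht : (t : ℝ≥0∞) < shockTime μ u a) : velocity μ u (flow μ u t a) t = u a := by
  have hsolo := h.lo_eq_hi_of_lt ht
  rcases eq_zero_or_pos t with rfl | ht0
  · rw [velocity, NNReal.coe_zero, h.flow_zero, h.clusterLeft_zero]
    obtain ⟨r, hr0, hr⟩ := ENNReal.lt_iff_exists_nnreal_btwn.1 ht
    have hr0 : 0 < (r : ℝ) := by exact_mod_cast hr0
    have h1 : HasDerivWithinAt (fun s : ℝ => a + s * u a) (u a) (Ici 0) 0 := by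
      have := (((hasDerivAt_id (0 : ℝ)).mul_const (u a)).const_add a).hasDerivWithinAt
        (s := Ici (0 : ℝ))
      simpa using this
    refine (h1.congr_of_eventuallyEq ?_ ?_).derivWithin (uniqueDiffOn_Ici 0 0 self_mem_Ici)
    · filter_upwards [self_mem_nhdsWithin, mem_nhdsWithin_of_mem_nhds (gt_mem_nhds hr0)]
        with s hs0 hsr
      have hs : (s.toNNReal : ℝ≥0∞) < shockTime μ u a :=
        lt_trans (by exact_mod_cast (Real.toNNReal_lt_iff_lt_coe hs0).2 hsr) hr
      have := h.flow_eq_of_lt_shockTime hs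
      rwa [Real.coe_toNNReal s hs0] at this
    · rw [h.flow_zero]; simp
  · exact h.velocity_of_eq (NNReal.coe_pos.2 ht0) (h.lo_eq_of_eq t.coe_nonneg hsolo)
      (h.hi_eq_of_eq t.coe_nonneg hsolo)

end ShockTimes

/-! ### Representatives of the clusters at the first shock time -/

/-- `p` selects, for each particle `a`, a particle `p a` which is met by `a` at its first shock time
`τ(a)` at the latest, and which has met no other particle before `τ(a)`. The four processes are the
paths of such particles. -/
structure IsRepresentative (μ : Measure ℝ) (u : ℝ → ℝ) (p : ℝ → ℝ) : Prop where
  measurable : Measurable p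
  of_top : ∀ a, shockTime μ u a = ∞ → p a = a
  flow_eq : ∀ a, shockTime μ u a ≠ ∞ →
    flow μ u (shockTime μ u a).toReal (p a) = flow μ u (shockTime μ u a).toReal a
  solo : ∀ (a : ℝ) (s : ℝ≥0), (s : ℝ≥0∞) < shockTime μ u a → lo μ u s (p a) = hi μ u s (p a)

section Representatives

variable {μ : Measure ℝ} {u : ℝ → ℝ} {p : ℝ → ℝ}

theorem IsRepresentative.flow_eq_of_le (hp : IsRepresentative μ u p) (h : Admissible μ u) {a : ℝ}
    {t : ℝ≥0} (ht : shockTime μ u a ≤ t) : flow μ u t (p a) = flow μ u t a := by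
  have hne : shockTime μ u a ≠ ∞ := ne_top_of_le_ne_top ENNReal.coe_ne_top ht
  exact h.flow_eq_of_le ENNReal.toReal_nonneg (ENNReal.toReal_le_coe_of_le_coe ht)
    (hp.flow_eq a hne)

theorem IsRepresentative.shockTime_eq (hp : IsRepresentative μ u p) (h : Admissible μ u) (a : ℝ) :
    shockTime μ u (p a) = shockTime μ u a := by
  refine le_antisymm ?_ (h.le_shockTime (hp.solo a))
  by_cases htop : shockTime μ u a = ∞
  · rw [htop]; exact le_top
  by_contra! hcon
  obtain ⟨r, hr1, hr2⟩ := ENNReal.lt_iff_exists_nnreal_btwn.1 hcon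
  have h1 := h.lo_lt_hi_of_lt hr1
  have h2 := h.lo_eq_hi_of_lt hr2
  have h3 := hp.flow_eq_of_le h hr1.le
  rw [lo_congr h3, hi_congr h3] at h2
  exact h1.ne h2

theorem shockPos_eq {a b : ℝ} (h1 : shockTime μ u b = shockTime μ u a)
    (h2 : shockPos μ u b = shockPos μ u a) :
    flow μ u (shockTime μ u a).toReal b = flow μ u (shockTime μ u a).toReal a := by
  rwa [shockPos, shockPos, h1] at h2

theorem mem_turbInterval {a b : ℝ} (htop : shockTime μ u a ≠ ∞) :
    b ∈ turbInterval μ u a ↔ ∀ c ∈ uIcc a b,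
      shockTime μ u c = shockTime μ u a ∧ shockPos μ u c = shockPos μ u a := by
  rw [turbInterval, if_neg htop]
  exact Iff.rfl

theorem turbInterval_of_top {a : ℝ} (htop : shockTime μ u a = ∞) : turbInterval μ u a = {a} := by
  rw [turbInterval, if_pos htop]

theorem self_mem_turbInterval (a : ℝ) : a ∈ turbInterval μ u a := by
  by_cases htop : shockTime μ u a = ∞
  · rw [turbInterval_of_top htop]; exact mem_singleton a
  · rw [mem_turbInterval htop, uIcc_self]
    rintro c rfl
    exact ⟨rfl, rfl⟩

theorem shockTime_of_mem_turbInterval {a b : ℝ} (hb : b ∈ turbInterval μ u a) :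
    shockTime μ u b = shockTime μ u a := by
  by_cases htop : shockTime μ u a = ∞
  · rw [turbInterval_of_top htop] at hb; rw [hb]
  · exact (((mem_turbInterval htop).1 hb) b right_mem_uIcc).1

theorem mem_turbInterval_of_mem_uIcc {a b c : ℝ} (hb : b ∈ turbInterval μ u a)
    (hc : c ∈ uIcc a b) : c ∈ turbInterval μ u a := by
  by_cases htop : shockTime μ u a = ∞
  · rw [turbInterval_of_top htop] at hb ⊢
    rw [hb, uIcc_self] at hc
    exact hc
  · rw [mem_turbInterval htop] at hb ⊢
    exact fun d hd => hb d (uIcc_subset_uIcc_left hc hd)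

theorem turbInterval_eq_of_mem {a b : ℝ} (hb : b ∈ turbInterval μ u a) :
    turbInterval μ u b = turbInterval μ u a := by
  by_cases htop : shockTime μ u a = ∞
  · rw [turbInterval_of_top htop] at hb; rw [hb]
  have htb := shockTime_of_mem_turbInterval hb
  have htop' : shockTime μ u b ≠ ∞ := htb ▸ htop
  have hb' := (mem_turbInterval htop).1 hb
  have hpb := (hb' b right_mem_uIcc).2
  ext c
  rw [mem_turbInterval htop, mem_turbInterval htop', htb, hpb]
  refine ⟨fun hc d hd => ?_, fun hc d hd => ?_⟩
  · rcases uIcc_subset_uIcc_union_uIcc (b := b) hd with hd | hd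
    · exact hb' d hd
    · exact hc d hd
  · rcases uIcc_subset_uIcc_union_uIcc (b := a) hd with hd | hd
    · exact hb' d (by rwa [uIcc_comm])
    · exact hc d hd

theorem Admissible.turbInterval_subset (h : Admissible μ u) {a : ℝ} (htop : shockTime μ u a ≠ ∞) :
    turbInterval μ u a ⊆
      Icc (lo μ u (shockTime μ u a).toReal a) (hi μ u (shockTime μ u a).toReal a) := by
  intro b hb
  have hb' := (mem_turbInterval htop).1 hb b right_mem_uIcc
  exact (h.flow_eq_iff ENNReal.toReal_nonneg).1 (shockPos_eq hb'.1 hb'.2)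

theorem Admissible.bddBelow_turbInterval (h : Admissible μ u) (a : ℝ) :
    BddBelow (turbInterval μ u a) := by
  by_cases htop : shockTime μ u a = ∞
  · rw [turbInterval_of_top htop]; exact bddBelow_singleton
  · exact bddBelow_Icc.mono (h.turbInterval_subset htop)

theorem Admissible.bddAbove_turbInterval (h : Admissible μ u) (a : ℝ) :
    BddAbove (turbInterval μ u a) := by
  by_cases htop : shockTime μ u a = ∞
  · rw [turbInterval_of_top htop]; exact bddAbove_singleton
  · exact bddAbove_Icc.mono (h.turbInterval_subset htop)

theorem Admissible.monotone_sInf_turbInterval (h : Admissible μ u) :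
    Monotone fun a => sInf (turbInterval μ u a) := by
  intro a b hab
  by_cases hb : b ∈ turbInterval μ u a
  · exact (congrArg sInf (turbInterval_eq_of_mem hb)).symm.le
  · refine le_csInf ⟨b, self_mem_turbInterval b⟩ fun c hc => ?_
    refine (csInf_le (h.bddBelow_turbInterval a) (self_mem_turbInterval a)).trans ?_
    by_contra! hcon
    have h1 : a ∈ turbInterval μ u b :=
      mem_turbInterval_of_mem_uIcc hc (by rw [uIcc_comm, uIcc_of_le (hcon.le.trans hab)]
                                          exact ⟨hcon.le, hab⟩)
    exact hb (turbInterval_eq_of_mem h1 ▸ self_mem_turbInterval b)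

theorem Admissible.monotone_sSup_turbInterval (h : Admissible μ u) :
    Monotone fun a => sSup (turbInterval μ u a) := by
  intro a b hab
  by_cases hb : b ∈ turbInterval μ u a
  · exact (congrArg sSup (turbInterval_eq_of_mem hb)).symm.le
  · refine csSup_le ⟨a, self_mem_turbInterval a⟩ fun c hc => ?_
    refine le_trans ?_ (le_csSup (h.bddAbove_turbInterval b) (self_mem_turbInterval b))
    by_contra! hcon
    exact hb (mem_turbInterval_of_mem_uIcc hc (by rw [uIcc_of_le (hab.trans hcon.le)]
                                                  exact ⟨hab, hcon.le⟩))

/-- If the left end `A` of the turbulent interval of `a` met other particles at a time `s < τ(a)`, it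
could only meet particles on its left, so that it would be the right end of its cluster during
`[s, τ(a))`; but the right end of a cluster has met no particle before. -/
theorem Admissible.isRepresentative_sInf_turbInterval (h : Admissible μ u) :
    IsRepresentative μ u fun a => sInf (turbInterval μ u a) where
  measurable := h.monotone_sInf_turbInterval.measurable
  of_top a htop := by simp [turbInterval_of_top htop]
  flow_eq a htop := by
    refine (h.flow_eq_iff ENNReal.toReal_nonneg).2 ⟨?_, ?_⟩
    · exact le_csInf ⟨a, self_mem_turbInterval a⟩ fun b hb => (h.turbInterval_subset htop hb).1
    · exact (csInf_le (h.bddBelow_turbInterval a) (self_mem_turbInterval a)).trans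
        (h.le_hi ENNReal.toReal_nonneg a)
  solo a s hs := by
    set A := sInf (turbInterval μ u a) with hA
    rcases (csInf_le (h.bddBelow_turbInterval a) (self_mem_turbInterval a)).eq_or_lt with heq | hlt
    · rw [hA, heq]; exact h.lo_eq_hi_of_lt hs
    have hright : ∀ r : ℝ≥0, (r : ℝ≥0∞) < shockTime μ u a → hi μ u r A = A := by
      intro r hr
      by_contra hne
      have hAhi : A < hi μ u r A := lt_of_le_of_ne (h.le_hi r.coe_nonneg A) (Ne.symm hne)
      obtain ⟨b, hb, hbA⟩ := exists_lt_of_csInf_lt ⟨a, self_mem_turbInterval a⟩ hAhi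
      have hAb : A ≤ b := csInf_le (h.bddBelow_turbInterval a) hb
      have e := (h.flow_eq_iff r.coe_nonneg).2 ⟨(h.lo_le r.coe_nonneg A).trans hAb, hbA.le⟩
      rw [← shockTime_of_mem_turbInterval hb] at hr
      have h1 := h.lo_eq_hi_of_lt hr
      rw [lo_congr e, hi_congr e] at h1
      exact ((h.lo_le r.coe_nonneg A).trans_lt hAhi).ne h1
    obtain ⟨r, hr1, hr2⟩ := ENNReal.lt_iff_exists_nnreal_btwn.1 hs
    have hsr : (s : ℝ) < r := by exact_mod_cast hr1
    rw [hright s hs]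
    exact h.eq_of_flow_eq_clusterRight s.coe_nonneg hsr (hright r hr2) (h.flow_lo s.coe_nonneg A)

/-- The counterpart of `Admissible.isRepresentative_sInf_turbInterval` for the right end. -/
theorem Admissible.isRepresentative_sSup_turbInterval (h : Admissible μ u) :
    IsRepresentative μ u fun a => sSup (turbInterval μ u a) where
  measurable := h.monotone_sSup_turbInterval.measurable
  of_top a htop := by simp [turbInterval_of_top htop]
  flow_eq a htop := by
    refine (h.flow_eq_iff ENNReal.toReal_nonneg).2 ⟨?_, ?_⟩
    · exact (h.lo_le ENNReal.toReal_nonneg a).trans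
        (le_csSup (h.bddAbove_turbInterval a) (self_mem_turbInterval a))
    · exact csSup_le ⟨a, self_mem_turbInterval a⟩ fun b hb => (h.turbInterval_subset htop hb).2
  solo a s hs := by
    set B := sSup (turbInterval μ u a) with hB
    rcases (le_csSup (h.bddAbove_turbInterval a) (self_mem_turbInterval a)).eq_or_lt with heq | hlt
    · rw [hB, ← heq]; exact h.lo_eq_hi_of_lt hs
    have hleft : ∀ r : ℝ≥0, (r : ℝ≥0∞) < shockTime μ u a → lo μ u r B = B := by
      intro r hr
      by_contra hne
      have hloB : lo μ u r B < B := lt_of_le_of_ne (h.lo_le r.coe_nonneg B) hne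
      obtain ⟨b, hb, hBb⟩ := exists_lt_of_lt_csSup ⟨a, self_mem_turbInterval a⟩ hloB
      have hbB : b ≤ B := le_csSup (h.bddAbove_turbInterval a) hb
      have e := (h.flow_eq_iff r.coe_nonneg).2 ⟨hBb.le, hbB.trans (h.le_hi r.coe_nonneg B)⟩
      rw [← shockTime_of_mem_turbInterval hb] at hr
      have h1 := h.lo_eq_hi_of_lt hr
      rw [lo_congr e, hi_congr e] at h1
      exact (hloB.trans_le (h.le_hi r.coe_nonneg B)).ne h1
    obtain ⟨r, hr1, hr2⟩ := ENNReal.lt_iff_exists_nnreal_btwn.1 hs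
    have hsr : (s : ℝ) < r := by exact_mod_cast hr1
    rw [hleft s hs]
    exact (h.eq_of_flow_eq_clusterLeft s.coe_nonneg hsr (hleft r hr2) (h.flow_hi s.coe_nonneg B)).symm

/-- The ends of the clusters at time `τ(a)` are approximated by those at rational times. -/
theorem Admissible.lt_lo_shockTime_iff (h : Admissible μ u) {a c : ℝ}
    (htop : shockTime μ u a ≠ ∞) :
    c < lo μ u (shockTime μ u a).toReal a ↔
      ∃ q : ℚ, shockTime μ u a < Real.toNNReal q ∧ c < lo μ u (Real.toNNReal q) a := by
  constructor
  · intro hc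
    obtain ⟨s, hs1, hs2⟩ := (((h.lo_tendsto_right ENNReal.toReal_nonneg a).eventually
      (lt_mem_nhds hc)).and self_mem_nhdsWithin).exists
    have hs0 : 0 ≤ s := ENNReal.toReal_nonneg.trans (le_of_lt hs2)
    have hlt : shockTime μ u a < ENNReal.ofReal s :=
      (ENNReal.lt_ofReal_iff_toReal_lt htop).2 hs2
    obtain ⟨q, hq0, hq1, hq2⟩ := ENNReal.lt_iff_exists_rat_btwn.1 hlt
    refine ⟨q, hq1, hs1.trans_le (h.lo_anti (NNReal.coe_nonneg _) ?_ a)⟩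
    have h3 : Real.toNNReal q < Real.toNNReal s := ENNReal.coe_lt_coe.1 hq2
    calc (Real.toNNReal q : ℝ) ≤ Real.toNNReal s := by exact_mod_cast h3.le
      _ = s := Real.coe_toNNReal s hs0
  · rintro ⟨q, hq1, hq2⟩
    exact hq2.trans_le (h.lo_anti ENNReal.toReal_nonneg
      (ENNReal.toReal_le_coe_of_le_coe hq1.le) a)

theorem Admissible.hi_shockTime_lt_iff (h : Admissible μ u) {a c : ℝ}
    (htop : shockTime μ u a ≠ ∞) :
    hi μ u (shockTime μ u a).toReal a < c ↔
      ∃ q : ℚ, shockTime μ u a < Real.toNNReal q ∧ hi μ u (Real.toNNReal q) a < c := by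
  constructor
  · intro hc
    obtain ⟨s, hs1, hs2⟩ := (((h.hi_tendsto_right ENNReal.toReal_nonneg a).eventually
      (gt_mem_nhds hc)).and self_mem_nhdsWithin).exists
    have hs0 : 0 ≤ s := ENNReal.toReal_nonneg.trans (le_of_lt hs2)
    have hlt : shockTime μ u a < ENNReal.ofReal s :=
      (ENNReal.lt_ofReal_iff_toReal_lt htop).2 hs2
    obtain ⟨q, hq0, hq1, hq2⟩ := ENNReal.lt_iff_exists_rat_btwn.1 hlt
    refine ⟨q, hq1, (h.hi_mono (NNReal.coe_nonneg _) ?_ a).trans_lt hs1⟩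
    have h3 : Real.toNNReal q < Real.toNNReal s := ENNReal.coe_lt_coe.1 hq2
    calc (Real.toNNReal q : ℝ) ≤ Real.toNNReal s := by exact_mod_cast h3.le
      _ = s := Real.coe_toNNReal s hs0
  · rintro ⟨q, hq1, hq2⟩
    exact (h.hi_mono ENNReal.toReal_nonneg
      (ENNReal.toReal_le_coe_of_le_coe hq1.le) a).trans_lt hq2

open Classical in
/-- The left end of a cluster has met no other particle before; in particular it has not done so before
the first shock time of any particle of the cluster. -/
theorem Admissible.isRepresentative_clusterLeft (h : Admissible μ u) :
    IsRepresentative μ u fun a => if shockTime μ u a = ∞ then a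
      else clusterLeft μ u (shockPos μ u a) (shockTime μ u a).toReal where
  measurable := by
    refine measurable_of_Ioi fun c => ?_
    have hset : (fun a => if shockTime μ u a = ∞ then a
        else clusterLeft μ u (shockPos μ u a) (shockTime μ u a).toReal) ⁻¹' Ioi c =
        (shockTime μ u ⁻¹' {∞} ∩ Ioi c) ∪ ⋃ q : ℚ,
          (shockTime μ u ⁻¹' Iio (Real.toNNReal q : ℝ≥0∞) ∩
            lo μ u (Real.toNNReal q) ⁻¹' Ioi c) := by
      ext a
      by_cases htop : shockTime μ u a = ∞
      · simp [htop]
      · have := h.lt_lo_shockTime_iff (c := c) htop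
        simpa [htop, lo, shockPos] using this
    rw [hset]
    refine ((h.measurable_shockTime (measurableSet_singleton _)).inter measurableSet_Ioi).union
      (MeasurableSet.iUnion fun q => ?_)
    exact (h.measurable_shockTime measurableSet_Iio).inter
      ((h.lo_monotone (NNReal.coe_nonneg _)).measurable measurableSet_Ioi)
  of_top a htop := by simp [htop]
  flow_eq a htop := by
    simp only [htop, if_false]
    exact h.flow_clusterLeft ENNReal.toReal_nonneg _
  solo a s hs := by
    by_cases htop : shockTime μ u a = ∞
    · simp only [htop, if_true]
      exact h.lo_eq_hi_of_lt hs
    simp only [htop, if_false]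
    have hst : (s : ℝ) < (shockTime μ u a).toReal := by
      simpa using (ENNReal.toReal_lt_toReal ENNReal.coe_ne_top htop).2 hs
    set α := clusterLeft μ u (shockPos μ u a) (shockTime μ u a).toReal
    have hα : clusterLeft μ u (flow μ u (shockTime μ u a).toReal α) (shockTime μ u a).toReal = α := by
      rw [h.flow_clusterLeft ENNReal.toReal_nonneg]
    rw [h.eq_of_flow_eq_clusterLeft s.coe_nonneg hst hα (h.flow_lo s.coe_nonneg α),
      h.eq_of_flow_eq_clusterLeft s.coe_nonneg hst hα (h.flow_hi s.coe_nonneg α)]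

open Classical in
/-- The counterpart of `Admissible.isRepresentative_clusterLeft` for the right end. -/
theorem Admissible.isRepresentative_clusterRight (h : Admissible μ u) :
    IsRepresentative μ u fun a => if shockTime μ u a = ∞ then a
      else clusterRight μ u (shockPos μ u a) (shockTime μ u a).toReal where
  measurable := by
    refine measurable_of_Iio fun c => ?_
    have hset : (fun a => if shockTime μ u a = ∞ then a
        else clusterRight μ u (shockPos μ u a) (shockTime μ u a).toReal) ⁻¹' Iio c =
        (shockTime μ u ⁻¹' {∞} ∩ Iio c) ∪ ⋃ q : ℚ,
          (shockTime μ u ⁻¹' Iio (Real.toNNReal q : ℝ≥0∞) ∩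
            hi μ u (Real.toNNReal q) ⁻¹' Iio c) := by
      ext a
      by_cases htop : shockTime μ u a = ∞
      · simp [htop]
      · have := h.hi_shockTime_lt_iff (c := c) htop
        simpa [htop, hi, shockPos] using this
    rw [hset]
    refine ((h.measurable_shockTime (measurableSet_singleton _)).inter measurableSet_Iio).union
      (MeasurableSet.iUnion fun q => ?_)
    exact (h.measurable_shockTime measurableSet_Iio).inter
      ((h.hi_monotone (NNReal.coe_nonneg _)).measurable measurableSet_Iio)
  of_top a htop := by simp [htop]
  flow_eq a htop := by
    simp only [htop, if_false]
    exact h.flow_clusterRight ENNReal.toReal_nonneg _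
  solo a s hs := by
    by_cases htop : shockTime μ u a = ∞
    · simp only [htop, if_true]
      exact h.lo_eq_hi_of_lt hs
    simp only [htop, if_false]
    have hst : (s : ℝ) < (shockTime μ u a).toReal := by
      simpa using (ENNReal.toReal_lt_toReal ENNReal.coe_ne_top htop).2 hs
    set β := clusterRight μ u (shockPos μ u a) (shockTime μ u a).toReal
    have hβ : clusterRight μ u (flow μ u (shockTime μ u a).toReal β) (shockTime μ u a).toReal =
        β := by
      rw [h.flow_clusterRight ENNReal.toReal_nonneg]
    rw [h.eq_of_flow_eq_clusterRight s.coe_nonneg hst hβ (h.flow_lo s.coe_nonneg β),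
      h.eq_of_flow_eq_clusterRight s.coe_nonneg hst hβ (h.flow_hi s.coe_nonneg β)]

theorem Admissible.exists_isRepresentative (h : Admissible μ u) {Ω : Type*} (X₀ : Ω → ℝ)
    (Z : ℝ≥0 → Ω → ℝ) (hZ : Z = Z1 μ u X₀ ∨ Z = Z2 μ u X₀ ∨ Z = Z3 μ u X₀ ∨ Z = Z4 μ u X₀) :
    ∃ p, IsRepresentative μ u p ∧ ∀ t ω, Z t ω = flow μ u t (p (X₀ ω)) := by
  rcases hZ with rfl | rfl | rfl | rfl
  · exact ⟨_, h.isRepresentative_sInf_turbInterval, fun _ _ => rfl⟩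
  · exact ⟨_, h.isRepresentative_sSup_turbInterval, fun _ _ => rfl⟩
  · exact ⟨_, h.isRepresentative_clusterLeft, fun _ _ => rfl⟩
  · exact ⟨_, h.isRepresentative_clusterRight, fun _ _ => rfl⟩

end Representatives

/-! ### Lebesgue differentiation along non-centred intervals -/

section Differentiation

variable {μ : Measure ℝ} {u : ℝ → ℝ}

theorem tendsto_measureReal_Iic_right (ν : Measure ℝ) [IsFiniteMeasure ν] (x : ℝ) :
    Tendsto (fun y => ν.real (Iic y)) (𝓝[>] x) (𝓝 (ν.real (Iic x))) := by
  have := tendsto_setIntegral_of_eventually_mem_iff (l := 𝓝[>] x) (μ := ν) (f := fun _ => (1 : ℝ))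
    (S := Iic) (S₀ := Iic x) MeasurableSet.univ (integrable_const _).integrableOn
    (Eventually.of_forall fun _ => measurableSet_Iic) (Eventually.of_forall fun _ => subset_univ _)
    measurableSet_Iic fun y => ?_
  · simpa using this
  · by_cases hy : y ≤ x
    · filter_upwards [self_mem_nhdsWithin] with z hz
      exact iff_of_true (hy.trans (le_of_lt hz)) hy
    · filter_upwards [mem_nhdsWithin_of_mem_nhds (gt_mem_nhds (not_le.1 hy))] with z hz
      exact iff_of_false (fun hh => absurd hz (not_lt.2 hh)) hy

theorem tendsto_measureReal_Iic_left (ν : Measure ℝ) [IsFiniteMeasure ν] (x : ℝ) :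
    Tendsto (fun y => ν.real (Iic y)) (𝓝[<] x) (𝓝 (ν.real (Iio x))) := by
  have := tendsto_setIntegral_of_eventually_mem_iff (l := 𝓝[<] x) (μ := ν) (f := fun _ => (1 : ℝ))
    (S := Iic) (S₀ := Iio x) MeasurableSet.univ (integrable_const _).integrableOn
    (Eventually.of_forall fun _ => measurableSet_Iic) (Eventually.of_forall fun _ => subset_univ _)
    measurableSet_Iio fun y => ?_
  · simpa using this
  · by_cases hy : y < x
    · filter_upwards [mem_nhdsWithin_of_mem_nhds (lt_mem_nhds hy)] with z hz
      exact iff_of_true hz.le hy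
    · filter_upwards [self_mem_nhdsWithin] with z hz
      exact iff_of_false (fun hh => hy (lt_of_le_of_lt hh hz)) hy

/-- The quantile function of a finite measure on the line. -/
def quantile (ν : Measure ℝ) (m : ℝ) : ℝ := sInf {x | m ≤ ν.real (Iic x)}

section Quantile

variable {ν : Measure ℝ} [IsFiniteMeasure ν] {a b : ℝ}

theorem quantile_le_iff (hab : ν (Ioc a b)ᶜ = 0) {m x : ℝ}
    (hm : m ∈ Ioc 0 (ν.real univ)) : quantile ν m ≤ x ↔ m ≤ ν.real (Iic x) := by
  have hbdd : BddBelow {x | m ≤ ν.real (Iic x)} := by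
    refine ⟨a, fun y hy => ?_⟩
    by_contra! hcon
    have : ν.real (Iic y) = 0 := by
      refine (measureReal_eq_zero_iff).2 (measure_mono_null (fun z hz => ?_) hab)
      exact fun hh => absurd (hh.1.trans_le hz) (not_lt.2 hcon.le)
    have hy : m ≤ ν.real (Iic y) := hy
    linarith [hm.1]
  have hne : {x | m ≤ ν.real (Iic x)}.Nonempty := by
    refine ⟨b, show m ≤ ν.real (Iic b) from hm.2.trans (le_of_eq ?_)⟩
    refine measureReal_congr (ae_eq_univ.2 (measure_mono_null (fun z hz => ?_) hab)).symm
    exact fun hh => hz hh.2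
  have hmono : Monotone fun x => ν.real (Iic x) := fun _ _ hxy =>
    measureReal_mono (Iic_subset_Iic.2 hxy)
  refine ⟨fun hx => ?_, fun hx => csInf_le hbdd hx⟩
  refine le_trans ?_ (hmono hx)
  refine ge_of_tendsto (tendsto_measureReal_Iic_right ν _) ?_
  filter_upwards [self_mem_nhdsWithin] with y hy
  obtain ⟨z, hz, hzy⟩ := exists_lt_of_csInf_lt hne hy
  exact le_trans hz (hmono hzy.le)

theorem aemeasurable_quantile (hab : ν (Ioc a b)ᶜ = 0) :
    AEMeasurable (quantile ν) (volume.restrict (Ioc 0 (ν.real univ))) := by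
  refine aemeasurable_restrict_of_monotoneOn measurableSet_Ioc fun m hm m' hm' hmm => ?_
  exact (quantile_le_iff hab hm).2 (hmm.trans ((quantile_le_iff hab hm').1 le_rfl))

/-- The quantile function pushes the Lebesgue measure forward to the given measure. -/
theorem map_quantile (hab : ν (Ioc a b)ᶜ = 0) :
    (volume.restrict (Ioc 0 (ν.real univ))).map (quantile ν) = ν := by
  have hQ := aemeasurable_quantile hab
  refine Measure.ext_of_Iic _ _ fun x => ?_
  rw [Measure.map_apply_of_aemeasurable hQ measurableSet_Iic]
  have h1 : (quantile ν ⁻¹' Iic x) ∩ Ioc 0 (ν.real univ) = Ioc 0 (ν.real (Iic x)) := by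
    ext m
    constructor
    · rintro ⟨h1, h2⟩
      exact ⟨h2.1, (quantile_le_iff hab h2).1 h1⟩
    · intro h1
      have h2 : m ∈ Ioc 0 (ν.real univ) := ⟨h1.1, h1.2.trans (measureReal_mono (subset_univ _))⟩
      exact ⟨(quantile_le_iff hab h2).2 h1.2, h2⟩
  rw [Measure.restrict_apply' measurableSet_Ioc, h1, Real.volume_Ioc, sub_zero,
    ofReal_measureReal]

end Quantile

/-- Lebesgue's differentiation theorem for the means over intervals which contain the point, but
need not be centred there. At an atom it is trivial; the other points correspond, through the
distribution function, to almost all points of an interval with the Lebesgue measure, for which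
the theorem is known. -/
theorem Admissible.ae_tendsto_average (h : Admissible μ u) :
    ∀ᵐ a ∂μ, Tendsto (fun x : ℝ × ℝ => ⨍ η in Icc x.1 x.2, u η ∂μ)
      ((𝓝[≤] a ×ˢ 𝓝[≥] a) ⊓ 𝓟 {x | x.1 < x.2}) (𝓝 (u a)) := by
  have hfin := h.locallyFinite
  suffices hN : ∀ n : ℕ, ∀ᵐ a ∂μ, a ∈ Ioo (-(n : ℝ)) n →
      Tendsto (fun x : ℝ × ℝ => ⨍ η in Icc x.1 x.2, u η ∂μ)
        ((𝓝[≤] a ×ˢ 𝓝[≥] a) ⊓ 𝓟 {x | x.1 < x.2}) (𝓝 (u a)) by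
    filter_upwards [ae_all_iff.2 hN] with a ha
    obtain ⟨n, hn⟩ := exists_nat_gt |a|
    exact ha n ⟨(abs_lt.1 hn).1, (abs_lt.1 hn).2⟩
  intro n
  set ν := μ.restrict (Ioc (-(n : ℝ)) n) with hν
  have hνfin : IsFiniteMeasure ν := ⟨by
    rw [hν, Measure.restrict_apply_univ]; exact h.measure_lt_top Ioc_subset_Icc_self⟩
  have hab : ν (Ioc (-(n : ℝ)) n)ᶜ = 0 := by
    rw [hν, Measure.restrict_apply' measurableSet_Ioc]; simp
  -- `u` is transported to `[0, M]` by the quantile function `Q`, and `F` is the way back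
  set M := ν.real univ with hM
  set Q := quantile ν with hQ
  set F : ℝ → ℝ := fun x => ν.real (Iic x) with hF
  have hQm := aemeasurable_quantile hab
  have hmap := map_quantile hab
  have hFmono : Monotone F := fun _ _ hxy => measureReal_mono (Iic_subset_Iic.2 hxy)
  have huν : Integrable u ν := integrableOn_of_bdd h.locallyIntegrable Ioc_subset_Icc_self
  have huQ : IntegrableOn (fun m => u (Q m)) (Ioc 0 M) volume := by
    have : Integrable u ((volume.restrict (Ioc 0 M)).map Q) := hmap.symm ▸ huν
    exact (integrable_map_measure this.aestronglyMeasurable hQm).1 this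
  set g : ℝ → ℝ := (Ioc 0 M).indicator fun m => u (Q m) with hg
  have hgint : Integrable g volume := (integrable_indicator_iff measurableSet_Ioc).2 huQ
  have hleb := IsUnifLocDoublingMeasure.ae_tendsto_average (μ := (volume : Measure ℝ))
    hgint.locallyIntegrable 1
  rw [ae_iff] at hleb
  set B := toMeasurable volume {m : ℝ | ¬ ∀ {ι : Type} {l : Filter ι} (w : ι → ℝ) (δ : ι → ℝ),
    Tendsto δ l (𝓝[>] 0) → (∀ᶠ j in l, m ∈ Metric.closedBall (w j) (1 * δ j)) →
      Tendsto (fun j => ⨍ y in Metric.closedBall (w j) (δ j), g y) l (𝓝 (g m))} with hB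
  have hB0 : volume B = 0 := by rw [hB, measure_toMeasurable]; exact hleb
  have hBm : MeasurableSet B := measurableSet_toMeasurable _ _
  set A : Set ℝ := {a | 0 < ν {a}} with hA
  have hAc : A.Countable := Measure.countable_meas_pos_of_disjoint_iUnion
    (fun a => measurableSet_singleton a) fun _ _ hab => by simpa using hab
  -- the exceptional points that are not atoms are negligible
  have hE : ν (F ⁻¹' B \ A) = 0 := by
    have hEm : MeasurableSet (F ⁻¹' B \ A) := (hFmono.measurable hBm).diff hAc.measurableSet
    rw [← hmap, Measure.map_apply_of_aemeasurable hQm hEm, Measure.restrict_apply' measurableSet_Ioc]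
    refine measure_mono_null ?_ hB0
    rintro m ⟨⟨hm1, hm2⟩, hm3⟩
    have hle : m ≤ F (Q m) := (quantile_le_iff hab hm3).1 le_rfl
    have hge : F (Q m) ≤ m := by
      have h0 : ν {Q m} = 0 := by simpa [hA, pos_iff_ne_zero] using hm2
      have h1 : F (Q m) = ν.real (Iio (Q m)) := by
        refine measureReal_congr ?_
        exact (Iio_ae_eq_Iic' h0).symm
      rw [h1]
      refine le_of_tendsto (tendsto_measureReal_Iic_left ν _) ?_
      filter_upwards [self_mem_nhdsWithin] with y hy
      by_contra! hcon
      exact absurd ((quantile_le_iff hab hm3).2 hcon.le) (not_le.2 hy)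
    have hB' : F (Q m) ∈ B := hm1
    rwa [le_antisymm hge hle] at hB'
  have hE' : ∀ᵐ a ∂μ, a ∈ Ioo (-(n : ℝ)) n → a ∉ F ⁻¹' B \ A := by
    have : ∀ᵐ a ∂ν, a ∉ F ⁻¹' B \ A := measure_eq_zero_iff_ae_notMem.1 hE
    filter_upwards [(ae_restrict_iff' measurableSet_Ioc).1 this] with a ha ha'
    exact ha (Ioo_subset_Ioc_self ha')
  filter_upwards [hE'] with a ha haN
  have ha := ha haN
  set L := (𝓝[≤] a ×ˢ 𝓝[≥] a) ⊓ 𝓟 {x : ℝ × ℝ | x.1 < x.2} with hL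
  have hfst : Tendsto Prod.fst L (𝓝[≤] a) := tendsto_fst.mono_left inf_le_left
  have hsnd : Tendsto Prod.snd L (𝓝[≥] a) := tendsto_snd.mono_left inf_le_left
  have hlt : ∀ᶠ x in L, x.1 < x.2 := mem_inf_of_right (mem_principal_self _)
  have hle1 : ∀ᶠ x in L, x.1 ≤ a := hfst.eventually self_mem_nhdsWithin
  have hle2 : ∀ᶠ x in L, a ≤ x.2 := hsnd.eventually self_mem_nhdsWithin
  have hin : ∀ᶠ x in L, Icc x.1 x.2 ⊆ Ioc (-(n : ℝ)) n := by
    filter_upwards [hfst.eventually (mem_nhdsWithin_of_mem_nhds (lt_mem_nhds haN.1)),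
      hsnd.eventually (mem_nhdsWithin_of_mem_nhds (gt_mem_nhds haN.2))] with x h1 h2 y hy
    exact ⟨h1.trans_le hy.1, hy.2.trans h2.le⟩
  have h1 := tendsto_setIntegral_Icc_of_le
    ((continuous_const (y := (1 : ℝ))).locallyIntegrable (μ := μ))
    (hfst.mono_right nhdsWithin_le_nhds) (hsnd.mono_right nhdsWithin_le_nhds) hle1 hle2
  simp only [setIntegral_const, smul_eq_mul, mul_one, Icc_self] at h1
  have hatom : ν {a} = μ {a} := by
    rw [hν, Measure.restrict_apply' measurableSet_Ioc,
      inter_eq_left.2 (singleton_subset_iff.2 (Ioo_subset_Ioc_self haN))]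
  -- at an atom both the masses and the integrals converge to those of the atom
  by_cases haA : a ∈ A
  · have hpos : μ.real {a} ≠ 0 := by
      rw [Measure.real, ← hatom]
      exact (ENNReal.toReal_pos (ne_of_gt haA) (measure_ne_top _ _)).ne'
    have h2 := tendsto_setIntegral_Icc_of_le h.locallyIntegrable
      (hfst.mono_right nhdsWithin_le_nhds) (hsnd.mono_right nhdsWithin_le_nhds) hle1 hle2
    rw [Icc_self, integral_singleton, smul_eq_mul] at h2
    have h3 := (h1.inv₀ hpos).mul h2
    rw [inv_mul_cancel_left₀ hpos] at h3
    simpa only [setAverage_eq, smul_eq_mul] using h3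
  have haB : F a ∉ B := fun hh => ha ⟨hh, haA⟩
  have ha0 : μ.real {a} = 0 := by
    have h2 : ν {a} = 0 := by simpa [hA, pos_iff_ne_zero] using haA
    rw [Measure.real, ← hatom, h2]; rfl
  rw [ha0] at h1
  have hFa : F a ∈ Ioc 0 M := by
    refine ⟨ENNReal.toReal_pos ?_ (measure_ne_top _ _), measureReal_mono (subset_univ _)⟩
    rw [hν, Measure.restrict_apply' measurableSet_Ioc]
    have h2 := h.measureReal_pos haN.1 subset_rfl Ioo_subset_Icc_self
    refine ((ENNReal.toReal_pos_iff.1 h2).1.trans_le (measure_mono fun z hz => ?_)).ne'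
    exact ⟨hz.2.le, hz.1, hz.2.le.trans haN.2.le⟩
  have hQFa : Q (F a) = a := by
    refine le_antisymm ((quantile_le_iff hab hFa).2 le_rfl) ?_
    by_contra! hcon
    have h2 := (quantile_le_iff hab hFa).1 (le_refl (Q (F a)))
    obtain ⟨z, hz1, hz2⟩ := exists_between (max_lt hcon haN.1)
    have h3 : F a ≤ F z := h2.trans (hFmono ((le_max_left _ _).trans hz1.le))
    have h4 : F a = F z + ν.real (Ioc z a) := by
      rw [hF, ← measureReal_union (by
        exact Set.disjoint_left.2 fun y hy hy' => absurd hy'.1 (not_lt.2 hy)) measurableSet_Ioc,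
        Iic_union_Ioc_eq_Iic hz2.le]
    have h5 : 0 < ν.real (Ioc z a) := by
      have h6 := h.measureReal_Ioc_pos hz2
      rwa [Measure.real, hν, Measure.restrict_apply' measurableSet_Ioc, inter_eq_left.2]
      exact Ioc_subset_Ioc ((le_max_right _ _).trans hz1.le) haN.2.le
    linarith
  -- the interval `[c,d]` corresponds to `[ν(-∞,c), ν(-∞,d]]`, whose length `μ[c,d]` tends to `0`
  have hgood := mt (fun hh => subset_toMeasurable (volume : Measure ℝ) _ hh) haB
  rw [mem_ofPred_eq, not_not] at hgood
  have key := hgood (l := L) (fun x => (F x.2 + ν.real (Iio x.1)) / 2)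
    (fun x => μ.real (Icc x.1 x.2) / 2) (by
      refine tendsto_nhdsWithin_iff.2 ⟨by simpa using h1.div_const 2, ?_⟩
      filter_upwards [hlt] with x hx
      exact half_pos (h.measureReal_Icc_pos hx))
  have hlen : ∀ᶠ x in L, F x.2 - ν.real (Iio x.1) = μ.real (Icc x.1 x.2) := by
    filter_upwards [hlt, hin] with x hx hxin
    have h2 : F x.2 = ν.real (Iio x.1) + ν.real (Icc x.1 x.2) := by
      rw [hF, ← measureReal_union (by
        exact Set.disjoint_left.2 fun y hy hy' => absurd hy (not_lt.2 hy'.1)) measurableSet_Icc,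
        Iio_union_Icc_eq_Iic hx.le]
    have h3 : ν.real (Icc x.1 x.2) = μ.real (Icc x.1 x.2) := by
      rw [Measure.real, hν, Measure.restrict_apply' measurableSet_Ioc, inter_eq_left.2 hxin]
      rfl
    linarith
  have hgFa : g (F a) = u a := by rw [hg, indicator_of_mem hFa, hQFa]
  rw [hgFa] at key
  refine (key ?_).congr' ?_
  · filter_upwards [hlen, hle1, hle2] with x hx h2 h3
    rw [one_mul, Real.closedBall_eq_Icc]
    have h4 : ν.real (Iio x.1) ≤ F a := measureReal_mono fun z hz => (le_of_lt hz).trans h2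
    have h5 : F a ≤ F x.2 := hFmono h3
    constructor <;> linarith
  · filter_upwards [hlen, hlt, hin] with x hx hxlt hxin
    set p := ν.real (Iio x.1) with hp
    set q := F x.2 with hq
    have hball : Metric.closedBall ((q + p) / 2) (μ.real (Icc x.1 x.2) / 2) = Icc p q := by
      rw [Real.closedBall_eq_Icc, ← hx]; congr 1 <;> ring
    have hp0 : 0 ≤ p := measureReal_nonneg
    have hqM : q ≤ M := measureReal_mono (subset_univ _)
    have hpq : Ioc p q ⊆ Ioc 0 M := Ioc_subset_Ioc hp0 hqM
    set J := Q ⁻¹' Icc x.1 x.2 ∩ Ioc 0 M with hJ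
    have hsub : Ioc p q ⊆ J := by
      intro m hm
      refine ⟨⟨?_, (quantile_le_iff hab (hpq hm)).2 hm.2⟩, hpq hm⟩
      by_contra! hcon
      have h2 := (quantile_le_iff hab (hpq hm)).1 (le_refl (Q m))
      have h3 : F (Q m) ≤ p := measureReal_mono fun z hz => lt_of_le_of_lt hz hcon
      exact absurd hm.1 (not_lt.2 (h2.trans h3))
    have hνμ : ν (Icc x.1 x.2) = μ (Icc x.1 x.2) := by
      rw [hν, Measure.restrict_apply' measurableSet_Ioc, inter_eq_left.2 hxin]
    have hJvol : volume J = ENNReal.ofReal (q - p) := by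
      rw [hJ, ← Measure.restrict_apply' measurableSet_Ioc,
        ← Measure.map_apply_of_aemeasurable hQm measurableSet_Icc, hmap, hνμ, hx,
        ofReal_measureReal (h.measure_lt_top subset_rfl).ne]
    have hJae : Ioc p q =ᵐ[volume] J := by
      refine ae_eq_of_subset_of_measure_ge hsub ?_ measurableSet_Ioc.nullMeasurableSet ?_
      · rw [hJvol, Real.volume_Ioc]
      · rw [hJvol]; exact ENNReal.ofReal_ne_top
    have hint : ∫ η in Icc x.1 x.2, u η ∂μ = ∫ y in Icc p q, g y := by
      have e1 : μ.restrict (Icc x.1 x.2) = ν.restrict (Icc x.1 x.2) := by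
        rw [hν, Measure.restrict_restrict_of_subset hxin]
      have e2 : (volume.restrict (Ioc 0 M)).restrict (Q ⁻¹' Icc x.1 x.2) = volume.restrict J :=
        Measure.restrict_restrict₀ (hQm.nullMeasurable measurableSet_Icc)
      have e3 : ∫ η in Icc x.1 x.2, u η ∂ν = ∫ m in J, u (Q m) := by
        rw [← e2, ← setIntegral_map measurableSet_Icc (by rw [hmap]; exact huν.aestronglyMeasurable)
          hQm, hmap]
      rw [e1, e3, ← setIntegral_congr_set hJae, integral_Icc_eq_integral_Ioc]
      refine setIntegral_congr_fun measurableSet_Ioc fun m hm => ?_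
      rw [hg, indicator_of_mem (hpq hm)]
    rw [hball, setAverage_eq, setAverage_eq, hint]
    congr 2
    rw [← hx, Measure.real, Real.volume_Icc, ENNReal.toReal_ofReal]
    linarith [measureReal_nonneg (μ := μ) (s := Icc x.1 x.2)]

end Differentiation

/-! ### The velocity at time zero -/

section TimeZero

variable {μ : Measure ℝ} {u : ℝ → ℝ} {a : ℝ}

/-- A function of two variables `c < d` which tends to `y` as `c ↑ a` and `d ↓ a` still does so when
it is extended by `y` to `c = d`. -/
theorem tendsto_ite_of_tendsto_pair {G : ℝ → ℝ → ℝ} {y : ℝ}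
    (hG : Tendsto (fun x : ℝ × ℝ => G x.1 x.2)
      ((𝓝[≤] a ×ˢ 𝓝[≥] a) ⊓ 𝓟 {x | x.1 < x.2}) (𝓝 y))
    {ι : Type*} {l : Filter ι} {c d : ι → ℝ} (hc : Tendsto c l (𝓝 a)) (hd : Tendsto d l (𝓝 a))
    (hca : ∀ᶠ i in l, c i ≤ a) (hda : ∀ᶠ i in l, a ≤ d i) :
    Tendsto (fun i => if c i < d i then G (c i) (d i) else y) l (𝓝 y) := by
  have h1 : Tendsto c l (𝓝[≤] a) := tendsto_nhdsWithin_iff.2 ⟨hc, hca⟩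
  have h2 : Tendsto d l (𝓝[≥] a) := tendsto_nhdsWithin_iff.2 ⟨hd, hda⟩
  have h3 : Tendsto (fun i => (c i, d i)) (l ⊓ 𝓟 {i | c i < d i})
      ((𝓝[≤] a ×ˢ 𝓝[≥] a) ⊓ 𝓟 {x | x.1 < x.2}) := by
    refine tendsto_inf.2 ⟨(h1.prodMk h2).mono_left inf_le_left, ?_⟩
    exact tendsto_principal.2 (mem_inf_of_right (mem_principal_self _))
  exact Tendsto.if (hG.comp h3) tendsto_const_nhds

theorem Admissible.velocity_zero (h : Admissible μ u) (x : ℝ) :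
    velocity μ u x 0 = derivWithin (fun s => flow μ u s x) (Ici 0) 0 := by
  rw [velocity, h.clusterLeft_zero]

/-- The contact inequalities bound the difference quotient at time `0` by means of `u` over the two
parts `[a, β]` and `[α, a]` of the cluster `[α, β]`, which shrinks to `a`. -/
theorem Admissible.velocity_zero_eq (h : Admissible μ u)
    (hL : Tendsto (fun x : ℝ × ℝ => ⨍ η in Icc x.1 x.2, u η ∂μ)
      ((𝓝[≤] a ×ˢ 𝓝[≥] a) ⊓ 𝓟 {x | x.1 < x.2}) (𝓝 (u a))) : velocity μ u a 0 = u a := by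
  have hpos : ∀ᶠ s : ℝ in 𝓝[>] 0, 0 < s := self_mem_nhdsWithin
  rw [h.velocity_zero]
  suffices hd : HasDerivWithinAt (fun s => flow μ u s a) (u a) (Ici 0) 0 from
    hd.derivWithin (uniqueDiffOn_Ici 0 0 self_mem_Ici)
  rw [← hasDerivWithinAt_Ioi_iff_Ici, hasDerivWithinAt_iff_tendsto_slope' self_notMem_Ioi]
  have hlo := h.lo_tendsto_right le_rfl a
  have hhi := h.hi_tendsto_right le_rfl a
  rw [h.lo_zero] at hlo
  rw [h.hi_zero] at hhi
  have h1 := tendsto_ite_of_tendsto_pair (G := fun c d => ⨍ η in Icc c d, u η ∂μ) hL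
    hlo (tendsto_const_nhds (x := a)) (by
    filter_upwards [hpos] with s hs using h.lo_le hs.le a) (Eventually.of_forall fun _ => le_rfl)
  have h2 := tendsto_ite_of_tendsto_pair (G := fun c d => ⨍ η in Icc c d, u η ∂μ) hL
    (tendsto_const_nhds (x := a)) hhi
    (Eventually.of_forall fun _ => le_rfl) (by
    filter_upwards [hpos] with s hs using h.le_hi hs.le a)
  refine tendsto_of_tendsto_of_tendsto_of_le_of_le' h2 h1 ?_ ?_
  · filter_upwards [hpos] with s hs
    rw [slope_def_field, h.flow_zero, sub_zero, le_div_iff₀ hs]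
    split_ifs with hlt
    · have h3 := (h.isContact_hi hs.le a).setIntegral_Icc_left_nonpos h hs.le hlt.le
      have h4 := h.lt_setIntegral_id hlt Ioo_subset_Icc_self subset_rfl measurableSet_Icc
        (fun η hη => hη.1) le_rfl
      rw [h.setIntegral_split _ _ subset_rfl] at h3
      have hm := h.measureReal_Icc_pos hlt
      rw [setAverage_eq, smul_eq_mul, mul_assoc, inv_mul_le_iff₀ hm]
      linarith
    · have e := le_antisymm (not_lt.1 hlt) (h.le_hi hs.le a)
      have h3 := h.flow_eq_hi hs.le a
      rw [e] at h3
      linarith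
  · filter_upwards [hpos] with s hs
    rw [slope_def_field, h.flow_zero, sub_zero, div_le_iff₀ hs]
    split_ifs with hlt
    · have h3 := (h.isContact_lo hs.le a).setIntegral_Icc_right_nonneg h hs.le hlt.le
      have h4 := h.setIntegral_id_lt hlt Ioo_subset_Icc_self subset_rfl measurableSet_Icc
        (fun η hη => hη.2) le_rfl
      rw [h.setIntegral_split _ _ subset_rfl] at h3
      have hm := h.measureReal_Icc_pos hlt
      rw [setAverage_eq, smul_eq_mul, mul_assoc, le_inv_mul_iff₀ hm]
      linarith
    · have e := le_antisymm (h.lo_le hs.le a) (not_lt.1 hlt)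
      have h3 := h.flow_eq_lo hs.le a
      rw [e] at h3
      linarith

theorem Admissible.velocity_tendsto_zero (h : Admissible μ u)
    (hL : Tendsto (fun x : ℝ × ℝ => ⨍ η in Icc x.1 x.2, u η ∂μ)
      ((𝓝[≤] a ×ˢ 𝓝[≥] a) ⊓ 𝓟 {x | x.1 < x.2}) (𝓝 (u a))) :
    Tendsto (fun s => velocity μ u (flow μ u s a) s) (𝓝[>] 0) (𝓝 (u a)) := by
  have hpos : ∀ᶠ s : ℝ in 𝓝[>] 0, 0 < s := self_mem_nhdsWithin
  have hlo := h.lo_tendsto_right le_rfl a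
  have hhi := h.hi_tendsto_right le_rfl a
  rw [h.lo_zero] at hlo
  rw [h.hi_zero] at hhi
  refine (tendsto_ite_of_tendsto_pair (G := fun c d => ⨍ η in Icc c d, u η ∂μ) hL hlo hhi (by
    filter_upwards [hpos] with s hs using h.lo_le hs.le a) (by
    filter_upwards [hpos] with s hs using h.le_hi hs.le a)).congr' ?_
  filter_upwards [hpos] with s hs
  split_ifs with hlt
  · exact (h.velocity_of_lt hs hlt).symm
  · have heq := le_antisymm (h.lo_le_hi hs.le a) (not_lt.1 hlt)
    exact (h.velocity_of_eq hs (h.lo_eq_of_eq hs.le heq) (h.hi_eq_of_eq hs.le heq)).symm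

/-- The velocity field is a Borel function at each time `t ≥ 0`. For `t > 0` it is a difference of
monotone functions. At time `0` it is the limit of difference quotients where the limit exists, and
there it suffices to consider rational times by continuity of the paths. -/
theorem Admissible.measurable_velocity (h : Admissible μ u) {t : ℝ} (ht : 0 ≤ t) :
    Measurable fun x => velocity μ u x t := by
  rcases ht.eq_or_lt with rfl | ht
  · set q : ℝ → ℝ → ℝ := fun s x => (flow μ u s x - x) / s with hq
    have hslope : ∀ x, slope (fun s => flow μ u s x) 0 = fun s => q s x := fun x => by
      ext s; rw [slope_def_field, h.flow_zero, sub_zero]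
    have hqm : ∀ s, 0 ≤ s → Measurable (q s) := fun s hs =>
      ((h.measurable_flow hs).sub measurable_id).div_const s
    let ι := {r : ℚ // 0 < r}
    let l : Filter ι := comap (fun r : ι => ((r : ℚ) : ℝ)) (𝓝[>] 0)
    set E : Set ℝ := {x | ∃ c, Tendsto (fun r : ι => q ((r : ℚ) : ℝ) x) l (𝓝 c)} with hE
    have hEm : MeasurableSet E := measurableSet_exists_tendsto (l := l)
      (f := fun (r : ι) x => q ((r : ℚ) : ℝ) x) fun r => hqm _ (by exact_mod_cast r.2.le)
    have hreal : ∀ x c, Tendsto (fun r : ι => q ((r : ℚ) : ℝ) x) l (𝓝 c) →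
        Tendsto (fun s => q s x) (𝓝[>] 0) (𝓝 c) := by
      intro x c hc
      refine Metric.tendsto_nhds.2 fun ε hε => ?_
      have h1 := Metric.tendsto_nhds.1 hc (ε / 2) (half_pos hε)
      obtain ⟨T, hT, hTsub⟩ := mem_comap.1 h1
      obtain ⟨δ, hδ, hδT⟩ := mem_nhdsGT_iff_exists_Ioo_subset.1 hT
      filter_upwards [Ioo_mem_nhdsGT hδ] with s hs
      refine lt_of_le_of_lt ?_ (half_lt_self hε)
      by_contra! hcon
      have hcont : ContinuousAt (fun s => dist (q s x) c) s := by
        have h2 := h.flow_continuousAt hs.1 x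
        have h3 := hs.1.ne'
        have : ContinuousAt (fun s => q s x) s :=
          (h2.sub continuousAt_const).div continuousAt_id h3
        exact this.dist continuousAt_const
      obtain ⟨_, ⟨r, rfl⟩, hr⟩ := Rat.denseRange_cast (𝕜 := ℝ) |>.inter_nhds_nonempty
        (inter_mem (hcont.eventually (lt_mem_nhds hcon)) (Ioo_mem_nhds hs.1 hs.2))
      have hr0 : 0 < r := by exact_mod_cast hr.2.1
      have h4 : dist (q (r : ℝ) x) c < ε / 2 := hTsub (a := ⟨r, hr0⟩) (hδT hr.2)
      exact absurd h4 (not_lt.2 (le_of_lt hr.1))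
    have hreal' : ∀ x c, Tendsto (fun s => q s x) (𝓝[>] 0) (𝓝 c) →
        Tendsto (fun r : ι => q ((r : ℚ) : ℝ) x) l (𝓝 c) := fun x c hc =>
      hc.comp tendsto_comap
    have hseq : Tendsto (fun n : ℕ => 1 / ((n : ℝ) + 1)) atTop (𝓝[>] 0) := by
      refine tendsto_nhdsWithin_iff.2 ⟨tendsto_one_div_add_atTop_nhds_zero_nat, ?_⟩
      exact Eventually.of_forall fun n => by rw [mem_Ioi]; positivity
    refine measurable_of_tendsto_metrizable
      (f := fun n : ℕ => E.indicator (q (1 / ((n : ℝ) + 1))))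
      (fun n => (hqm _ (by positivity)).indicator hEm) (tendsto_pi_nhds.2 fun x => ?_)
    rw [h.velocity_zero]
    -- off `E` the path is not differentiable, and `derivWithin` is `0` by convention
    by_cases hx : x ∈ E
    · simp only [indicator_of_mem hx]
      obtain ⟨c, hc⟩ := hx
      have h1 := hreal x c hc
      have h2 : HasDerivWithinAt (fun s => flow μ u s x) c (Ici 0) 0 := by
        rw [← hasDerivWithinAt_Ioi_iff_Ici, hasDerivWithinAt_iff_tendsto_slope' self_notMem_Ioi,
          hslope]
        exact h1
      rw [h2.derivWithin (uniqueDiffOn_Ici 0 0 self_mem_Ici)]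
      exact h1.comp hseq
    · simp only [indicator_of_notMem hx]
      rw [derivWithin_zero_of_not_differentiableWithinAt]
      · exact tendsto_const_nhds
      · intro hd
        have h2 := hd.hasDerivWithinAt
        rw [← hasDerivWithinAt_Ioi_iff_Ici, hasDerivWithinAt_iff_tendsto_slope' self_notMem_Ioi,
          hslope] at h2
        exact hx ⟨_, hreal' x _ h2⟩
  · simp only [h.velocity_eq ht]
    have hmono : Monotone fun x =>
        massCentre μ (clusterLeft μ u x t) (clusterRight μ u x t) := by
      intro x y hxy
      rcases hxy.eq_or_lt with rfl | hxy
      · exact le_rfl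
      · exact (h.massCentre_le (h.clusterLeft_le_clusterRight ht.le x)).trans
          ((h.clusterRight_lt_clusterLeft ht.le hxy).le.trans
            (h.le_massCentre (h.clusterLeft_le_clusterRight ht.le y)))
    exact (measurable_id.sub hmono.measurable).div_const t

end TimeZero

/-! ### Paths that jump once from a constant -/

section Paths

theorem tendsto_coe_nhdsGT (t : ℝ≥0) : Tendsto ((↑) : ℝ≥0 → ℝ) (𝓝[>] t) (𝓝[>] (t : ℝ)) :=
  tendsto_nhdsWithin_iff.2 ⟨(NNReal.continuous_coe.tendsto t).mono_left nhdsWithin_le_nhds, by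
    filter_upwards [self_mem_nhdsWithin] with s hs
    exact NNReal.coe_lt_coe.2 hs⟩

theorem tendsto_coe_nhdsLT (t : ℝ≥0) : Tendsto ((↑) : ℝ≥0 → ℝ) (𝓝[<] t) (𝓝[<] (t : ℝ)) :=
  tendsto_nhdsWithin_iff.2 ⟨(NNReal.continuous_coe.tendsto t).mono_left nhdsWithin_le_nhds, by
    filter_upwards [self_mem_nhdsWithin] with s hs
    exact NNReal.coe_lt_coe.2 hs⟩

/-- A path which is constant before `γ` is càdlàg if it is so from `γ` on. -/
theorem isCadlag_of_const_before {f v : ℝ≥0 → ℝ} {γ : ℝ≥0∞} {c : ℝ}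
    (hc : ∀ t : ℝ≥0, (t : ℝ≥0∞) < γ → f t = c) (hv : ∀ t : ℝ≥0, γ ≤ t → f t = v t)
    (hright : ∀ t : ℝ≥0, γ ≤ t → Tendsto v (𝓝[>] t) (𝓝 (v t)))
    (hleft : ∀ t : ℝ≥0, γ < t → ∃ l, Tendsto v (𝓝[<] t) (𝓝 l)) : IsCadlag f := by
  intro t
  rcases lt_or_ge (t : ℝ≥0∞) γ with ht | ht
  · have hev : ∀ᶠ s in 𝓝 t, f s = c := by
      filter_upwards [(ENNReal.continuous_coe.tendsto t).eventually (gt_mem_nhds ht)] with s hs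
      exact hc s hs
    have hcont : Tendsto f (𝓝 t) (𝓝 c) :=
      tendsto_const_nhds.congr' (hev.mono fun _ hs => hs.symm)
    refine ⟨?_, c, hcont.mono_left nhdsWithin_le_nhds⟩
    have : ContinuousAt f t := by rw [ContinuousAt, hc t ht]; exact hcont
    exact this.continuousWithinAt
  · refine ⟨?_, ?_⟩
    · rw [← continuousWithinAt_Ioi_iff_Ici, ContinuousWithinAt, hv t ht]
      refine (hright t ht).congr' ?_
      filter_upwards [self_mem_nhdsWithin] with s hs
      exact (hv s (ht.trans (ENNReal.coe_le_coe.2 (le_of_lt hs)))).symm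
    · rcases ht.eq_or_lt with ht | ht
      · refine ⟨c, tendsto_const_nhds.congr' ?_⟩
        filter_upwards [self_mem_nhdsWithin] with s hs
        exact (hc s (ht ▸ ENNReal.coe_lt_coe.2 hs)).symm
      · obtain ⟨l, hl⟩ := hleft t ht
        refine ⟨l, hl.congr' ?_⟩
        filter_upwards [mem_nhdsWithin_of_mem_nhds
          ((ENNReal.continuous_coe.tendsto t).eventually (lt_mem_nhds ht))] with s hs
        exact (hv s hs.le).symm

theorem isCadlag_step {f : ℝ≥0 → ℝ} {γ : ℝ≥0∞} {c : ℝ}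
    (hc : ∀ t : ℝ≥0, (t : ℝ≥0∞) < γ → f t = c) (h0 : ∀ t : ℝ≥0, γ ≤ t → f t = 0) :
    IsCadlag f :=
  isCadlag_of_const_before (v := fun _ => 0) hc h0 (fun _ _ => tendsto_const_nhds)
    fun _ _ => ⟨0, tendsto_const_nhds⟩

theorem boundedVariationOn_step {f : ℝ≥0 → ℝ} {γ : ℝ≥0∞} {c : ℝ}
    (hc : ∀ t : ℝ≥0, (t : ℝ≥0∞) < γ → f t = c) (h0 : ∀ t : ℝ≥0, γ ≤ t → f t = 0) :
    BoundedVariationOn f univ := by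
  classical
  -- the path is an affine function of the increasing function `1_{γ ≤ t}`
  let φ : ℝ≥0 → ℝ := fun t => if γ ≤ t then 1 else 0
  let g : ℝ → ℝ := fun x => c * (1 - x)
  have hφ : MonotoneOn φ univ := by
    intro s _ t _ hst
    by_cases hs : γ ≤ s
    · have ht : γ ≤ t := hs.trans (ENNReal.coe_le_coe.2 hst)
      simp only [φ, hs, ht, if_true, le_refl]
    · simp only [φ, hs, if_false]
      split_ifs <;> norm_num
  have hmaps : MapsTo φ univ (Icc 0 1) := by
    intro t _
    simp only [φ]
    split_ifs <;> norm_num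
  have hf : f = g ∘ φ := by
    ext t
    rcases lt_or_ge (t : ℝ≥0∞) γ with ht | ht
    · simp [g, φ, hc t ht, not_le.2 ht]
    · simp [g, φ, h0 t ht, ht]
  have hg : LipschitzWith ‖c‖₊ g := by
    refine LipschitzWith.of_dist_le_mul fun x y => ?_
    rw [Real.dist_eq, Real.dist_eq, coe_nnnorm, Real.norm_eq_abs, ← abs_mul]
    apply le_of_eq
    rw [← abs_neg]
    congr 1
    simp only [g]; ring
  have hgb := hg.locallyBoundedVariationOn univ 0 1 (mem_univ _) (mem_univ _)
  rw [univ_inter] at hgb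
  rw [BoundedVariationOn, hf]
  exact ne_top_of_le_ne_top hgb (eVariationOn.comp_le_of_monotoneOn g φ hφ hmaps)

end Paths

/-! ### Conditional expectations -/

section CondExp

variable {Ω : Type*}

/-- If `W` is a function of `Y` on an event `E` of `σ(Y)`, then every `σ(W)`-measurable function is
`σ(Y)`-measurable on `E`. -/
theorem measurable_comap_indicator {Y W V : Ω → ℝ} {E : Set Ω}
    (hE : MeasurableSet[MeasurableSpace.comap Y inferInstance] E) {φ : ℝ → ℝ} (hφ : Measurable φ)
    (h1 : ∀ ω ∈ E, W ω = φ (Y ω)) (hV : Measurable[MeasurableSpace.comap W inferInstance] V) :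
    Measurable[MeasurableSpace.comap Y inferInstance] (E.indicator V) := by
  obtain ⟨g, hg, rfl⟩ := hV.exists_eq_measurable_comp
  have : E.indicator (g ∘ W) = E.indicator ((g ∘ φ) ∘ Y) := by
    ext ω
    by_cases hω : ω ∈ E
    · rw [indicator_of_mem hω, indicator_of_mem hω, Function.comp_apply, h1 ω hω]
      rfl
    · rw [indicator_of_notMem hω, indicator_of_notMem hω]
  rw [this]
  exact ((hg.comp hφ).comp (comap_measurable Y)).indicator hE

variable [m0 : MeasurableSpace Ω] {P : Measure Ω}

theorem sigmaFinite_trim_of_cover {m : MeasurableSpace Ω} (hm : m ≤ m0) (S : ℕ → Set Ω)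
    (hS : ∀ n, MeasurableSet[m] (S n)) (hfin : ∀ n, P (S n) < ∞) (hcover : ⋃ n, S n = univ) :
    SigmaFinite (P.trim hm) :=
  ⟨⟨{ set := S
      set_mem := fun _ => trivial
      finite := fun n => by rw [trim_measurableSet_eq hm (hS n)]; exact hfin n
      spanning := hcover }⟩⟩

/-- If two random variables are functions of each other on an event of both of their σ-algebras,
then the conditional expectations given one or the other coincide on this event. -/
theorem condExp_ae_eq_restrict_of_eq_comp {Y W f : Ω → ℝ} (hY : Measurable Y) (hW : Measurable W)
    [SigmaFinite (P.trim hY.comap_le)] [SigmaFinite (P.trim hW.comap_le)] {E : Set Ω}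
    (hEY : MeasurableSet[MeasurableSpace.comap Y inferInstance] E)
    (hEW : MeasurableSet[MeasurableSpace.comap W inferInstance] E) {φ ψ : ℝ → ℝ}
    (hφ : Measurable φ) (hψ : Measurable ψ) (h1 : ∀ ω ∈ E, W ω = φ (Y ω))
    (h2 : ∀ ω ∈ E, Y ω = ψ (W ω)) :
    P[f | MeasurableSpace.comap Y inferInstance] =ᵐ[P.restrict E]
      P[f | MeasurableSpace.comap W inferInstance] := by
  have key : ∀ {Y W : Ω → ℝ} {φ : ℝ → ℝ}, Measurable φ → (∀ ω ∈ E, W ω = φ (Y ω)) →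
      MeasurableSet[MeasurableSpace.comap Y inferInstance] E → ∀ s,
      MeasurableSet[MeasurableSpace.comap W inferInstance] (E ∩ s) →
      MeasurableSet[MeasurableSpace.comap Y inferInstance] (E ∩ s) := by
    rintro Y W φ hφ hφE hE s ⟨B, hB, hBs⟩
    have : E ∩ s = E ∩ Y ⁻¹' (φ ⁻¹' B) := by
      ext ω
      constructor
      · intro hω
        refine ⟨hω.1, ?_⟩
        have : W ω ∈ B := by rw [← hBs] at hω; exact hω
        rwa [hφE ω hω.1] at this
      · rintro ⟨hωE, hω⟩
        rw [← hBs]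
        change W ω ∈ B
        rw [hφE ω hωE]
        exact hω
    rw [this]
    exact hE.inter ⟨_, hφ hB, rfl⟩
  exact condExp_ae_eq_restrict_of_measurableSpace_eq_on hY.comap_le hW.comap_le hEY
    fun s => ⟨key hψ h2 hEW s, key hφ h1 hEY s⟩

end CondExp

/-! ### The processes -/

section Trajectories

variable {μ : Measure ℝ} {u : ℝ → ℝ} {p : ℝ → ℝ}
variable {Ω : Type*} {X₀ : Ω → ℝ} {Z : ℝ≥0 → Ω → ℝ}

theorem Admissible.measurable_clusterLeft (h : Admissible μ u) {t : ℝ} (ht : 0 ≤ t) :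
    Measurable fun x => clusterLeft μ u x t := (h.clusterLeft_strictMono ht).monotone.measurable

theorem Admissible.measurable_clusterRight (h : Admissible μ u) {t : ℝ} (ht : 0 ≤ t) :
    Measurable fun x => clusterRight μ u x t := (h.clusterRight_strictMono ht).monotone.measurable

/-- The later positions are functions of the present one, since clusters stay together. -/
theorem Admissible.process_eq_comp (h : Admissible μ u)
    (hZ : ∀ t ω, Z t ω = flow μ u t (p (X₀ ω))) {s t : ℝ≥0} (hst : s ≤ t) :
    Z t = (fun x => flow μ u t (clusterLeft μ u x s)) ∘ Z s := by
  ext ω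
  rw [Function.comp_apply, hZ, hZ]
  exact (h.flow_eq_of_le s.coe_nonneg (NNReal.coe_le_coe.2 hst) (h.flow_lo s.coe_nonneg _)).symm

theorem Admissible.comap_process_anti (h : Admissible μ u)
    (hZ : ∀ t ω, Z t ω = flow μ u t (p (X₀ ω))) {s t : ℝ≥0} (hst : s ≤ t) :
    MeasurableSpace.comap (Z t) inferInstance ≤ MeasurableSpace.comap (Z s) inferInstance := by
  rw [h.process_eq_comp hZ hst, ← MeasurableSpace.comap_comp]
  refine MeasurableSpace.comap_mono (Measurable.comap_le ?_)
  exact (h.measurable_flow t.coe_nonneg).comp (h.measurable_clusterLeft s.coe_nonneg)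

/-- The future is as large as the present, because particles merge but never split. -/
theorem Admissible.future_eq (h : Admissible μ u)
    (hZ : ∀ t ω, Z t ω = flow μ u t (p (X₀ ω))) :
    future Z = fun t => MeasurableSpace.comap (Z t) inferInstance := by
  ext1 t
  refine le_antisymm (iSup₂_le fun s hs => h.comap_process_anti hZ hs) ?_
  exact le_iSup₂_of_le t le_rfl le_rfl

/-- Whether the first shock is still to come can be read off the present position: it is so if the
left end of the cluster found there has not had its first shock. -/
theorem IsRepresentative.lt_shockTime_iff (hp : IsRepresentative μ u p) (h : Admissible μ u)
    (t : ℝ≥0) (a : ℝ) :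
    (t : ℝ≥0∞) < shockTime μ u a ↔
      (t : ℝ≥0∞) < shockTime μ u (clusterLeft μ u (flow μ u t (p a)) t) := by
  constructor
  · intro ht
    have h1 := h.lo_eq_of_eq t.coe_nonneg (hp.solo a t ht)
    rw [lo] at h1
    rwa [h1, hp.shockTime_eq h]
  · intro ht
    have h1 : p a = clusterLeft μ u (flow μ u t (p a)) t :=
      h.eq_of_flow_eq t.coe_nonneg (h.lo_eq_hi_of_lt ht) (h.flow_lo t.coe_nonneg (p a)).symm
    rwa [← h1, hp.shockTime_eq h] at ht

theorem IsRepresentative.eq_clusterLeft_of_lt (hp : IsRepresentative μ u p) (h : Admissible μ u)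
    {t : ℝ≥0} {a : ℝ} (ht : (t : ℝ≥0∞) < shockTime μ u a) :
    p a = clusterLeft μ u (flow μ u t (p a)) t :=
  (h.lo_eq_of_eq t.coe_nonneg (hp.solo a t ht)).symm

theorem Admissible.measurableSet_unshocked (h : Admissible μ u) (t : ℝ≥0) :
    MeasurableSet {x | (t : ℝ≥0∞) < shockTime μ u (clusterLeft μ u x t)} :=
  measurableSet_lt measurable_const
    (h.measurable_shockTime.comp (h.measurable_clusterLeft t.coe_nonneg))

theorem IsRepresentative.measurableSet_lt (hp : IsRepresentative μ u p) (h : Admissible μ u)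
    (hZ : ∀ t ω, Z t ω = flow μ u t (p (X₀ ω))) (t : ℝ≥0) :
    MeasurableSet[MeasurableSpace.comap (Z t) inferInstance]
      {ω | (t : ℝ≥0∞) < shockTime μ u (X₀ ω)} := by
  refine ⟨_, h.measurableSet_unshocked t, ?_⟩
  ext ω
  simp only [mem_preimage, mem_ofPred_eq, hZ]
  exact (hp.lt_shockTime_iff h t (X₀ ω)).symm

variable [m0 : MeasurableSpace Ω] {P : Measure Ω}

theorem IsRepresentative.measurable_process (hp : IsRepresentative μ u p) (h : Admissible μ u)
    (hX₀ : Measurable X₀) (hZ : ∀ t ω, Z t ω = flow μ u t (p (X₀ ω))) (t : ℝ≥0) :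
    Measurable (Z t) := by
  rw [show Z t = fun ω => flow μ u t (p (X₀ ω)) from funext (hZ t)]
  exact (h.measurable_flow t.coe_nonneg).comp (hp.measurable.comp hX₀)

/-- The measure is σ-finite on `σ(Z_t)`: a particle whose representative lies in a bounded set at time
`t`, and whose first shock happens by time `n` or never, starts in a bounded set. -/
theorem IsRepresentative.sigmaFinite_trim (hp : IsRepresentative μ u p) (h : Admissible μ u)
    (hX₀ : Measurable X₀) (hlaw : P.map X₀ = μ) (hZ : ∀ t ω, Z t ω = flow μ u t (p (X₀ ω)))
    (t : ℝ≥0) :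
    SigmaFinite (P.trim (hp.measurable_process h hX₀ hZ t).comap_le) := by
  have hPfin : ∀ S : Set Ω, ∀ c d, (∀ ω ∈ S, X₀ ω ∈ Icc c d) → P S < ∞ := by
    intro S c d hS
    refine (measure_mono (show S ⊆ X₀ ⁻¹' Icc c d from hS)).trans_lt ?_
    rw [← Measure.map_apply hX₀ measurableSet_Icc, hlaw]
    exact h.measure_lt_top subset_rfl
  -- bounded positions come from bounded starting points
  have hbdd : ∀ (s : ℝ≥0) (c d a : ℝ), flow μ u s a ∈ Icc c d →
      a ∈ Icc (clusterLeft μ u c s) (clusterRight μ u d s) := by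
    intro s c d a ha
    constructor
    · by_contra! hcon
      exact absurd ha.1 (not_le.2 (h.flow_lt_of_lt_clusterLeft s.coe_nonneg hcon))
    · by_contra! hcon
      exact absurd ha.2 (not_le.2 (h.lt_flow_of_clusterRight_lt s.coe_nonneg hcon))
  set T : ℝ → ℝ≥0∞ := fun x => shockTime μ u (clusterLeft μ u x t) with hT
  have hTm : Measurable T := h.measurable_shockTime.comp (h.measurable_clusterLeft t.coe_nonneg)
  refine sigmaFinite_trim_of_cover _
    (fun n : ℕ => Z t ⁻¹' (Icc (-(n : ℝ)) n ∩ (T ⁻¹' Iic (n : ℝ≥0∞) ∪ T ⁻¹' {∞}))) (fun n => ?_)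
    (fun n => ?_) ?_
  · exact ⟨_, measurableSet_Icc.inter
      ((hTm measurableSet_Iic).union (hTm (measurableSet_singleton _))), rfl⟩
  · set N : ℝ≥0 := max t n with hN
    set c := clusterLeft μ u (-(n : ℝ)) t
    set d := clusterRight μ u (n : ℝ) t
    have htN : (t : ℝ) ≤ N := NNReal.coe_le_coe.2 (le_max_left t (n : ℝ≥0))
    refine hPfin _ (min c (clusterLeft μ u (flow μ u N c) N))
      (max d (clusterRight μ u (flow μ u N d) N)) fun ω hω => ?_
    obtain ⟨hω1, hω2⟩ := hω
    rw [hZ] at hω1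
    have hX : X₀ ω ∈ Icc c d → X₀ ω ∈ Icc (min c (clusterLeft μ u (flow μ u N c) N))
        (max d (clusterRight μ u (flow μ u N d) N)) := fun hh =>
      ⟨(min_le_left _ _).trans hh.1, hh.2.trans (le_max_left _ _)⟩
    have hpcd := hbdd t _ _ _ hω1
    rcases lt_or_ge (t : ℝ≥0∞) (shockTime μ u (X₀ ω)) with hlt | hge
    · have hTγ : T (Z t ω) = shockTime μ u (X₀ ω) := by
        rw [hT, hZ]
        simp only
        rw [← hp.eq_clusterLeft_of_lt h hlt, hp.shockTime_eq h]
      rcases hω2 with hω2 | hω2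
      · have hτn : shockTime μ u (X₀ ω) ≤ N := by
          rw [← hTγ]
          refine le_trans (show T (Z t ω) ≤ (n : ℝ≥0∞) from hω2) ?_
          have : (n : ℝ≥0) ≤ N := le_max_right _ _
          exact_mod_cast this
        have h1 := hp.flow_eq_of_le h hτn
        have h2 : flow μ u N (X₀ ω) ∈ Icc (flow μ u N c) (flow μ u N d) := by
          rw [← h1]
          exact ⟨h.flow_monotone N.coe_nonneg hpcd.1, h.flow_monotone N.coe_nonneg hpcd.2⟩
        have h3 := hbdd N _ _ _ h2
        exact ⟨(min_le_right _ _).trans h3.1, h3.2.trans (le_max_right _ _)⟩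
      · have htop : shockTime μ u (X₀ ω) = ∞ := by rw [← hTγ]; exact hω2
        rw [hp.of_top _ htop] at hpcd
        exact hX hpcd
    · rw [hp.flow_eq_of_le h hge] at hω1
      exact hX (hbdd t _ _ _ hω1)
  · refine eq_univ_of_forall fun ω => mem_iUnion.2 ?_
    obtain ⟨n, hn⟩ := exists_nat_ge |Z t ω|
    by_cases htop : T (Z t ω) = ∞
    · exact ⟨n, abs_le.1 hn, Or.inr htop⟩
    · obtain ⟨k, hk⟩ := exists_nat_ge (T (Z t ω)).toReal
      have hk' : T (Z t ω) ≤ (k : ℝ≥0∞) := by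
        rw [← ENNReal.ofReal_toReal htop, ← ENNReal.ofReal_natCast]
        exact ENNReal.ofReal_le_ofReal hk
      refine ⟨max n k, abs_le.1 (hn.trans (by exact_mod_cast le_max_left n k)), Or.inl ?_⟩
      exact hk'.trans (by exact_mod_cast le_max_right n k)

/-- The Markov property is immediate: every event of the future belongs to `σ(Z_t)`. -/
theorem IsRepresentative.isMarkov (hp : IsRepresentative μ u p) (h : Admissible μ u)
    (hX₀ : Measurable X₀) (hlaw : P.map X₀ = μ) (hZ : ∀ t ω, Z t ω = flow μ u t (p (X₀ ω))) :
    IsMarkov Z P := by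
  intro t A hA hPA B hB hPB
  have hm := hp.measurable_process h hX₀ hZ
  have hsf := hp.sigmaFinite_trim h hX₀ hlaw hZ t
  have hpast : past Z t ≤ m0 := iSup₂_le fun s _ => (hm s).comap_le
  rw [h.future_eq hZ] at hB
  have hB' : MeasurableSet B := (hm t).comap_le _ hB
  have hA' : MeasurableSet A := hpast _ hA
  have hintA : Integrable (A.indicator fun _ => (1 : ℝ)) P :=
    (integrable_indicator_iff hA').2 (integrableOn_const hPA)
  have hintB : Integrable (B.indicator fun _ => (1 : ℝ)) P :=
    (integrable_indicator_iff hB').2 (integrableOn_const hPB)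
  have h1 : (A ∩ B).indicator (fun _ => (1 : ℝ)) = B.indicator (A.indicator fun _ => (1 : ℝ)) := by
    rw [indicator_indicator, inter_comm]
  have h2 := condExp_indicator (m := MeasurableSpace.comap (Z t) inferInstance) hintA hB
  have h3 : P[B.indicator (fun _ => (1 : ℝ)) | MeasurableSpace.comap (Z t) inferInstance] =
      B.indicator fun _ => (1 : ℝ) :=
    condExp_of_stronglyMeasurable (hm t).comap_le
      ((@stronglyMeasurable_const _ _ (MeasurableSpace.comap (Z t) inferInstance) _ _).indicator hB)
      hintB
  rw [h1, h3]
  filter_upwards [h2] with ω hω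
  rw [hω]
  by_cases hωB : ω ∈ B
  · simp [hωB]
  · simp [hωB]

end Trajectories

/-! ### The velocity as a conditional expectation -/

section Velocity

variable {μ : Measure ℝ} {u : ℝ → ℝ} {p : ℝ → ℝ}
variable {Ω : Type*} [m0 : MeasurableSpace Ω] {P : Measure Ω} {X₀ : Ω → ℝ} {Z : ℝ≥0 → Ω → ℝ}

theorem sigmaFinite_trim_initial (h : Admissible μ u) (hX₀ : Measurable X₀)
    (hlaw : P.map X₀ = μ) : SigmaFinite (P.trim hX₀.comap_le) := by
  refine sigmaFinite_trim_of_cover _ (fun n : ℕ => X₀ ⁻¹' Icc (-(n : ℝ)) n)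
    (fun n => ⟨_, measurableSet_Icc, rfl⟩) (fun n => ?_) ?_
  · rw [← Measure.map_apply hX₀ measurableSet_Icc, hlaw]
    exact h.measure_lt_top subset_rfl
  · refine eq_univ_of_forall fun ω => mem_iUnion.2 ?_
    obtain ⟨n, hn⟩ := exists_nat_ge |X₀ ω|
    exact ⟨n, abs_le.1 hn⟩

/-- The particles found in a non-trivial cluster are the same for the processes and for the flow. -/
theorem IsRepresentative.flow_eq_iff_of_lt (hp : IsRepresentative μ u p) (h : Admissible μ u)
    {t : ℝ≥0} {y a : ℝ} (hy : clusterLeft μ u y t < clusterRight μ u y t) :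
    flow μ u t (p a) = y ↔ a ∈ Icc (clusterLeft μ u y t) (clusterRight μ u y t) := by
  constructor
  · rintro rfl
    have hle : shockTime μ u a ≤ t := by
      by_contra! hcon
      exact hy.ne (hp.solo a t hcon)
    rw [hp.flow_eq_of_le h hle]
    exact ⟨h.lo_le t.coe_nonneg a, h.le_hi t.coe_nonneg a⟩
  · intro ha
    have e := h.flow_eq_of_mem t.coe_nonneg ha.1 ha.2
    have hle : shockTime μ u a ≤ t := h.shockTime_le (by rw [lo, hi, e]; exact hy)
    rw [hp.flow_eq_of_le h hle, e]

theorem ae_velocity_zero_eq (h : Admissible μ u) (hX₀ : Measurable X₀) (hlaw : P.map X₀ = μ) :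
    ∀ᵐ ω ∂P, velocity μ u (X₀ ω) 0 = u (X₀ ω) := by
  have : ∀ᵐ a ∂(P.map X₀), velocity μ u a 0 = u a := by
    rw [hlaw]
    filter_upwards [h.ae_tendsto_average] with a ha using h.velocity_zero_eq ha
  exact ae_of_ae_map hX₀.aemeasurable this

/-- On a non-trivial cluster the conditional expectation of the initial velocity is the velocity of
the cluster, by conservation of momentum. -/
theorem IsRepresentative.condExp_eq_velocity_of_lt (hp : IsRepresentative μ u p)
    (h : Admissible μ u) (hX₀ : Measurable X₀) (hlaw : P.map X₀ = μ)
    (hZ : ∀ t ω, Z t ω = flow μ u t (p (X₀ ω))) (hu : Integrable u μ) (t : ℝ≥0) (ω : Ω)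
    (hω : clusterLeft μ u (Z t ω) t < clusterRight μ u (Z t ω) t) :
    (P[fun ω => u (X₀ ω) | MeasurableSpace.comap (Z t) inferInstance]) ω =
      velocity μ u (Z t ω) t := by
  have hm := hp.measurable_process h hX₀ hZ
  have hsf := hp.sigmaFinite_trim h hX₀ hlaw hZ t
  have ht : 0 < (t : ℝ) := by
    rcases t.coe_nonneg.eq_or_lt with h0 | h0
    · rw [← h0, h.clusterLeft_zero, h.clusterRight_zero] at hω
      exact absurd hω (lt_irrefl _)
    · exact h0
  have huX : Integrable (fun ω => u (X₀ ω)) P := by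
    rw [← hlaw] at hu
    exact hu.comp_measurable hX₀
  obtain ⟨g, hg, hgeq⟩ := (stronglyMeasurable_condExp (μ := P) (f := fun ω => u (X₀ ω))
    (m := MeasurableSpace.comap (Z t) inferInstance)).measurable.exists_eq_measurable_comp
  set y := Z t ω with hy
  set K := Icc (clusterLeft μ u y t) (clusterRight μ u y t) with hK
  have hS : Z t ⁻¹' {y} = X₀ ⁻¹' K := by
    ext ω'
    simp only [mem_preimage, mem_singleton_iff, hZ]
    exact hp.flow_eq_iff_of_lt h hω
  have h1 := setIntegral_condExp (hm t).comap_le huX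
    (⟨_, measurableSet_singleton y, rfl⟩ :
      MeasurableSet[MeasurableSpace.comap (Z t) inferInstance] (Z t ⁻¹' {y}))
  have h2 : ∫ ω' in Z t ⁻¹' {y},
      (P[fun ω => u (X₀ ω) | MeasurableSpace.comap (Z t) inferInstance]) ω' ∂P =
      g y * μ.real K := by
    rw [hgeq, setIntegral_congr_fun (g := fun _ => g y) (hm t (measurableSet_singleton y))
      (fun ω' hω' => by rw [Function.comp_apply, show Z t ω' = y from hω']),
      setIntegral_const, smul_eq_mul, hS, Measure.real,
      ← Measure.map_apply hX₀ measurableSet_Icc, hlaw, mul_comm]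
    rfl
  have h3 : ∫ ω' in Z t ⁻¹' {y}, u (X₀ ω') ∂P = ∫ η in K, u η ∂μ := by
    rw [hS, ← setIntegral_map measurableSet_Icc (by rw [hlaw]; exact hu.aestronglyMeasurable)
      hX₀.aemeasurable, hlaw]
  rw [h2, h3] at h1
  rw [h.velocity_of_lt ht hω, setAverage_eq, smul_eq_mul, ← h1, hgeq, Function.comp_apply,
    ← hy, mul_comm, mul_assoc, mul_inv_cancel₀ (h.measureReal_Icc_pos hω).ne', mul_one]

/-- The conditional expectation of the initial velocity `u(X₀)` given `Z_t` is the velocity of `Z_t`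
from the first shock time on, and the conditional expectation given `Z_0` before. -/
theorem IsRepresentative.condExp_eq (hp : IsRepresentative μ u p) (h : Admissible μ u)
    (hX₀ : Measurable X₀) (hlaw : P.map X₀ = μ) (hZ : ∀ t ω, Z t ω = flow μ u t (p (X₀ ω)))
    (hu : Integrable u μ) (t : ℝ≥0) :
    P[fun ω => u (X₀ ω) | MeasurableSpace.comap (Z t) inferInstance] =ᵐ[P] fun ω =>
      {ω | shockTime μ u (X₀ ω) ≤ t}.indicator (fun ω => velocity μ u (Z t ω) t) ω +
      {ω | (t : ℝ≥0∞) < shockTime μ u (X₀ ω)}.indicator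
        (P[fun ω => u (X₀ ω) | MeasurableSpace.comap (Z 0) inferInstance]) ω := by
  have hm := hp.measurable_process h hX₀ hZ
  have hsf := hp.sigmaFinite_trim h hX₀ hlaw hZ t
  have hsf0 := hp.sigmaFinite_trim h hX₀ hlaw hZ 0
  have hsfX := sigmaFinite_trim_initial h hX₀ hlaw
  have huX : Integrable (fun ω => u (X₀ ω)) P := by
    rw [← hlaw] at hu
    exact hu.comp_measurable hX₀
  have hcl := h.measurable_clusterLeft t.coe_nonneg
  have hcr := h.measurable_clusterRight t.coe_nonneg
  have hZ0 : ∀ ω, Z 0 ω = p (X₀ ω) := fun ω => by rw [hZ, NNReal.coe_zero, h.flow_zero]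
  set E₁ : Set Ω := {ω | (t : ℝ≥0∞) < shockTime μ u (X₀ ω)} with hE₁
  have hE₁m := hp.measurableSet_lt h hZ t
  -- before the first shock, `Z_t` and `Z_0` determine each other
  have hae₁ : ∀ᵐ ω ∂P, ω ∈ E₁ →
      (P[fun ω => u (X₀ ω) | MeasurableSpace.comap (Z t) inferInstance]) ω =
      (P[fun ω => u (X₀ ω) | MeasurableSpace.comap (Z 0) inferInstance]) ω := by
    rw [← ae_restrict_iff' ((hm t).comap_le _ hE₁m)]
    refine condExp_ae_eq_restrict_of_eq_comp (hm t) (hm 0) hE₁m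
      (h.comap_process_anti hZ (zero_le : (0 : ℝ≥0) ≤ t) _ hE₁m) hcl
      (h.measurable_flow t.coe_nonneg) (fun ω hω => ?_) (fun ω _ => ?_)
    · rw [hZ0, hZ]; exact hp.eq_clusterLeft_of_lt h hω
    · rw [hZ0, hZ]
  -- after it, in a trivial cluster, `Z_t` and `X_0` determine each other
  set E₃ : Set Ω := {ω | shockTime μ u (X₀ ω) ≤ t ∧
    clusterLeft μ u (Z t ω) t = clusterRight μ u (Z t ω) t} with hE₃
  have hE₃eq : ∀ ω ∈ E₃, X₀ ω = clusterLeft μ u (Z t ω) t ∧ Z t ω = flow μ u t (X₀ ω) := by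
    rintro ω ⟨hω1, hω2⟩
    have e : Z t ω = flow μ u t (X₀ ω) := by rw [hZ, hp.flow_eq_of_le h hω1]
    rw [e] at hω2 ⊢
    exact ⟨(h.lo_eq_of_eq t.coe_nonneg hω2).symm, rfl⟩
  have hE₃m : MeasurableSet[MeasurableSpace.comap (Z t) inferInstance] E₃ := by
    have h1 : MeasurableSet[MeasurableSpace.comap (Z t) inferInstance]
        {ω | clusterLeft μ u (Z t ω) t = clusterRight μ u (Z t ω) t} :=
      ⟨_, measurableSet_eq_fun hcl hcr, rfl⟩
    have h2 : E₃ = E₁ᶜ ∩ {ω | clusterLeft μ u (Z t ω) t = clusterRight μ u (Z t ω) t} := by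
      ext ω; simp [hE₃, hE₁]
    rw [h2]
    exact hE₁m.compl.inter h1
  have hae₃ : ∀ᵐ ω ∂P, ω ∈ E₃ →
      (P[fun ω => u (X₀ ω) | MeasurableSpace.comap (Z t) inferInstance]) ω = u (X₀ ω) := by
    rw [← ae_restrict_iff' ((hm t).comap_le _ hE₃m)]
    have hZX : MeasurableSpace.comap (Z t) inferInstance ≤
        MeasurableSpace.comap X₀ inferInstance := by
      rw [show Z t = (fun a => flow μ u t (p a)) ∘ X₀ from funext (hZ t),
        ← MeasurableSpace.comap_comp]
      exact MeasurableSpace.comap_mono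
        ((h.measurable_flow t.coe_nonneg).comp hp.measurable).comap_le
    have h1 := condExp_ae_eq_restrict_of_eq_comp (P := P) (f := fun ω => u (X₀ ω)) (hm t) hX₀ hE₃m
      (hZX _ hE₃m) hcl (h.measurable_flow t.coe_nonneg) (fun ω hω => (hE₃eq ω hω).1)
      (fun ω hω => (hE₃eq ω hω).2)
    have h2 : P[fun ω => u (X₀ ω) | MeasurableSpace.comap X₀ inferInstance] =ᵐ[P]
        fun ω => u (X₀ ω) := by
      refine condExp_of_aestronglyMeasurable' hX₀.comap_le ?_ huX
      have hum : AEStronglyMeasurable u (P.map X₀) := by rw [hlaw]; exact hu.aestronglyMeasurable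
      refine ⟨hum.mk u ∘ X₀, ?_, ae_of_ae_map hX₀.aemeasurable hum.ae_eq_mk⟩
      exact hum.stronglyMeasurable_mk.comp_measurable (comap_measurable X₀)
    filter_upwards [h1, ae_restrict_of_ae h2] with ω hω1 hω2
    rw [hω1, hω2]
  filter_upwards [hae₁, hae₃, ae_velocity_zero_eq h hX₀ hlaw] with ω hω1 hω3 hω0
  rcases lt_or_ge (t : ℝ≥0∞) (shockTime μ u (X₀ ω)) with hlt | hge
  · rw [indicator_of_notMem (show ω ∉ {ω | shockTime μ u (X₀ ω) ≤ t} from not_le.2 hlt),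
      indicator_of_mem (show ω ∈ E₁ from hlt), zero_add]
    exact hω1 hlt
  · rw [indicator_of_mem (show ω ∈ {ω | shockTime μ u (X₀ ω) ≤ t} from hge),
      indicator_of_notMem (show ω ∉ E₁ from not_lt.2 hge), add_zero]
    rcases (h.clusterLeft_le_clusterRight t.coe_nonneg (Z t ω)).eq_or_lt with heq | hclt
    · have hmem : ω ∈ E₃ := ⟨hge, heq⟩
      rw [hω3 hmem]
      have hZX := (hE₃eq ω hmem).2
      rcases eq_zero_or_pos t with rfl | ht
      · rw [hZX, NNReal.coe_zero, h.flow_zero, hω0]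
      · rw [hZX] at heq ⊢
        exact (h.velocity_of_eq (NNReal.coe_pos.2 ht) (h.lo_eq_of_eq t.coe_nonneg heq)
          (h.hi_eq_of_eq t.coe_nonneg heq)).symm
    · exact hp.condExp_eq_velocity_of_lt h hX₀ hlaw hZ hu t ω hclt

end Velocity

/-! ### Adaptedness and path properties -/

section Paths

variable {μ : Measure ℝ} {u : ℝ → ℝ} {p : ℝ → ℝ}
variable {Ω : Type*} {X₀ : Ω → ℝ} {Z : ℝ≥0 → Ω → ℝ}

theorem IsRepresentative.velocity_of_lt_shockTime (hp : IsRepresentative μ u p)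
    (h : Admissible μ u) (hZ : ∀ t ω, Z t ω = flow μ u t (p (X₀ ω))) {t : ℝ≥0} {ω : Ω}
    (ht : (t : ℝ≥0∞) < shockTime μ u (X₀ ω)) : velocity μ u (Z t ω) t = u (p (X₀ ω)) := by
  rw [hZ]
  exact h.velocity_eq_of_lt_shockTime (by rwa [hp.shockTime_eq h])

theorem Admissible.measurable_comap_velocity (h : Admissible μ u) (t : ℝ≥0) :
    Measurable[MeasurableSpace.comap (Z t) inferInstance] fun ω => velocity μ u (Z t ω) t :=
  (h.measurable_velocity t.coe_nonneg).comp (comap_measurable (Z t))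

theorem IsRepresentative.measurable_indicator_initial (hp : IsRepresentative μ u p)
    (h : Admissible μ u) (hZ : ∀ t ω, Z t ω = flow μ u t (p (X₀ ω))) (t : ℝ≥0) {V : Ω → ℝ}
    (hV : Measurable[MeasurableSpace.comap (Z 0) inferInstance] V) :
    Measurable[MeasurableSpace.comap (Z t) inferInstance]
      ({ω | (t : ℝ≥0∞) < shockTime μ u (X₀ ω)}.indicator V) := by
  refine measurable_comap_indicator (W := Z 0) (hp.measurableSet_lt h hZ t)
    (h.measurable_clusterLeft t.coe_nonneg) (fun ω hω => ?_) hV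
  rw [hZ, NNReal.coe_zero, h.flow_zero, hZ]
  exact hp.eq_clusterLeft_of_lt h hω

variable [m0 : MeasurableSpace Ω] {P : Measure Ω}

/-- The velocity after the first shock, completed by a constant before it, has càdlàg paths; at
time `0` this is Lebesgue's differentiation theorem. -/
theorem IsRepresentative.ae_isCadlag (hp : IsRepresentative μ u p) (h : Admissible μ u)
    (hX₀ : Measurable X₀) (hlaw : P.map X₀ = μ) (hZ : ∀ t ω, Z t ω = flow μ u t (p (X₀ ω)))
    (W : Ω → ℝ) :
    ∀ᵐ ω ∂P, IsCadlag fun t : ℝ≥0 =>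
      {ω | shockTime μ u (X₀ ω) ≤ t}.indicator (fun ω => velocity μ u (Z t ω) t) ω +
      {ω | (t : ℝ≥0∞) < shockTime μ u (X₀ ω)}.indicator W ω := by
  have hL := h.ae_tendsto_average
  rw [← hlaw] at hL
  filter_upwards [ae_of_ae_map hX₀.aemeasurable hL] with ω hω
  rw [hlaw] at hω
  refine isCadlag_of_const_before (γ := shockTime μ u (X₀ ω)) (c := W ω)
    (v := fun t : ℝ≥0 => velocity μ u (flow μ u t (X₀ ω)) t) (fun t ht => ?_) (fun t ht => ?_)
    (fun t _ => ?_) (fun t ht => ?_)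
  · rw [indicator_of_notMem (show ω ∉ {ω | shockTime μ u (X₀ ω) ≤ t} from not_le.2 ht),
      indicator_of_mem (show ω ∈ {ω | (t : ℝ≥0∞) < shockTime μ u (X₀ ω)} from ht), zero_add]
  · rw [indicator_of_mem (show ω ∈ {ω | shockTime μ u (X₀ ω) ≤ t} from ht),
      indicator_of_notMem (show ω ∉ {ω | (t : ℝ≥0∞) < shockTime μ u (X₀ ω)} from not_lt.2 ht),
      add_zero, hZ, hp.flow_eq_of_le h ht]
  · rcases eq_zero_or_pos t with rfl | ht
    · have h1 := h.velocity_tendsto_zero hω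
      simp only [NNReal.coe_zero, h.flow_zero]
      rw [h.velocity_zero_eq hω]
      exact h1.comp (by simpa using tendsto_coe_nhdsGT 0)
    · exact (h.velocity_tendsto_time_right (NNReal.coe_pos.2 ht) _).comp (tendsto_coe_nhdsGT t)
  · have ht0 : 0 < t := ENNReal.coe_pos.1 (lt_of_le_of_lt zero_le ht)
    obtain ⟨l, hl⟩ := h.exists_tendsto_velocity_left (NNReal.coe_pos.2 ht0) (X₀ ω)
    exact ⟨l, hl.comp (tendsto_coe_nhdsLT t)⟩

end Paths

end Sticky

end

open Sticky in
theorem mainTheorem1 {Ω : Type*} [MeasurableSpace Ω] (P : Measure Ω)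
    (μ₀ : Measure ℝ) (u₀ : ℝ → ℝ) (h₀ : Sticky.Admissible μ₀ u₀)
    (X₀ : Ω → ℝ) (hX₀ : Measurable X₀) (hlaw : P.map X₀ = μ₀)
    (Z : ℝ≥0 → Ω → ℝ)
    (hZ : Z = Sticky.Z1 μ₀ u₀ X₀ ∨ Z = Sticky.Z2 μ₀ u₀ X₀ ∨
      Z = Sticky.Z3 μ₀ u₀ X₀ ∨ Z = Sticky.Z4 μ₀ u₀ X₀)
    (γ : Ω → ℝ≥0∞) (hγ : ∀ ω, γ ω = Sticky.shockTime μ₀ u₀ (X₀ ω))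
    (U : ℝ≥0 → Ω → ℝ) (hU : ∀ t ω, U t ω = Sticky.velocity μ₀ u₀ (Z t ω) t) :
    -- the process is well defined and Markov
    (∀ t, Measurable (Z t)) ∧ Sticky.IsMarkov Z P ∧
    -- the velocity before the first shock time
    Sticky.IsAdapted (fun t => {ω | (t : ℝ≥0∞) < γ ω}.indicator (U t)) (Sticky.future Z) ∧
    (∀ᵐ ω ∂P, BoundedVariationOn
      (fun t : ℝ≥0 => {ω' | (t : ℝ≥0∞) < γ ω'}.indicator (U t) ω) univ) ∧
    (Integrable u₀ μ₀ →
      -- the velocity after the first shock time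
      Sticky.IsBackwardCadlagSemimartingale
        (fun t => {ω | γ ω ≤ (t : ℝ≥0∞)}.indicator (U t)) (Sticky.future Z) P ∧
      Sticky.IsBackwardMartingale
        (fun t ω => {ω' | γ ω' ≤ (t : ℝ≥0∞)}.indicator (U t) ω +
          {ω' | (t : ℝ≥0∞) < γ ω'}.indicator
            (P[fun ω' => u₀ (X₀ ω') | MeasurableSpace.comap (Z 0) inferInstance]) ω)
        (Sticky.future Z) P ∧
      -- the velocity at all times
      Sticky.IsBackwardCadlagSemimartingale U (Sticky.future Z) P ∧
      Sticky.IsBackwardMartingale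
        (fun t ω => U t ω -
          {ω' | (t : ℝ≥0∞) < γ ω'}.indicator
            (fun ω' => u₀ (Z 0 ω') -
              (P[fun ω'' => u₀ (X₀ ω'') | MeasurableSpace.comap (Z 0) inferInstance]) ω') ω)
        (Sticky.future Z) P) := by
  obtain ⟨p, hp, hZp⟩ := h₀.exists_isRepresentative X₀ Z hZ
  obtain rfl : γ = fun ω => shockTime μ₀ u₀ (X₀ ω) := funext hγ
  obtain rfl : U = fun t ω => velocity μ₀ u₀ (Z t ω) t := funext fun t => funext (hU t)
  have hm := hp.measurable_process h₀ hX₀ hZp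
  have hbefore : ∀ {t : ℝ≥0} {ω}, (t : ℝ≥0∞) < shockTime μ₀ u₀ (X₀ ω) →
      velocity μ₀ u₀ (Z t ω) t = u₀ (p (X₀ ω)) := fun ht => hp.velocity_of_lt_shockTime h₀ hZp ht
  have hEm := hp.measurableSet_lt h₀ hZp
  have hadapt : ∀ t : ℝ≥0, Measurable[MeasurableSpace.comap (Z t) inferInstance]
      ({ω | (t : ℝ≥0∞) < shockTime μ₀ u₀ (X₀ ω)}.indicator
        fun ω => velocity μ₀ u₀ (Z t ω) t) := fun t =>
    (h₀.measurable_comap_velocity t).indicator (hEm t)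
  rw [h₀.future_eq hZp]
  refine ⟨hm, hp.isMarkov h₀ hX₀ hlaw hZp, hadapt, Eventually.of_forall fun ω => ?_, fun hu => ?_⟩
  · exact boundedVariationOn_step (γ := shockTime μ₀ u₀ (X₀ ω)) (c := u₀ (p (X₀ ω)))
      (fun t ht => (indicator_of_mem (show ω ∈ {ω | (t : ℝ≥0∞) < shockTime μ₀ u₀ (X₀ ω)} from ht)
        _).trans (hbefore ht))
      (fun t ht => indicator_of_notMem
        (show ω ∉ {ω | (t : ℝ≥0∞) < shockTime μ₀ u₀ (X₀ ω)} from not_lt.2 ht) _)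
  set W := P[fun ω => u₀ (X₀ ω) | MeasurableSpace.comap (Z 0) inferInstance] with hW
  have hWm : Measurable[MeasurableSpace.comap (Z 0) inferInstance] W :=
    stronglyMeasurable_condExp.measurable
  set M : ℝ≥0 → Ω → ℝ := fun t ω =>
    {ω | shockTime μ₀ u₀ (X₀ ω) ≤ t}.indicator (fun ω => velocity μ₀ u₀ (Z t ω) t) ω +
      {ω | (t : ℝ≥0∞) < shockTime μ₀ u₀ (X₀ ω)}.indicator W ω with hM
  have hcond : ∀ t, P[fun ω => u₀ (X₀ ω) | MeasurableSpace.comap (Z t) inferInstance] =ᵐ[P] M t :=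
    hp.condExp_eq h₀ hX₀ hlaw hZp hu
  have hcadlag : ∀ᵐ ω ∂P, IsCadlag fun t => M t ω := hp.ae_isCadlag h₀ hX₀ hlaw hZp W
  have hWt := fun t => hp.measurable_indicator_initial h₀ hZp t hWm
  have hmart : IsBackwardMartingale M (fun t => MeasurableSpace.comap (Z t) inferInstance) P :=
    { adapted := fun t => by
        refine Measurable.add ?_ (hWt t)
        refine (h₀.measurable_comap_velocity t).indicator ?_
        have : {ω | shockTime μ₀ u₀ (X₀ ω) ≤ t} = {ω | (t : ℝ≥0∞) < shockTime μ₀ u₀ (X₀ ω)}ᶜ := by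
          ext ω; simp
        rw [this]
        exact (hEm t).compl
      integrable := fun t => integrable_condExp.congr (hcond t)
      condExp_eq := fun s t hst => by
        have hsf := hp.sigmaFinite_trim h₀ hX₀ hlaw hZp s
        exact (condExp_congr_ae (hcond s).symm).trans
          ((condExp_condExp_of_le (h₀.comap_process_anti hZp hst) (hm s).comap_le).trans
            (hcond t)) }
  -- a process which is constant before the first shock and vanishes afterwards
  have hstep : ∀ (V : ℝ≥0 → Ω → ℝ) (c : Ω → ℝ),
      (∀ (t : ℝ≥0) ω, (t : ℝ≥0∞) < shockTime μ₀ u₀ (X₀ ω) → V t ω = c ω) →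
      (∀ (t : ℝ≥0) ω, shockTime μ₀ u₀ (X₀ ω) ≤ t → V t ω = 0) →
      (∀ᵐ ω ∂P, IsCadlag fun t => V t ω) ∧
        ∀ᵐ ω ∂P, LocallyBoundedVariationOn (fun t => V t ω) univ := fun V c h1 h2 =>
    ⟨Eventually.of_forall fun ω => isCadlag_step (fun t ht => h1 t ω ht) (fun t ht => h2 t ω ht),
      Eventually.of_forall fun ω => (boundedVariationOn_step (fun t ht => h1 t ω ht)
        (fun t ht => h2 t ω ht)).locallyBoundedVariationOn⟩
  refine ⟨?_, hmart, ?_, ?_⟩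
  · obtain ⟨h1, h2⟩ := hstep
      (fun t ω => -{ω | (t : ℝ≥0∞) < shockTime μ₀ u₀ (X₀ ω)}.indicator W ω) (fun ω => -W ω)
      (fun t ω ht => by
        rw [indicator_of_mem (show ω ∈ {ω | (t : ℝ≥0∞) < shockTime μ₀ u₀ (X₀ ω)} from ht)])
      (fun t ω ht => by
        rw [indicator_of_notMem (show ω ∉ {ω | (t : ℝ≥0∞) < shockTime μ₀ u₀ (X₀ ω)} from
          not_lt.2 ht), neg_zero])
    refine ⟨M, _, hmart, hcadlag, fun t => (hWt t).neg, h1, h2, fun t ω => ?_⟩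
    simp only [hM, Pi.neg_apply]; ring
  · obtain ⟨h1, h2⟩ := hstep
      (fun t ω => {ω | (t : ℝ≥0∞) < shockTime μ₀ u₀ (X₀ ω)}.indicator
          (fun ω => velocity μ₀ u₀ (Z t ω) t) ω -
        {ω | (t : ℝ≥0∞) < shockTime μ₀ u₀ (X₀ ω)}.indicator W ω)
      (fun ω => u₀ (p (X₀ ω)) - W ω)
      (fun t ω ht => by
        have hmem : ω ∈ {ω | (t : ℝ≥0∞) < shockTime μ₀ u₀ (X₀ ω)} := ht
        simp only [indicator_of_mem hmem, hbefore ht])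
      (fun t ω ht => by
        have hmem : ω ∉ {ω | (t : ℝ≥0∞) < shockTime μ₀ u₀ (X₀ ω)} := not_lt.2 ht
        simp only [indicator_of_notMem hmem, sub_zero])
    refine ⟨M, _, hmart, hcadlag, fun t => (hadapt t).sub (hWt t), h1, h2, fun t ω => ?_⟩
    rcases lt_or_ge (t : ℝ≥0∞) (shockTime μ₀ u₀ (X₀ ω)) with ht | ht
    · have hmem : ω ∈ {ω | (t : ℝ≥0∞) < shockTime μ₀ u₀ (X₀ ω)} := ht
      have hmem' : ω ∉ {ω | shockTime μ₀ u₀ (X₀ ω) ≤ t} := not_le.2 ht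
      simp only [hM, indicator_of_mem hmem, indicator_of_notMem hmem', Pi.sub_apply]; ring
    · have hmem : ω ∉ {ω | (t : ℝ≥0∞) < shockTime μ₀ u₀ (X₀ ω)} := not_lt.2 ht
      have hmem' : ω ∈ {ω | shockTime μ₀ u₀ (X₀ ω) ≤ t} := ht
      simp only [hM, indicator_of_mem hmem', indicator_of_notMem hmem, Pi.sub_apply]; ring
  · convert hmart using 3 with t ω
    rcases lt_or_ge (t : ℝ≥0∞) (shockTime μ₀ u₀ (X₀ ω)) with ht | ht
    · have hmem : ω ∈ {ω | (t : ℝ≥0∞) < shockTime μ₀ u₀ (X₀ ω)} := ht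
      have hmem' : ω ∉ {ω | shockTime μ₀ u₀ (X₀ ω) ≤ t} := not_le.2 ht
      have hZ0 : Z 0 ω = p (X₀ ω) := by rw [hZp, NNReal.coe_zero, h₀.flow_zero]
      simp only [hM, indicator_of_mem hmem, indicator_of_notMem hmem', hbefore ht, hZ0]; ring
    · have hmem : ω ∉ {ω | (t : ℝ≥0∞) < shockTime μ₀ u₀ (X₀ ω)} := not_lt.2 ht
      have hmem' : ω ∈ {ω | shockTime μ₀ u₀ (X₀ ω) ≤ t} := ht
      simp only [hM, indicator_of_mem hmem', indicator_of_notMem hmem]; ring
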